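/- All polynomials are over $\mathbb{C}$. An arithmetic circuit is a finite acyclic directed graph with vertices of in-degree $0$ (inputs, labelled by a variable or a constant of $\mathbb{C}$) or $2$ (labelled by $+$ or $\times$) and exactly one vertex of out-degree $0$; its size is the number of its vertices. It is weakly-skew if for each $\times$-gate $\alpha$ at least one of the two vertices pointing to $\alpha$ is computed by a separate subcircuit $C_\alpha$, i.e. the edge connecting $C_\alpha$ to $\alpha$ is the only edge between a vertex of $C_\alpha$ and the remainder of the circuit. Let $L(f)$ (resp. $L_{\mathrm{ws}}(f)$) be the minimum size of an arithmetic circuit (resp. a weakly-skew arithmetic circuit) computing $f$. Give $A=\mathbb{C}[X_1,X_2,\ldots]$ the limit of the Euclidean topologies on the finite-dimensional subspaces $\{f\in\mathbb{C}[X_1,\ldots,X_n] : \deg f\le d\}$. The approximate complexity $\underline{L}_{\mathrm{ws}}(f)$ of $f \in A$ is the minimum $r\in\mathbb{N}$ such that $f$ lies in the closure of $\{g\in A : L_{\mathrm{ws}}(g)\le r\}$. The class $\overline{\mathrm{VP}_{\mathrm{ws}}}$ is the set of sequences $(f_n)$ in $A$ such that $\underline{L}_{\mathrm{ws}}(f_n)$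 is polynomially bounded in $n$. The class $\mathrm{VP}$ consists of the sequences $(g_n)$ of polynomials such that $L(g_n)$ and $\deg g_n$ are polynomially bounded in $n$, and $\mathrm{VNP}$ consists of the sequences $(f_n)$ in $A$ for which there are a polynomial $p$ and a sequence $(g_n)\in\mathrm{VP}$ with $f_n(x)=\sum_{e\in\{0,1\}^{p(n)}} g_n(x,e)$ for all $n$. Let $\det_n$ and $\mathrm{perm}_m$ denote the determinant of the $n\times n$ and the permanent of the $m\times m$ matrix of variables. For $n\ge m$, regard $\ell^{n-m}\mathrm{perm}_m$ as a form of degree $n$ in the $n^2$ entries of an $n\times n$ matrix, where $\mathrm{perm}_m$ is the permanent of the upper left $m\times m$ block and $\ell$ is the lower right entry (which lies outside that block if $n>m$). The group $GL_{n^2}$ acts by linear substitution of the variables on the projective space $\mathbb{P}(S^n\mathbb{C}^{n^2})$ of forms of degree $n$ in $n^2$ variables, and bars over orbits denote Zariski closures in this space. The Mulmuley–Sohoni conjecture is the statement: there does not exist an integer constant $c\ge1$ such that for all sufficiently large $m$, $$\overline{GL_{m^{2c}}\cdot[\ell^{m^c-m}\mathrm{perm}_m]}\subset\overline{GL_{m^{2c}}\cdot[\det\nolimits_{m^c}]}.$$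 **Proposition.** The Mulmuley–Sohoni conjecture is equivalent to $(\mathrm{perm}_m)\notin\overline{\mathrm{VP}_{\mathrm{ws}}}$, and it is also equivalent to $\mathrm{VNP}\not\subseteq\overline{\mathrm{VP}_{\mathrm{ws}}}$. -/

import Mathlib

open MvPolynomial Filter
open scoped LinearAlgebra.Projectivization MatrixGroups

noncomputable section

namespace GCT

/-! ### Arithmetic circuits -/

/-- Labels of the vertices of an arithmetic circuit with variables in `σ` and vertex set `V`.
Vertices of in-degree `0` carry a constant or a variable; a computation gate records the sources of
its two incoming edges (which may coincide, giving a double edge). -/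
inductive Node (σ : Type*) (V : Type*) where
  | const (c : ℂ) : Node σ V
  | var (x : σ) : Node σ V
  | add (a b : V) : Node σ V
  | mul (a b : V) : Node σ V

/-- `a` is the source of one of the edges pointing to a vertex with the given label. -/
def Node.HasInput {σ V : Type*} : Node σ V → V → Prop
  | .const _, _ => False
  | .var _, _ => False
  | .add a b, v => v = a ∨ v = b
  | .mul a b, v => v = a ∨ v = b

/-- An arithmetic circuit over `ℂ`: a finite acyclic directed graph, with vertices of in-degree
`0` or `2`, and with exactly one vertex `out` of out-degree `0`. -/
structure Circuit (σ : Type*) where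
  V : Type
  fintypeV : Fintype V
  gate : V → Node σ V
  acyclic : ∀ v, ¬ Relation.TransGen (fun a b => (gate b).HasInput a) v v
  out : V
  outdegree_zero_iff : ∀ v, (∀ w, ¬ (gate w).HasInput v) ↔ v = out

namespace Circuit

variable {σ : Type*} (C : Circuit σ)

/-- There is an edge from `a` to `b`. -/
def Edge (a b : C.V) : Prop := (C.gate b).HasInput a

/-- The size is the number of vertices. -/
def size : ℕ := @Fintype.card C.V C.fintypeV

theorem wellFounded_edge : WellFounded C.Edge := by
  have := C.fintypeV
  have : Std.Irrefl (Relation.TransGen C.Edge) := ⟨C.acyclic⟩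
  have : IsTrans C.V (Relation.TransGen C.Edge) := ⟨fun _ _ _ h h' => h.trans h'⟩
  exact Subrelation.wf (fun h => Relation.TransGen.single h)
    (Finite.wellFounded_of_trans_of_irrefl (Relation.TransGen C.Edge))

/-- The polynomial computed at a vertex, by recursion along the edges. -/
def value : C.V → MvPolynomial σ ℂ :=
  C.wellFounded_edge.fix fun v ih =>
    match h : C.gate v with
    | .const c => MvPolynomial.C c
    | .var x => X x
    | .add a b => ih a (by simp [Edge, h, Node.HasInput]) + ih b (by simp [Edge, h, Node.HasInput])
    | .mul a b => ih a (by simp [Edge, h, Node.HasInput]) * ih b (by simp [Edge, h, Node.HasInput])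

theorem value_eq (v : C.V) : C.value v =
    match C.gate v with
    | .const c => MvPolynomial.C c
    | .var x => X x
    | .add a b => C.value a + C.value b
    | .mul a b => C.value a * C.value b := by
  conv_lhs => rw [value, WellFounded.fix_eq]
  split <;> rename_i h <;> simp only [h] <;> rfl

/-- The polynomial computed by the circuit. -/
def poly : MvPolynomial σ ℂ := C.value C.out

/-- `InSub a v`: the vertex `v` belongs to the subcircuit computing the vertex `a`, that is, there is
a directed path (possibly of length `0`) from `v` to `a`. -/
def InSub (a v : C.V) : Prop := Relation.ReflTransGen C.Edge v a

/-- For a gate `α` whose two incoming edges start at `a` and `b`: the vertex `a` is computed by a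
separate subcircuit, i.e. the edge from `a` to `α` is the only edge between a vertex of the
subcircuit computing `a` and the remainder of the circuit. The condition `a ≠ b` says that this edge
is not a double edge. (There is never an edge from the remainder into the subcircuit.) -/
def IsSeparate (α a b : C.V) : Prop :=
  a ≠ b ∧ ∀ v w, C.InSub a v → ¬ C.InSub a w → C.Edge v w → v = a ∧ w = α

/-- Each multiplication gate has at least one operand that is computed by a separate subcircuit. -/
def WeaklySkew : Prop :=
  ∀ α a b, C.gate α = .mul a b → C.IsSeparate α a b ∨ C.IsSeparate α b a

end Circuit

/-! ### Complexity -/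

/-- The complexity `L(f)`: the minimum size of an arithmetic circuit computing `f`. -/
def complexity {σ : Type*} (f : MvPolynomial σ ℂ) : ℕ :=
  sInf {r | ∃ C : Circuit σ, C.poly = f ∧ C.size = r}

/-- The complexity `L_ws(f)`: the minimum size of a weakly-skew arithmetic circuit computing `f`. -/
def wsComplexity {σ : Type*} (f : MvPolynomial σ ℂ) : ℕ :=
  sInf {r | ∃ C : Circuit σ, C.WeaklySkew ∧ C.poly = f ∧ C.size = r}

/-- The polynomial ring `ℂ[X₀, X₁, X₂, …]`. -/
abbrev A : Type := MvPolynomial ℕ ℂ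

/-- The finite-dimensional space of polynomials of degree at most `d` in the first `n` variables. -/
def boundedPart (n d : ℕ) : Set A := {f | (∀ i ∈ f.vars, i < n) ∧ f.totalDegree ≤ d}

/-- The Euclidean topology on `boundedPart n d`: the topology of convergence of all coefficients. -/
@[reducible]
def boundedPartTopology (n d : ℕ) : TopologicalSpace (boundedPart n d) :=
  TopologicalSpace.induced (fun f (s : ℕ →₀ ℕ) => coeff s (f : A)) Pi.topologicalSpace

/-- The limit of the Euclidean topologies: a set of polynomials is open if and only if its trace on
each `boundedPart n d` is open. -/
@[reducible]
def polyTopology : TopologicalSpace A :=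
  ⨆ n : ℕ, ⨆ d : ℕ, TopologicalSpace.coinduced Subtype.val (boundedPartTopology n d)

/-- The approximate complexity of `f`: the minimum `r` such that `f` lies in the closure of
the set of polynomials of weakly-skew complexity at most `r`. -/
def approxWsComplexity (f : A) : ℕ :=
  sInf {r | f ∈ @closure A polyTopology {g | wsComplexity g ≤ r}}

/-! ### Complexity classes -/

/-- `t` is polynomially bounded. -/
def PolyBounded (t : ℕ → ℕ) : Prop := ∃ q : Polynomial ℕ, ∀ n, t n ≤ q.eval n

/-- The sequence `(g n)` belongs to VP; the set of variables may depend on `n`. -/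
def IsVP {τ : ℕ → Type} (g : (n : ℕ) → MvPolynomial (τ n) ℂ) : Prop :=
  PolyBounded (fun n => complexity (g n)) ∧ PolyBounded (fun n => (g n).totalDegree)

/-- The class VNP: `f n (x) = ∑ g n (x, e)`, the sum being over `e ∈ {0, 1} ^ p(n)`, for
a polynomial `p` and a sequence `(g n)` in VP. The variables of `g n` are those of `A` together with
`p(n)` further ones. -/
def VNP : Set (ℕ → A) :=
  {f | ∃ (p : Polynomial ℕ) (g : (n : ℕ) → MvPolynomial (ℕ ⊕ Fin (p.eval n)) ℂ), IsVP g ∧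
    ∀ n, f n = ∑ e : Fin (p.eval n) → Bool,
      aeval (Sum.elim X fun i => if e i then 1 else 0) (g n)}

/-- The closure of the class VP_ws. -/
def VPwsClosure : Set (ℕ → A) := {f | PolyBounded fun n => approxWsComplexity (f n)}

/-! ### Determinant and permanent -/

/-- The permanent of the `m × m` matrix of variables. -/
def perm (m : ℕ) : MvPolynomial (Fin m × Fin m) ℂ :=
  (Matrix.mvPolynomialX (Fin m) (Fin m) ℂ).permanent

/-- The determinant of the `n × n` matrix of variables. -/
def det (n : ℕ) : MvPolynomial (Fin n × Fin n) ℂ :=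
  (Matrix.mvPolynomialX (Fin n) (Fin n) ℂ).det

/-- The sequence of permanents in `A`: the `m ^ 2` variables of the `m`-th permanent are
numbered row by row. -/
def permSeq (m : ℕ) : A := rename (fun ij => (finProdFinEquiv ij : ℕ)) (perm m)

/-- A linear form: the variable in the lower right corner of an `n × n` matrix. -/
def ell (n : ℕ) : MvPolynomial (Fin n × Fin n) ℂ :=
  if h : 0 < n then X (⟨n - 1, by omega⟩, ⟨n - 1, by omega⟩) else 0

/-- The padded permanent `ℓ ^ (n - m) * perm m`, where the `m × m` matrices are placed in the upper
left corner of the `n × n` matrices. If `m < n` then `ℓ` does not occur in this copy of `perm m`. -/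
def paddedPerm {m n : ℕ} (h : m ≤ n) : MvPolynomial (Fin n × Fin n) ℂ :=
  ell n ^ (n - m) * rename (Prod.map (Fin.castLE h) (Fin.castLE h)) (perm m)

/-! ### Projective orbit closures -/

/-- `S^d W` for the space `W` with basis the variables in `N`: homogeneous polynomials of
degree `d`. -/
abbrev Form (N : Type) (d : ℕ) : Type := homogeneousSubmodule N ℂ d

section Action

variable {N : Type} [Fintype N]

/-- The linear substitution `X k ↦ ∑ j, g j k • X j`, which is the action of the matrix `g` on `W`
in the basis of variables, extended to polynomials. -/
def subst (g : Matrix N N ℂ) : MvPolynomial N ℂ →ₐ[ℂ] MvPolynomial N ℂ :=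
  aeval fun k => ∑ j, C (g j k) * X j

theorem subst_isHomogeneous (g : Matrix N N ℂ) {d : ℕ} {f : MvPolynomial N ℂ}
    (hf : f.IsHomogeneous d) : (subst g f).IsHomogeneous d := by
  have := hf.aeval (n := 1) (fun k => ∑ j, C (g j k) * X j : N → MvPolynomial N ℂ) fun k =>
    IsHomogeneous.sum _ _ _ fun j _ => by
      simpa using (isHomogeneous_C N (g j k)).mul (isHomogeneous_X ℂ j)
  simpa [subst] using this

theorem subst_mul (g h : Matrix N N ℂ) (f : MvPolynomial N ℂ) :
    subst (g * h) f = subst g (subst h f) := by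
  have : subst (g * h) = (subst g).comp (subst h) := by
    ext1 k
    simp only [subst, Matrix.mul_apply, aeval_X, AlgHom.comp_apply, map_sum, map_mul, algHom_C,
      algebraMap_eq, Finset.sum_mul, Finset.mul_sum]
    rw [Finset.sum_comm]
    exact Finset.sum_congr rfl fun _ _ => Finset.sum_congr rfl fun _ _ => by ring
  simp [this]

variable [DecidableEq N]

theorem subst_one (f : MvPolynomial N ℂ) : subst (1 : Matrix N N ℂ) f = f := by
  have : subst (1 : Matrix N N ℂ) = AlgHom.id ℂ _ := by
    ext1 k
    simp [subst, Matrix.one_apply]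
  simp [this]

/-- The linear action of `GL(W)` on `S^d W`. -/
instance formSMul (d : ℕ) : SMul (GL N ℂ) (Form N d) where
  smul g f := ⟨subst g.val f.val, subst_isHomogeneous _ f.2⟩

theorem coe_smul_form {d : ℕ} (g : GL N ℂ) (f : Form N d) :
    (g • f).val = subst g.val f.val := rfl

instance formAction (d : ℕ) : DistribMulAction (GL N ℂ) (Form N d) where
  one_smul f := Subtype.ext <| by rw [coe_smul_form, Units.val_one, subst_one]
  mul_smul g h f := Subtype.ext <| by
    rw [coe_smul_form, coe_smul_form, coe_smul_form, Units.val_mul, subst_mul]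
  smul_zero g := Subtype.ext <| by
    rw [coe_smul_form]
    exact map_zero (subst g.val)
  smul_add g f₁ f₂ := Subtype.ext <| by
    rw [coe_smul_form]
    exact map_add (subst g.val) f₁.val f₂.val

instance formAction_smulCommClass (d : ℕ) : SMulCommClass (GL N ℂ) ℂ (Form N d) where
  smul_comm g c f := Subtype.ext <| by
    rw [coe_smul_form]
    exact map_smul (subst g.val) c f.val

end Action

/-- The Zariski closure of a subset `S` of the projective space `ℙ V`: the common zeros of all
homogeneous elements of `Sym(V^*)` that vanish on `S`. -/
def zariskiClosure {V : Type} [AddCommGroup V] [Module ℂ V] (S : Set (ℙ ℂ V)) : Set (ℙ ℂ V) :=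
  {p | ∀ (d : ℕ) (F : MvPolynomial (Module.Dual ℂ V) ℂ), F.IsHomogeneous d →
    (∀ q ∈ S, eval (fun φ => φ q.rep) F = 0) → eval (fun φ => φ p.rep) F = 0}

/-- The closure of the orbit `GL(W) · x` in `ℙ (S^d W)`. -/
def orbitClosure {N : Type} [Fintype N] [DecidableEq N] {d : ℕ} (x : ℙ ℂ (Form N d)) :
    Set (ℙ ℂ (Form N d)) :=
  zariskiClosure (MulAction.orbit (GL N ℂ) x)

theorem perm_isHomogeneous (m : ℕ) : (perm m).IsHomogeneous m := by
  refine IsHomogeneous.sum _ _ _ fun σ _ => ?_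
  simpa using IsHomogeneous.prod Finset.univ
    (fun i => Matrix.mvPolynomialX (Fin m) (Fin m) ℂ (σ i) i) (fun _ => 1)
    fun i _ => isHomogeneous_X ℂ (σ i, i)

theorem perm_ne_zero (m : ℕ) : perm m ≠ 0 := by
  intro h
  have h1 : eval (fun ij : Fin m × Fin m => (1 : Matrix (Fin m) (Fin m) ℂ) ij.1 ij.2) (perm m)
      = (1 : Matrix (Fin m) (Fin m) ℂ).permanent := by
    simp [perm, Matrix.permanent, Matrix.mvPolynomialX_apply]
  rw [h, map_zero, Matrix.permanent_one] at h1
  exact zero_ne_one h1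

theorem det_isHomogeneous (n : ℕ) : (det n).IsHomogeneous n := by
  rw [det, Matrix.det_apply]
  refine IsHomogeneous.sum _ _ _ fun σ _ => ?_
  have h := IsHomogeneous.prod Finset.univ
    (fun i => Matrix.mvPolynomialX (Fin n) (Fin n) ℂ (σ i) i) (fun _ => 1)
    fun i _ => isHomogeneous_X ℂ (σ i, i)
  simp only [Finset.sum_const, Finset.card_univ, Fintype.card_fin, smul_eq_mul, mul_one] at h
  rcases Int.units_eq_one_or (Equiv.Perm.sign σ) with hs | hs
  · simpa [hs] using h
  · simpa [hs] using h.neg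

theorem paddedPerm_isHomogeneous {m n : ℕ} (h : m ≤ n) : (paddedPerm h).IsHomogeneous n := by
  have hl : (ell n).IsHomogeneous 1 := by
    unfold ell
    split
    · exact isHomogeneous_X ℂ _
    · exact isHomogeneous_zero _ _ _
  have := (hl.pow (n - m)).mul ((perm_isHomogeneous m).rename_isHomogeneous
    (f := Prod.map (Fin.castLE h) (Fin.castLE h)))
  rwa [one_mul, Nat.sub_add_cancel h] at this

theorem paddedPerm_ne_zero {m n : ℕ} (h : m ≤ n) : paddedPerm h ≠ 0 := by
  refine mul_ne_zero ?_ ?_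
  · rcases Nat.eq_zero_or_pos n with rfl | hn
    · simp
    · rw [ell, dif_pos hn]
      exact pow_ne_zero _ (X_ne_zero _)
  · have hi : Function.Injective (Prod.map (Fin.castLE h) (Fin.castLE h)) :=
      (Fin.castLE_injective h).prodMap (Fin.castLE_injective h)
    exact (map_ne_zero_iff _ (rename_injective _ hi)).2 (perm_ne_zero m)

/-- The point `[det n]` of `ℙ (S^n (ℂ^(n^2)))`. -/
def detPoint (n : ℕ) : ℙ ℂ (Form (Fin n × Fin n) n) :=
  Projectivization.mk ℂ ⟨det n, det_isHomogeneous n⟩ fun h =>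
    Matrix.det_mvPolynomialX_ne_zero (Fin n) ℂ (congrArg Subtype.val h)

/-- The point `[ℓ ^ (n - m) * perm m]` of `ℙ (S^n (ℂ^(n^2)))`. -/
def paddedPermPoint {m n : ℕ} (h : m ≤ n) : ℙ ℂ (Form (Fin n × Fin n) n) :=
  Projectivization.mk ℂ ⟨paddedPerm h, paddedPerm_isHomogeneous h⟩ fun h0 =>
    paddedPerm_ne_zero h (congrArg Subtype.val h0)

/-- The Mulmuley–Sohoni conjecture: there is no constant `c ≥ 1` such that, for all sufficiently
large `m`, the orbit closure of `[ℓ ^ (m ^ c - m) * perm m]` is contained in that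
of `[det (m ^ c)]`. -/
def MulmuleySohoniConjecture : Prop :=
  ¬ ∃ (c : ℕ) (hc : 1 ≤ c), ∀ᶠ m : ℕ in atTop,
    orbitClosure (paddedPermPoint (Nat.le_self_pow (Nat.one_le_iff_ne_zero.1 hc) m)) ⊆
      orbitClosure (detPoint (m ^ c))

end GCT

end

/-!
The proof has two independent halves: the Mulmuley–Sohoni conjecture is the statement that the
permanents do not belong to the closure of VP_ws, and the permanents belong to this closure if and
only if all of VNP does.

**Normal forms.** Circuits are first replaced by straight-line programs (`Prog`), weakly-skew
circuits by skew programs, in which one factor of each product is a constant or a variable. A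
polynomial has a skew program of polynomial length if and only if it is a determinant of
polynomial size with affine entries: a skew program is a triangular system of linear equations,
which is solved by Cramer's rule (`HasSkewProg.isAffineDet`), and a determinant is computed by
Berkowitz' recursion for the power series `det (1 - t M)` (`IsAffineDet.hasSkewProg`). Hence the
property of being a limit of polynomials with short skew programs (`HasApproxSkewProg`) is stable
under affine substitutions.

**The conjecture and the permanent.** If the padded permanent lies in the orbit closure of `det
n`, it is a Euclidean limit of forms `subst g (det n)`: the Zariski closure of the image of a
polynomial map is contained in its Euclidean closure (`exists_eval_near_of_forall_relation`). For
a point `y` of the Zariski closure one projects along a Noether normalization, moves the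
projection slightly to a point over which all homomorphisms extend, and lifts it back close to
`y`, because the roots of a monic polynomial depend continuously on its coefficients. Setting the
padding variable to `1` and the variables outside of the block to `0` shows that `perm m` is a
limit of small determinants. Conversely, homogenization with respect to the padding variable is a
linear, hence continuous, map that sends the determinants of `n × n` matrices with affine entries
to linear images of `det n` (`IsAffineDet.exists_subst_eq_homogenize`) and `perm m` to the padded
permanent. The equations of the orbit of `det n` vanish on these linear images, hence on the
limit.

**Completeness of the permanent.** Ryser's formula shows that the permanents belong to VNP. For
the converse (Valiant's theorem), call `P` representable by `N` factors (`Rep N P`) if it is a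
coefficient, with respect to auxiliary variables, of a product of `N` affine forms. Such a
coefficient is up to a factor the permanent of an `N × N` matrix with repeated rows
(`Rep.exists_permanent`). Representability is stable under affine substitutions, under passing to
a coefficient, and under multiplication by affine forms and by quadrics `y * y' - w`
(`Rep.quadric_mul`). If the degree of `P` in `z` is at most `D`, then `P` with `z` replaced by `Q`
is the coefficient of `z ^ D` in `P * ∑ i, Q ^ i * z ^ (D - i)`, and for `Q = y * y'` the sum is a
product of such quadrics over the roots of unity (`Rep.substNone_mul`). The sum over the values
`0` and `1` of `z` is treated in the same way (`Rep.substNone_add`). Thus one may replace the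
gates of a circuit by variables, one after the other. After splitting the results into homogeneous
components, the degrees in these variables stay bounded by the degree of the polynomial that is
computed (`Prog.exists_rep_aeval`).
-/

noncomputable section

namespace GCT

/-! ### Zariski closures of images of polynomial maps are Euclidean closures -/

/-- A `ℂ`-valued point of `A` extends along `f : A → B` as soon as its kernel is the contraction of
some prime ideal of the finitely generated algebra `B`. -/
theorem exists_algHom_comp_eq {A B : Type*} [CommRing A] [Algebra ℂ A] [CommRing B] [Algebra ℂ B]
    [Algebra.FiniteType ℂ B] (f : A →ₐ[ℂ] B) (z : A →ₐ[ℂ] ℂ) (Q : Ideal B) (hQ : Q ≠ ⊤)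
    (h : ∀ a, z a = 0 → f a ∈ Q) : ∃ w : B →ₐ[ℂ] ℂ, w.comp f = z := by
  obtain ⟨M, hM, hQM⟩ := Ideal.exists_le_maximal Q hQ
  let : Field (B ⧸ M) := Ideal.Quotient.field M
  have : Module.Finite ℂ (B ⧸ M) := finite_of_finite_type_of_isJacobsonRing ℂ (B ⧸ M)
  have hb : Function.Bijective (algebraMap ℂ (B ⧸ M)) :=
    IsAlgClosed.algebraMap_bijective_of_isIntegral
  let e : ℂ ≃ₐ[ℂ] (B ⧸ M) := AlgEquiv.ofBijective (Algebra.ofId ℂ (B ⧸ M)) hb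
  refine ⟨(e.symm : (B ⧸ M) →ₐ[ℂ] ℂ).comp (Ideal.Quotient.mkₐ ℂ M), AlgHom.ext fun a => ?_⟩
  have h1 : f (a - algebraMap ℂ A (z a)) ∈ M := hQM (h _ (by simp))
  have h2 : Ideal.Quotient.mk M (f a) = algebraMap ℂ (B ⧸ M) (z a) := by
    rw [map_sub, AlgHom.commutes, ← Ideal.Quotient.eq] at h1
    exact h1
  change e.symm (Ideal.Quotient.mk M (f a)) = z a
  rw [h2]
  exact e.symm.commutes (z a)

/-- For an injective map of finitely generated domains, all points of a nonempty principal open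
subset lift; this is Chevalley's theorem. -/
theorem exists_ne_zero_forall_lift {A B : Type*} [CommRing A] [IsDomain A] [Algebra ℂ A]
    [Algebra.FiniteType ℂ A] [CommRing B] [IsDomain B] [Algebra ℂ B]
    [Algebra.FiniteType ℂ B] (f : A →ₐ[ℂ] B) (hf : Function.Injective f) :
    ∃ a : A, a ≠ 0 ∧ ∀ z : A →ₐ[ℂ] ℂ, z a ≠ 0 → ∃ w : B →ₐ[ℂ] ℂ, w.comp f = z := by
  have : IsNoetherianRing A := Algebra.FiniteType.isNoetherianRing ℂ A
  have hfin : f.toRingHom.FiniteType := by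
    refine RingHom.FiniteType.of_comp_finiteType (f := algebraMap ℂ A) ?_
    rw [show f.toRingHom.comp (algebraMap ℂ A) = algebraMap ℂ B from f.comp_algebraMap]
    exact RingHom.finiteType_algebraMap.mpr inferInstance
  have hfp : f.toRingHom.FinitePresentation := RingHom.FinitePresentation.of_finiteType.mp hfin
  obtain ⟨S, hS⟩ := PrimeSpectrum.exists_constructibleSetData_iff.mpr
    (PrimeSpectrum.isConstructible_range_comap hfp)
  have hgen : (⊥ : PrimeSpectrum A) ∈ S.toSet := by
    rw [hS]
    refine ⟨⊥, PrimeSpectrum.ext ?_⟩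
    change Ideal.comap f.toRingHom ⊥ = ⊥
    rw [← RingHom.ker_eq_comap_bot]
    exact (RingHom.injective_iff_ker_eq_bot _).mp hf
  simp only [PrimeSpectrum.ConstructibleSetData.toSet, Set.mem_iUnion] at hgen
  obtain ⟨D, hD, hD1, hD2⟩ := hgen
  refine ⟨D.f, fun h0 => hD2 ?_, fun z hz => ?_⟩
  · rw [h0]
    intro x hx
    rw [Set.mem_singleton_iff.mp hx]
    exact zero_mem _
  · have hzp : (RingHom.ker z).IsPrime := RingHom.ker_isPrime z.toRingHom
    have hmem : (⟨RingHom.ker z, hzp⟩ : PrimeSpectrum A) ∈ S.toSet := by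
      simp only [PrimeSpectrum.ConstructibleSetData.toSet, Set.mem_iUnion]
      refine ⟨D, hD, ?_, fun h => hz (h (Set.mem_singleton _))⟩
      rintro _ ⟨i, rfl⟩
      have h0 : D.g i = 0 := hD1 ⟨i, rfl⟩
      rw [h0]
      exact zero_mem _
    rw [hS] at hmem
    obtain ⟨q, hq⟩ := hmem
    refine exists_algHom_comp_eq f z q.asIdeal q.2.ne_top fun a ha => ?_
    have : a ∈ (PrimeSpectrum.comap f.toRingHom q).asIdeal := by
      rw [hq]
      exact ha
    exact this

/-- A monic polynomial with a small value at `x` has a root near `x`. -/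
theorem exists_root_near {p : Polynomial ℂ} (hp : p.Monic) (hd : p.natDegree ≠ 0) (x : ℂ) :
    ∃ r, p.IsRoot r ∧ ‖x - r‖ ^ p.natDegree ≤ ‖p.eval x‖ := by
  have hs := IsAlgClosed.splits p
  have hcard : p.roots.card = p.natDegree := hs.natDegree_eq_card_roots.symm
  have hne : p.roots.toFinset.Nonempty := by
    rw [Multiset.toFinset_nonempty]
    intro h
    rw [h] at hcard
    exact hd (by simpa using hcard.symm)
  obtain ⟨r, hr, hmin⟩ := Finset.exists_min_image _ (fun r => ‖x - r‖₊) hne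
  refine ⟨r, (Polynomial.mem_roots'.mp (Multiset.mem_toFinset.mp hr)).2, ?_⟩
  have heval : p.eval x = (p.roots.map fun a => x - a).prod := by
    conv_lhs => rw [hs.eq_prod_roots, hp.leadingCoeff]
    simp [Polynomial.eval_multiset_prod, Multiset.map_map]
  have hn : ‖p.eval x‖₊ = (p.roots.map fun a => ‖x - a‖₊).prod := by
    rw [heval]
    refine (map_multiset_prod (nnnormHom : ℂ →*₀ NNReal) _).trans ?_
    rw [Multiset.map_map]
    rfl
  have := Multiset.pow_card_le_prod (s := p.roots.map fun a => ‖x - a‖₊) (a := ‖x - r‖₊) (by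
    intro y hy
    obtain ⟨a, ha, rfl⟩ := Multiset.mem_map.mp hy
    exact hmin a (Multiset.mem_toFinset.mpr ha))
  rw [Multiset.card_map, hcard, ← hn] at this
  exact_mod_cast this

/-- The roots of a monic polynomial are bounded in terms of its coefficients. -/
theorem norm_root_le {p : Polynomial ℂ} (hp : p.Monic) {r : ℂ} (hr : p.IsRoot r) :
    ‖r‖ ≤ 1 + ∑ j ∈ Finset.range p.natDegree, ‖p.coeff j‖ := by
  have h := hr.norm_lt_cauchyBound hp.ne_zero
  have h2 : p.cauchyBound ≤ 1 + ∑ j ∈ Finset.range p.natDegree, ‖p.coeff j‖₊ := by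
    rw [Polynomial.cauchyBound, hp.leadingCoeff, nnnorm_one, div_one, add_comm]
    gcongr
    exact Finset.sup_le fun j hj =>
      Finset.single_le_sum (f := fun j => ‖p.coeff j‖₊) (fun _ _ => zero_le) hj
  have h3 : (‖r‖₊ : ℝ) ≤ _ := NNReal.coe_le_coe.mpr (le_trans (le_of_lt ?_) h2)
  · simpa using h3
  · exact_mod_cast h

/-- Given a point and finitely many others, some linear form separates the point from the others. -/
theorem exists_linear_separating {ι : Type*} [Fintype ι] (w₀ : ι → ℂ) {F : Set (ι → ℂ)}
    (hF : F.Finite) :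
    ∃ c : ι → ℂ, ∀ w ∈ F, ∑ i, c i * w i = ∑ i, c i * w₀ i → w = w₀ := by
  classical
  have : Finite (F \ {w₀} : Set (ι → ℂ)) := (hF.subset Set.sdiff_subset).to_subtype
  obtain ⟨φ, hφ⟩ := Module.exists_dual_forall_apply_ne_zero (K := ℂ)
    (fun w : (F \ {w₀} : Set (ι → ℂ)) => w.1 - w₀) fun w => sub_ne_zero.mpr w.2.2
  have hlin : ∀ w : ι → ℂ, φ w = ∑ i, φ (Pi.single i 1) * w i := fun w => by
    conv_lhs => rw [← Finset.univ_sum_single w, map_sum]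
    refine Finset.sum_congr rfl fun i _ => ?_
    rw [mul_comm, ← smul_eq_mul, ← map_smul, ← Pi.single_smul, smul_eq_mul, mul_one]
  refine ⟨fun i => φ (Pi.single i 1), fun w hw h => by_contra fun hne => ?_⟩
  refine hφ ⟨w, hw, hne⟩ ?_
  rw [map_sub, hlin, hlin, h, sub_self]

/-- A point of the base and a root of the specialized minimal polynomial of `b` come from a point of
an integral extension: this is where normality of the base is used. -/
theorem exists_algHom_of_minpoly_root {P A : Type*} [CommRing P] [IsDomain P]
    [IsIntegrallyClosed P] [Algebra ℂ P] [CommRing A] [IsDomain A] [Algebra ℂ A] [Algebra P A]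
    [IsScalarTower ℂ P A] [Algebra.FiniteType ℂ A] [Algebra.IsIntegral P A] [FaithfulSMul P A]
    (b : A) (t : P →ₐ[ℂ] ℂ) (r : ℂ) (hr : ((minpoly P b).map (t : P →+* ℂ)).IsRoot r) :
    ∃ z : A →ₐ[ℂ] ℂ, (∀ p, z (algebraMap P A p) = t p) ∧ z b = r := by
  let i : AdjoinRoot (minpoly P b) →ₐ[P] A :=
    (Algebra.adjoin P {b}).val.comp (minpoly.equivAdjoin (Algebra.IsIntegral.isIntegral b)).toAlgHom
  have hi : Function.Injective i :=
    Subtype.val_injective.comp (minpoly.equivAdjoin (Algebra.IsIntegral.isIntegral b)).injective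
  have hroot : i (AdjoinRoot.root _) = b := by
    simp [i]
  have hr' : (minpoly P b).eval₂ (t : P →+* ℂ) r = 0 := by
    rwa [Polynomial.IsRoot, Polynomial.eval_map] at hr
  let z₀ : AdjoinRoot (minpoly P b) →+* ℂ := AdjoinRoot.lift (t : P →+* ℂ) r hr'
  let z : AdjoinRoot (minpoly P b) →ₐ[ℂ] ℂ := { z₀ with
    commutes' := fun c => by
      change z₀ (algebraMap ℂ _ c) = c
      rw [IsScalarTower.algebraMap_apply ℂ P]
      change z₀ (AdjoinRoot.of _ _) = c
      rw [AdjoinRoot.lift_of]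
      exact t.commutes c }
  algebraize [i.toRingHom]
  have : Algebra.IsIntegral (AdjoinRoot (minpoly P b)) A := by
    constructor
    refine RingHom.IsIntegral.tower_top (algebraMap P _) _ ?_
    have h : (algebraMap (AdjoinRoot (minpoly P b)) A).comp (algebraMap P _) = algebraMap P A :=
      i.comp_algebraMap
    rw [h]
    exact algebraMap_isIntegral_iff.mpr inferInstance
  have hzp : (RingHom.ker z).IsPrime := RingHom.ker_isPrime z.toRingHom
  obtain ⟨Q, -, hQp, hQ⟩ := Ideal.exists_ideal_over_prime_of_isIntegral (RingHom.ker z) (⊥ : Ideal A)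
    (by
      intro x hx
      have : i x = 0 := hx
      rw [(map_eq_zero_iff i hi).mp this]
      exact zero_mem _)
  obtain ⟨w, hw⟩ := exists_algHom_comp_eq (i.restrictScalars ℂ) z Q hQp.ne_top fun a ha => by
    have : a ∈ RingHom.ker z := ha
    rw [← hQ] at this
    exact this
  refine ⟨w, fun p => ?_, ?_⟩
  · have := DFunLike.congr_fun hw (AdjoinRoot.of _ p)
    simp only [AlgHom.comp_apply] at this
    refine Eq.trans ?_ (this.trans (AdjoinRoot.lift_of hr'))
    congr 1
    exact (i.commutes p).symm
  · have := DFunLike.congr_fun hw (AdjoinRoot.root _)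
    simp only [AlgHom.comp_apply] at this
    refine Eq.trans ?_ (this.trans (AdjoinRoot.lift_root hr'))
    congr 1
    exact hroot.symm

/-- The complement of the zero set of a nonzero polynomial is dense: restrict to a line. -/
theorem exists_seq_tendsto_eval_ne_zero {ι : Type*} [Finite ι] {h : MvPolynomial ι ℂ} (hh : h ≠ 0)
    (t₀ : ι → ℂ) :
    ∃ t : ℕ → ι → ℂ, Tendsto t atTop (nhds t₀) ∧ ∀ k, eval (t k) h ≠ 0 := by
  obtain ⟨v, hv⟩ : ∃ v, eval v h ≠ 0 := by
    by_contra! hc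
    exact hh (MvPolynomial.funext fun v => by simpa using hc v)
  let q : Polynomial ℂ :=
    aeval (fun j => Polynomial.C (t₀ j) + Polynomial.X * Polynomial.C (v j - t₀ j)) h
  have hq : ∀ s, q.eval s = eval (fun j => t₀ j + s * (v j - t₀ j)) h := fun s => by
    have : (Polynomial.aeval s).comp (aeval (fun j => Polynomial.C (t₀ j) +
        Polynomial.X * Polynomial.C (v j - t₀ j)) : MvPolynomial ι ℂ →ₐ[ℂ] Polynomial ℂ) =
        aeval (fun j => t₀ j + s * (v j - t₀ j)) := by
      ext j
      simp
    have := DFunLike.congr_fun this h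
    simpa [q, MvPolynomial.coe_aeval_eq_eval, Polynomial.coe_aeval_eq_eval] using this
  have hq0 : q ≠ 0 := fun h0 => hv (by simpa [h0] using (hq 1).symm)
  have hev : ∀ᶠ s in nhdsWithin (0 : ℂ) {0}ᶜ, q.eval s ≠ 0 := by
    have hfin : ({s | q.IsRoot s} \ {0} : Set ℂ).Finite :=
      (Polynomial.finite_setOfPred_isRoot hq0).subset Set.sdiff_subset
    filter_upwards [mem_nhdsWithin_of_mem_nhds
      (hfin.isClosed.isOpen_compl.mem_nhds (by simp : (0 : ℂ) ∈ _)), self_mem_nhdsWithin]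
      with s hs hs0 hr
    exact hs ⟨hr, hs0⟩
  obtain ⟨s, hs, hs'⟩ := exists_seq_forall_of_frequently hev.frequently
  refine ⟨fun k j => t₀ j + s k * (v j - t₀ j), ?_, fun k => by rw [← hq]; exact hs' k⟩
  rw [tendsto_pi_nhds]
  intro j
  have : Tendsto s atTop (nhds 0) := hs.mono_right nhdsWithin_le_nhds
  simpa using (this.mul_const (v j - t₀ j)).const_add (t₀ j)

/-- A principal open subset of an irreducible affine variety is dense in the Euclidean topology. The
variety is a finite cover of an affine space, along which points are moved. -/
theorem exists_algHom_near {A : Type*} [CommRing A] [IsDomain A] [Algebra ℂ A]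
    [Algebra.FiniteType ℂ A] (y : A →ₐ[ℂ] ℂ) {a : A} (ha : a ≠ 0) {ι : Type*} [Fintype ι]
    (x : ι → A) {ε : ℝ} (hε : 0 < ε) :
    ∃ z : A →ₐ[ℂ] ℂ, z a ≠ 0 ∧ ∀ i, ‖z (x i) - y (x i)‖ < ε := by
  obtain ⟨s, g, hg, hint⟩ := exists_integral_inj_algHom_of_fg ℂ A
  algebraize [g.toRingHom]
  have : IsScalarTower ℂ (MvPolynomial (Fin s) ℂ) A :=
    IsScalarTower.of_algebraMap_eq fun c => (g.commutes c).symm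
  have : Algebra.IsIntegral (MvPolynomial (Fin s) ℂ) A := ⟨hint⟩
  have : FaithfulSMul (MvPolynomial (Fin s) ℂ) A :=
    (faithfulSMul_iff_algebraMap_injective _ _).mpr hg
  have hI : ∀ b : A, IsIntegral (MvPolynomial (Fin s) ℂ) b := Algebra.IsIntegral.isIntegral
  let M (b : A) := minpoly (MvPolynomial (Fin s) ℂ) b
  let t₀ : Fin s → ℂ := fun j => y (g (X j))
  have hy : ∀ p, y (algebraMap _ A p) = aeval t₀ p := fun p => by
    have : y.comp g = aeval t₀ := by
      ext j
      simp [t₀]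
    exact DFunLike.congr_fun this p
  -- the constant coefficient of the minimal polynomial of `a` is not the zero polynomial, and `z a`
  -- does not vanish for the points `z` over its nonzeros
  have hh : (M a).coeff 0 ≠ 0 := by
    intro h0
    obtain ⟨q, hq⟩ := Polynomial.X_dvd_iff.mpr h0
    have hqm : q.Monic := Polynomial.monic_X.of_mul_monic_left (hq ▸ minpoly.monic (hI a))
    rcases (minpoly.irreducible (hI a)).isUnit_or_isUnit hq with hu | hu
    · exact Polynomial.not_isUnit_X hu
    · have := minpoly.aeval (MvPolynomial (Fin s) ℂ) a
      rw [show minpoly _ a = _ from hq, hqm.eq_one_of_isUnit hu, mul_one, Polynomial.aeval_X] at this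
      exact ha this
  obtain ⟨t, ht, hth⟩ := exists_seq_tendsto_eval_ne_zero hh t₀
  -- values of polynomials depend continuously on the coefficients and on the argument
  have hcont : ∀ (p : Polynomial (MvPolynomial (Fin s) ℂ)) (u : ℕ → Fin s → ℂ) (r : ℕ → ℂ)
      (r₀ : ℂ), Tendsto u atTop (nhds t₀) → Tendsto r atTop (nhds r₀) →
      Tendsto (fun k => (p.map (aeval (u k) : MvPolynomial (Fin s) ℂ →ₐ[ℂ] ℂ).toRingHom).eval
        (r k)) atTop
        (nhds ((p.map (aeval t₀ : MvPolynomial (Fin s) ℂ →ₐ[ℂ] ℂ).toRingHom).eval r₀)) := by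
    intro p u r r₀ hu hr
    simp only [Polynomial.eval_map, Polynomial.eval₂_eq_sum_range]
    refine tendsto_finsetSum _ fun j _ => Tendsto.mul ?_ (hr.pow j)
    change Tendsto (fun k => eval (u k) (p.coeff j)) _ (nhds (eval t₀ (p.coeff j)))
    exact ((MvPolynomial.continuous_eval (p.coeff j)).tendsto t₀).comp hu
  have hroot : ∀ (z : A →ₐ[ℂ] ℂ) (u : Fin s → ℂ),
      (∀ p : MvPolynomial (Fin s) ℂ, z (algebraMap _ A p) = aeval u p) →
      ∀ b, ((M b).map (aeval u : MvPolynomial (Fin s) ℂ →ₐ[ℂ] ℂ).toRingHom).eval (z b) = 0 := by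
    intro z u hz b
    have h1 : z.toRingHom.comp (algebraMap _ A) =
        (aeval u : MvPolynomial (Fin s) ℂ →ₐ[ℂ] ℂ).toRingHom := RingHom.ext hz
    rw [Polynomial.eval_map, ← h1]
    change Polynomial.eval₂ _ (z.toRingHom b) _ = 0
    rw [← Polynomial.hom_eval₂, ← Polynomial.aeval_def, minpoly.aeval, map_zero]
  have hmonic : ∀ b u, ((M b).map (aeval u : MvPolynomial (Fin s) ℂ →ₐ[ℂ] ℂ).toRingHom).Monic :=
    fun b u => (minpoly.monic (hI b)).map _
  -- a linear form in the `x i` which separates `y` from the other points of its fiber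
  obtain ⟨c, hc⟩ := exists_linear_separating (fun i => y (x i))
    (F := Set.pi Set.univ fun i =>
      {r | ((M (x i)).map (aeval t₀ : MvPolynomial (Fin s) ℂ →ₐ[ℂ] ℂ).toRingHom).IsRoot r})
    (Set.Finite.pi fun i => Polynomial.finite_setOfPred_isRoot (hmonic (x i) t₀).ne_zero)
  let b : A := ∑ i, c i • x i
  have hb : ∀ z : A →ₐ[ℂ] ℂ, z b = ∑ i, c i * z (x i) := fun z => by
    simp [b, map_sum]
  have hD : ∀ u, ((M b).map (aeval u : MvPolynomial (Fin s) ℂ →ₐ[ℂ] ℂ).toRingHom).natDegree =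
      (M b).natDegree := fun u => (minpoly.monic (hI b)).natDegree_map _
  have hD0 : (M b).natDegree ≠ 0 := (minpoly.natDegree_pos (hI b)).ne'
  choose r hr hr' using fun k => exists_root_near (hmonic b (t k)) ((hD _).symm ▸ hD0) (y b)
  choose z hz hzb using fun k => exists_algHom_of_minpoly_root b (aeval (t k)) (r k) (hr k)
  have hrlim : Tendsto r atTop (nhds (y b)) := by
    have h1 := (hcont (M b) t (fun _ => y b) (y b) ht tendsto_const_nhds).norm
    rw [hroot y t₀ hy b, norm_zero] at h1
    have h2 : Tendsto (fun k => ‖y b - r k‖ ^ (M b).natDegree) atTop (nhds 0) :=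
      squeeze_zero (fun k => by positivity) (fun k => by simpa only [hD] using hr' k) h1
    have h3 : Tendsto (fun k => ‖y b - r k‖) atTop (nhds 0) := by
      have h4 := h2.rpow_const (p := ((M b).natDegree : ℝ)⁻¹) (Or.inr (by positivity))
      rw [Real.zero_rpow (by positivity)] at h4
      refine h4.congr fun k => ?_
      rw [Real.pow_rpow_inv_natCast (norm_nonneg _) hD0]
    rw [tendsto_iff_norm_sub_tendsto_zero]
    exact h3.congr fun k => norm_sub_rev _ _
  -- the coordinates of `z k` are roots of monic polynomials with convergent coefficients, hence they
  -- are bounded, and a subsequence converges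
  have hbdd : ∀ i, ∃ R : ℝ, ∀ k, ‖z k (x i)‖ ≤ R := by
    intro i
    let B (u : Fin s → ℂ) : ℝ :=
      1 + ∑ j ∈ Finset.range (M (x i)).natDegree, ‖eval u ((M (x i)).coeff j)‖
    have hB : Tendsto (fun k => B (t k)) atTop (nhds (B t₀)) := by
      refine (tendsto_finsetSum _ fun j _ => ?_).const_add 1
      exact (((MvPolynomial.continuous_eval _).tendsto t₀).comp ht).norm
    obtain ⟨R, hR⟩ := hB.bddAbove_range
    refine ⟨R, fun k => le_trans ?_ (hR ⟨k, rfl⟩)⟩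
    have := norm_root_le (hmonic (x i) (t k)) (hroot (z k) (t k) (hz k) (x i))
    rw [(minpoly.monic (hI (x i))).natDegree_map] at this
    simpa [B, Polynomial.coeff_map] using this
  choose R hR using hbdd
  obtain ⟨w, -, φ, hφ, hw⟩ := (isCompact_univ_pi fun i =>
    isCompact_closedBall (0 : ℂ) (R i)).tendsto_subseq (x := fun k i => z k (x i))
      (fun k i _ => by simpa using hR i k)
  rw [tendsto_pi_nhds] at hw
  have hwy : w = fun i => y (x i) := by
    refine hc w (fun i _ => ?_) ?_
    · have h1 := hcont (M (x i)) (t ∘ φ) (fun k => z (φ k) (x i)) (w i)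
        (ht.comp hφ.tendsto_atTop) (hw i)
      refine tendsto_nhds_unique h1 (tendsto_const_nhds.congr fun k => ?_)
      exact (hroot (z (φ k)) (t (φ k)) (hz _) (x i)).symm
    · rw [← hb]
      have h1 : Tendsto (fun k => ∑ i, c i * z (φ k) (x i)) atTop (nhds (∑ i, c i * w i)) :=
        tendsto_finsetSum _ fun i _ => (hw i).const_mul _
      refine tendsto_nhds_unique h1 ((hrlim.comp hφ.tendsto_atTop).congr fun k => ?_)
      rw [← hb, hzb]
      rfl
  have hev : ∀ᶠ k in atTop, ∀ i, ‖z (φ k) (x i) - y (x i)‖ < ε := by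
    rw [eventually_all]
    intro i
    have := hw i
    rw [hwy, tendsto_iff_norm_sub_tendsto_zero] at this
    exact this.eventually_lt_const hε
  obtain ⟨k, hk⟩ := hev.exists
  refine ⟨z (φ k), fun h0 => hth (φ k) ?_, hk⟩
  have := hroot (z (φ k)) (t (φ k)) (hz _) a
  rw [h0, ← Polynomial.coeff_zero_eq_eval_zero, Polynomial.coeff_map] at this
  simpa [MvPolynomial.coe_aeval_eq_eval] using this

/-- A point at which all polynomial relations between the components of a polynomial map vanish is a
Euclidean limit of values of the map. -/
theorem exists_eval_near_of_forall_relation {ι κ : Type*} [Fintype ι] [Finite κ]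
    (φ : ι → MvPolynomial κ ℂ) (y : ι → ℂ)
    (hy : ∀ G : MvPolynomial ι ℂ, aeval φ G = 0 → eval y G = 0) {ε : ℝ} (hε : 0 < ε) :
    ∃ x : κ → ℂ, ∀ i, ‖eval x (φ i) - y i‖ < ε := by
  let f : MvPolynomial ι ℂ →ₐ[ℂ] MvPolynomial κ ℂ := aeval φ
  have hsurj : Function.Surjective f.rangeRestrict := f.rangeRestrict_surjective
  have : Algebra.FiniteType ℂ f.range := Algebra.FiniteType.of_surjective f.rangeRestrict hsurj
  let e := Ideal.quotientKerAlgEquivOfSurjective hsurj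
  have hker : ∀ G ∈ RingHom.ker f.rangeRestrict, (aeval y : MvPolynomial ι ℂ →ₐ[ℂ] ℂ) G = 0 := by
    intro G hG
    have : f G = 0 := congrArg Subtype.val (show f.rangeRestrict G = 0 from hG)
    simpa [MvPolynomial.coe_aeval_eq_eval] using hy G this
  let y' : f.range →ₐ[ℂ] ℂ := (Ideal.Quotient.liftₐ _ _ hker).comp e.symm.toAlgHom
  have hy' : ∀ G, y' (f.rangeRestrict G) = aeval y G := fun G => by
    have : e.symm (f.rangeRestrict G) = Ideal.Quotient.mk _ G := by
      rw [AlgEquiv.symm_apply_eq]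
      rfl
    change Ideal.Quotient.liftₐ _ _ hker (e.symm (f.rangeRestrict G)) = _
    rw [this]
    rfl
  obtain ⟨a, ha, hlift⟩ := exists_ne_zero_forall_lift f.range.val Subtype.val_injective
  obtain ⟨z, hza, hz⟩ := exists_algHom_near y' ha (fun i => f.rangeRestrict (X i)) hε
  obtain ⟨w, hw⟩ := hlift z hza
  refine ⟨fun k => w (X k), fun i => ?_⟩
  have h1 : eval (fun k => w (X k)) (φ i) = z (f.rangeRestrict (X i)) := by
    rw [← hw]
    change _ = w (f (X i))
    have : w = aeval fun k => w (X k) := by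
      ext k
      simp
    conv_rhs => rw [this]
    simp [f]
  have h2 : y' (f.rangeRestrict (X i)) = y i := by
    rw [hy']
    simp
  rw [h1, ← h2]
  exact hz i

section

/-! ### Straight-line programs -/

/-- Straight-line programs with respect to a rule `r`, where `r S a` means that `a` may be computed
from the results in `S`. The results are listed with the last one first. -/
inductive Prog {α : Type*} (r : Set α → α → Prop) : List α → Prop
  | nil : Prog r []
  | cons {l : List α} {a : α} : Prog r l → r {x | x ∈ l} a → Prog r (a :: l)

/-- Any program which has computed all elements of `T` can be extended by at most `n` steps so as to
compute all elements of `U`. -/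
def Cost {α : Type*} (r : Set α → α → Prop) (T U : Set α) (n : ℕ) : Prop :=
  ∀ l, Prog r l → (∀ x ∈ T, x ∈ l) →
    ∃ l', Prog r l' ∧ (∀ x ∈ l, x ∈ l') ∧ l'.length ≤ l.length + n ∧ ∀ x ∈ U, x ∈ l'

namespace Cost

variable {α : Type*} {r : Set α → α → Prop} {T U W : Set α} {m n : ℕ}

theorem mono {T' U' : Set α} {n' : ℕ} (h : Cost r T U n) (hT : T ⊆ T') (hU : U' ⊆ U)
    (hn : n ≤ n') : Cost r T' U' n' := fun l hl hT' =>
  let ⟨l', h1, h2, h3, h4⟩ := h l hl fun x hx => hT' x (hT hx)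
  ⟨l', h1, h2, by omega, fun x hx => h4 x (hU hx)⟩

theorem mono_cost {n' : ℕ} (h : Cost r T U n) (hn : n ≤ n') : Cost r T U n' :=
  h.mono subset_rfl subset_rfl hn

theorem of_subset (h : U ⊆ T) : Cost r T U 0 := fun l hl hT =>
  ⟨l, hl, fun _ hx => hx, le_rfl, fun x hx => hT x (h hx)⟩

theorem trans (h : Cost r T U m) (h' : Cost r (T ∪ U) W n) : Cost r T (U ∪ W) (m + n) := by
  intro l hl hT
  obtain ⟨l₁, h1, h2, h3, h4⟩ := h l hl hT
  obtain ⟨l₂, g1, g2, g3, g4⟩ := h' l₁ h1 fun x hx => hx.elim (fun hx => h2 x (hT x hx)) (h4 x)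
  exact ⟨l₂, g1, fun x hx => g2 x (h2 x hx), by omega,
    fun x hx => hx.elim (fun hx => g2 x (h4 x hx)) (g4 x)⟩

theorem trans' (h : Cost r T U m) (h' : Cost r (T ∪ U) W n) : Cost r T W (m + n) :=
  (h.trans h').mono subset_rfl Set.subset_union_right le_rfl

theorem single (hr : ∀ ⦃S S' : Set α⦄ ⦃a : α⦄, S ⊆ S' → r S a → r S' a) {a : α} (h : r T a) :
    Cost r T {a} 1 := fun l hl hT =>
  ⟨a :: l, hl.cons (hr hT h), fun _ hx => List.mem_cons_of_mem _ hx, le_rfl, fun x hx => by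
    simp [Set.mem_singleton_iff.mp hx]⟩

theorem biUnion {ι : Type*} (s : Finset ι) (V : ι → Set α) (h : ∀ i ∈ s, Cost r T (V i) n) :
    Cost r T (⋃ i ∈ s, V i) (s.card * n) := by
  classical
  induction s using Finset.induction_on with
  | empty => exact (of_subset (by simp)).mono_cost (Nat.zero_le _)
  | insert i s hi ih =>
    have h1 := (ih fun j hj => h j (Finset.mem_insert_of_mem hj)).trans
      ((h i (Finset.mem_insert_self _ _)).mono (T' := T ∪ ⋃ i ∈ s, V i) Set.subset_union_left
        subset_rfl le_rfl)
    refine h1.mono subset_rfl ?_ (by rw [Finset.card_insert_of_notMem hi]; ring_nf; rfl)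
    rw [Finset.set_biUnion_insert, Set.union_comm]

/-- Stages of a computation, each of which uses the results of the previous one. -/
theorem iterate {V : ℕ → Set α} (k : ℕ) (h : ∀ i < k, Cost r (T ∪ V i) (V (i + 1)) n) :
    Cost r (T ∪ V 0) (⋃ i ≤ k, V i) (k * n) := by
  induction k with
  | zero => exact (of_subset (by simp)).mono_cost (Nat.zero_le _)
  | succ k ih =>
    refine ((ih fun i hi => h i (by omega)).trans ((h k (by omega)).mono
      (T' := T ∪ V 0 ∪ ⋃ i ≤ k, V i) ?_ subset_rfl le_rfl)).mono subset_rfl ?_ (by ring_nf; rfl)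
    · exact Set.union_subset (fun x hx => Or.inl (Or.inl hx))
        (fun x hx => Or.inr (Set.mem_biUnion (show k ≤ k from le_rfl) hx))
    · intro x hx
      simp only [Set.mem_iUnion] at hx
      obtain ⟨i, hi, hx⟩ := hx
      rcases Nat.lt_or_eq_of_le hi with hi | rfl
      · exact Or.inl (Set.mem_biUnion (show i ≤ k by omega) hx)
      · exact Or.inr hx

end Cost

variable {σ : Type*}

/-- The space of polynomials of degree at most `1` in the variables of `s`. -/
def affine (s : Set σ) : Submodule ℂ (MvPolynomial σ ℂ) := Submodule.span ℂ (insert 1 (X '' s))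

section Affine

variable {s : Set σ}

theorem C_mem_affine (c : ℂ) : C c ∈ affine s := by
  rw [← mul_one (C c), ← smul_eq_C_mul]
  exact Submodule.smul_mem _ _ (Submodule.subset_span (Set.mem_insert _ _))

theorem one_mem_affine : (1 : MvPolynomial σ ℂ) ∈ affine s := C_mem_affine 1

theorem X_mem_affine {x : σ} (hx : x ∈ s) : (X x : MvPolynomial σ ℂ) ∈ affine s :=
  Submodule.subset_span (Set.mem_insert_of_mem _ ⟨x, hx, rfl⟩)

theorem C_mul_mem_affine (c : ℂ) {p : MvPolynomial σ ℂ} (hp : p ∈ affine s) : C c * p ∈ affine s := by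
  rw [← smul_eq_C_mul]
  exact Submodule.smul_mem _ _ hp

theorem aeval_mem_affine {τ : Type*} {t : Set τ} {θ : σ → MvPolynomial τ ℂ}
    (hθ : ∀ x ∈ s, θ x ∈ affine t) {p : MvPolynomial σ ℂ} (hp : p ∈ affine s) :
    aeval θ p ∈ affine t := by
  induction hp using Submodule.span_induction with
  | mem p hp =>
    rcases hp with rfl | ⟨x, hx, rfl⟩
    · simpa using one_mem_affine
    · simpa using hθ x hx
  | zero => simp
  | add p q _ _ hp hq => simpa using Submodule.add_mem _ hp hq
  | smul c p _ hp => simpa using Submodule.smul_mem _ c hp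

theorem exists_eq_of_mem_affine {s : Finset σ} {p : MvPolynomial σ ℂ}
    (hp : p ∈ affine (s : Set σ)) :
    ∃ (c : ℂ) (d : σ → ℂ), p = C c + ∑ i ∈ s, C (d i) * X i := by
  classical
  induction hp using Submodule.span_induction with
  | mem p hp =>
    rcases hp with rfl | ⟨x, hx, rfl⟩
    · exact ⟨1, 0, by simp⟩
    · refine ⟨0, Pi.single x 1, ?_⟩
      rw [Finset.sum_eq_single x]
      · simp
      · intro y _ hy
        simp [Pi.single_eq_of_ne hy]
      · exact fun h => absurd hx h
  | zero => exact ⟨0, 0, by simp⟩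
  | add p q _ _ hp hq =>
    obtain ⟨c, d, rfl⟩ := hp
    obtain ⟨c', d', rfl⟩ := hq
    refine ⟨c + c', d + d', ?_⟩
    simp only [Pi.add_apply, map_add, add_mul, Finset.sum_add_distrib]
    ring
  | smul a p _ hp =>
    obtain ⟨c, d, rfl⟩ := hp
    refine ⟨a * c, fun i => a * d i, ?_⟩
    simp only [smul_eq_C_mul, map_mul, mul_add, Finset.mul_sum, mul_assoc]

end Affine

/-- The rule of skew programs: constants, sums, and products one factor of which is a constant
or a variable. -/
def SkewRule (S : Set (MvPolynomial σ ℂ)) (a : MvPolynomial σ ℂ) : Prop :=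
  (∃ c, a = C c) ∨ (∃ p ∈ S, ∃ q ∈ S, a = p + q) ∨ (∃ p ∈ S, ∃ c, a = C c * p) ∨
    ∃ p ∈ S, ∃ x, a = X x * p

theorem SkewRule.mono ⦃S S' : Set (MvPolynomial σ ℂ)⦄ ⦃a : MvPolynomial σ ℂ⦄ (h : S ⊆ S') :
    SkewRule S a → SkewRule S' a := by
  rintro (⟨c, rfl⟩ | ⟨p, hp, q, hq, rfl⟩ | ⟨p, hp, c, rfl⟩ | ⟨p, hp, x, rfl⟩)
  · exact Or.inl ⟨c, rfl⟩
  · exact Or.inr (Or.inl ⟨p, h hp, q, h hq, rfl⟩)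
  · exact Or.inr (Or.inr (Or.inl ⟨p, h hp, c, rfl⟩))
  · exact Or.inr (Or.inr (Or.inr ⟨p, h hp, x, rfl⟩))

/-- The rule of arbitrary straight-line programs. -/
def ArithRule (S : Set (MvPolynomial σ ℂ)) (a : MvPolynomial σ ℂ) : Prop :=
  (∃ c, a = C c) ∨ (∃ x, a = X x) ∨ (∃ p ∈ S, ∃ q ∈ S, a = p + q) ∨ ∃ p ∈ S, ∃ q ∈ S, a = p * q

section SkewCost

variable {T : Set (MvPolynomial σ ℂ)}

theorem cost_C (c : ℂ) : Cost SkewRule T {C c} 1 := Cost.single SkewRule.mono (Or.inl ⟨c, rfl⟩)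

theorem cost_add {p q : MvPolynomial σ ℂ} (hp : p ∈ T) (hq : q ∈ T) : Cost SkewRule T {p + q} 1 :=
  Cost.single SkewRule.mono (Or.inr (Or.inl ⟨p, hp, q, hq, rfl⟩))

theorem cost_C_mul (c : ℂ) {p : MvPolynomial σ ℂ} (hp : p ∈ T) : Cost SkewRule T {C c * p} 1 :=
  Cost.single SkewRule.mono (Or.inr (Or.inr (Or.inl ⟨p, hp, c, rfl⟩)))

theorem cost_X_mul (x : σ) {p : MvPolynomial σ ℂ} (hp : p ∈ T) : Cost SkewRule T {X x * p} 1 :=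
  Cost.single SkewRule.mono (Or.inr (Or.inr (Or.inr ⟨p, hp, x, rfl⟩)))

/-- A sum is computed by summing up successively. -/
theorem cost_sum {ι : Type*} (s : Finset ι) (f : ι → MvPolynomial σ ℂ) {n : ℕ}
    (h : ∀ i ∈ s, Cost SkewRule T {f i} n) :
    Cost SkewRule T {∑ i ∈ s, f i} (1 + s.card * (n + 1)) := by
  classical
  induction s using Finset.induction_on with
  | empty => simpa using (cost_C (T := T) (σ := σ) 0)
  | insert i s hi ih =>
    have h1 := ih fun j hj => h j (Finset.mem_insert_of_mem hj)
    have h2 := (h i (Finset.mem_insert_self _ _)).mono (T' := T ∪ {∑ j ∈ s, f j})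
      Set.subset_union_left subset_rfl le_rfl
    have h3 := (h1.trans h2).trans' (cost_add (p := f i) (q := ∑ j ∈ s, f j) (by simp) (by simp))
    rw [Finset.sum_insert hi, Finset.card_insert_of_notMem hi]
    exact h3.mono_cost (by ring_nf; rfl)

theorem cost_affine_mul {s : Finset σ} {a p : MvPolynomial σ ℂ} (ha : a ∈ affine (s : Set σ))
    (hp : p ∈ T) : Cost SkewRule T {a * p} (3 * s.card + 3) := by
  obtain ⟨c, d, rfl⟩ := exists_eq_of_mem_affine ha
  have h1 : Cost SkewRule T {C c * p} 1 := cost_C_mul c hp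
  have h2 : Cost SkewRule (T ∪ {C c * p}) {∑ i ∈ s, C (d i) * (X i * p)} (1 + s.card * (2 + 1)) :=
    cost_sum s _ fun i _ => (cost_X_mul i (Or.inl hp)).trans' (cost_C_mul _ (by simp))
  have h3 := (h1.trans h2).trans' (cost_add (p := C c * p) (q := ∑ i ∈ s, C (d i) * (X i * p))
    (by simp) (by simp))
  have h4 : (C c + ∑ i ∈ s, C (d i) * X i) * p = C c * p + ∑ i ∈ s, C (d i) * (X i * p) := by
    rw [add_mul, Finset.sum_mul]
    simp only [mul_assoc]
  rw [h4]
  exact h3.mono_cost (by ring_nf; rfl)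

theorem cost_dot {ι : Type*} (t : Finset ι) {s : Finset σ} (a p : ι → MvPolynomial σ ℂ)
    (ha : ∀ i ∈ t, a i ∈ affine (s : Set σ)) (hp : ∀ i ∈ t, p i ∈ T) :
    Cost SkewRule T {∑ i ∈ t, a i * p i} (1 + t.card * (3 * s.card + 4)) :=
  cost_sum t _ fun i hi => cost_affine_mul (ha i hi) (hp i hi)

theorem exists_cost (p : MvPolynomial σ ℂ) : ∃ n, ∀ T, Cost SkewRule T {p} n := by
  induction p using MvPolynomial.induction_on with
  | C c => exact ⟨1, fun _ => cost_C c⟩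
  | add p q hp hq =>
    obtain ⟨m, hm⟩ := hp
    obtain ⟨n, hn⟩ := hq
    exact ⟨m + n + 1, fun T => ((hm T).trans (hn _)).trans' (cost_add (by simp) (by simp))⟩
  | mul_X p x hp =>
    obtain ⟨m, hm⟩ := hp
    exact ⟨m + 1, fun T => by
      rw [mul_comm]
      exact (hm T).trans' (cost_X_mul x (by simp))⟩

end SkewCost

/-- `f` is the result of some skew program of length at most `n`. -/
def HasSkewProg (f : MvPolynomial σ ℂ) (n : ℕ) : Prop :=
  ∃ l, Prog SkewRule l ∧ l.length ≤ n ∧ f ∈ l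

theorem Cost.hasSkewProg {f : MvPolynomial σ ℂ} {n : ℕ} (h : Cost SkewRule ∅ {f} n) :
    HasSkewProg f n := by
  obtain ⟨l, h1, -, h2, h3⟩ := h [] .nil (by simp)
  exact ⟨l, h1, by simpa using h2, h3 f rfl⟩

/-! ### From skew programs to weakly-skew circuits -/

/-- The value at a vertex with the given label, in terms of the values at the other vertices. -/
def Node.eval {V : Type*} (val : V → MvPolynomial σ ℂ) : Node σ V → MvPolynomial σ ℂ
  | .const c => MvPolynomial.C c
  | .var x => X x
  | .add a b => val a + val b
  | .mul a b => val a * val b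

theorem Circuit.value_eq_eval (C : Circuit σ) (v : C.V) :
    C.value v = (C.gate v).eval C.value := by
  rw [Circuit.value_eq]
  cases C.gate v <;> rfl

/-- A label all of whose inputs satisfy `p`, as a label over the subtype. -/
def Node.restrict {V : Type*} {p : V → Prop} : (g : Node σ V) → (∀ u, g.HasInput u → p u) →
    Node σ (Subtype p)
  | .const c, _ => .const c
  | .var x, _ => .var x
  | .add a b, h => .add ⟨a, h a (Or.inl rfl)⟩ ⟨b, h b (Or.inr rfl)⟩
  | .mul a b, h => .mul ⟨a, h a (Or.inl rfl)⟩ ⟨b, h b (Or.inr rfl)⟩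

theorem Node.hasInput_restrict {V : Type*} {p : V → Prop} (g : Node σ V)
    (h : ∀ u, g.HasInput u → p u) (v : Subtype p) :
    (g.restrict h).HasInput v ↔ g.HasInput v.1 := by
  cases g <;> simp [Node.restrict, Node.HasInput, Subtype.ext_iff]

section Restrict

variable {V : Type*} {p : V → Prop} {g : Node σ V} (h : ∀ u, g.HasInput u → p u)

theorem Node.restrict_eq_const {c : ℂ} (hg : g = .const c) : g.restrict h = .const c := by
  subst hg
  rfl

theorem Node.restrict_eq_var {x : σ} (hg : g = .var x) : g.restrict h = .var x := by
  subst hg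
  rfl

theorem Node.restrict_eq_add {a b : V} (hg : g = .add a b) :
    g.restrict h = .add ⟨a, h a (hg ▸ Or.inl rfl)⟩ ⟨b, h b (hg ▸ Or.inr rfl)⟩ := by
  subst hg
  rfl

theorem Node.restrict_eq_mul {a b : V} (hg : g = .mul a b) :
    g.restrict h = .mul ⟨a, h a (hg ▸ Or.inl rfl)⟩ ⟨b, h b (hg ▸ Or.inr rfl)⟩ := by
  subst hg
  rfl

end Restrict

/-- The subcircuit computing the vertex `o` of a finite acyclic graph with possibly several vertices
of out-degree `0`. -/
def Circuit.ofGraph {V : Type} [Fintype V] (gate : V → Node σ V) (rank : V → ℕ)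
    (hrank : ∀ v w, (gate w).HasInput v → rank v < rank w) (o : V) : Circuit σ where
  V := {v // Relation.ReflTransGen (fun a b => (gate b).HasInput a) v o}
  fintypeV := @Subtype.fintype _ _ (Classical.decPred _) _
  gate v := (gate v.1).restrict fun _ hu => Relation.ReflTransGen.head hu v.2
  acyclic v hv := by
    have := Relation.TransGen.lift (p := fun a b : ℕ => a < b) (fun u => rank u.1)
      (fun a b h => by exact hrank _ _ ((Node.hasInput_restrict _ _ _).mp h)) v v hv
    rw [Relation.transGen_eq_self] at this
    exact lt_irrefl _ this
  out := ⟨o, .refl⟩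
  outdegree_zero_iff v := by
    simp only [Node.hasInput_restrict]
    constructor
    · intro h
      rcases Relation.ReflTransGen.cases_head v.2 with h1 | ⟨w, hw, hwo⟩
      · exact Subtype.ext h1
      · exact absurd hw (h ⟨w, hwo⟩)
    · rintro rfl w hw
      have : ∀ u, Relation.ReflTransGen (fun a b => (gate b).HasInput a) u o → rank u ≤ rank o :=
        fun u hu => by
          induction hu using Relation.ReflTransGen.head_induction_on with
          | refl => exact le_rfl
          | head h _ ih => exact (hrank _ _ h).le.trans ih
      exact absurd (hrank _ _ hw) (this _ w.2).not_gt

theorem Circuit.ofGraph_value {V : Type} [Fintype V] (gate : V → Node σ V) (rank : V → ℕ)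
    (hrank : ∀ v w, (gate w).HasInput v → rank v < rank w) (o : V)
    (val : V → MvPolynomial σ ℂ) (hval : ∀ v, val v = (gate v).eval val)
    (v : (Circuit.ofGraph gate rank hrank o).V) :
    (Circuit.ofGraph gate rank hrank o).value v = val v.1 := by
  induction v using (Circuit.ofGraph gate rank hrank o).wellFounded_edge.induction with
  | _ v ih =>
    have ih' : ∀ u : (Circuit.ofGraph gate rank hrank o).V, (gate v.1).HasInput u.1 →
        (Circuit.ofGraph gate rank hrank o).value u = val u.1 :=
      fun u hu => ih u ((Node.hasInput_restrict _ _ _).mpr hu)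
    have hg : (Circuit.ofGraph gate rank hrank o).gate v =
      (gate v.1).restrict fun _ hu =>
        Relation.ReflTransGen.head (r := fun a b => (gate b).HasInput a) hu v.2 := rfl
    rw [Circuit.value_eq_eval, hg, hval]
    generalize hn : (fun u hu =>
      Relation.ReflTransGen.head (r := fun a b => (gate b).HasInput a) hu v.2) = hn'
    clear hn hg
    revert hn' ih'
    generalize gate v.1 = n
    intro ih' hn'
    cases n
    · rfl
    · rfl
    · exact congrArg₂ (· + ·) (ih' ⟨_, hn' _ (Or.inl rfl)⟩ (Or.inl rfl))
        (ih' ⟨_, hn' _ (Or.inr rfl)⟩ (Or.inr rfl))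
    · exact congrArg₂ (· * ·) (ih' ⟨_, hn' _ (Or.inl rfl)⟩ (Or.inl rfl))
        (ih' ⟨_, hn' _ (Or.inr rfl)⟩ (Or.inr rfl))

/-- The results of a program, in the order of the computation. -/
theorem Prog.exists_seq {α : Type*} [Inhabited α] {r : Set α → α → Prop}
    (hmono : ∀ ⦃S S' : Set α⦄ ⦃a : α⦄, S ⊆ S' → r S a → r S' a) {l : List α} (h : Prog r l) :
    ∃ v : ℕ → α, (∀ i < l.length, r {x | ∃ j < i, v j = x} (v i)) ∧
      ∀ x ∈ l, ∃ i < l.length, v i = x := by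
  induction h with
  | nil => exact ⟨fun _ => default, by simp, by simp⟩
  | @cons l a _ hr ih =>
    obtain ⟨v, hv, hl⟩ := ih
    have hlt : ∀ i < l.length, Function.update v l.length a i = v i := fun i hi =>
      Function.update_of_ne hi.ne _ _
    refine ⟨Function.update v l.length a, fun i hi => ?_, fun x hx => ?_⟩
    · rcases Nat.lt_succ_iff_lt_or_eq.mp hi with h1 | rfl
      · rw [hlt i h1]
        exact hmono (by
          rintro x ⟨j, hj, rfl⟩
          exact ⟨j, hj, hlt j (hj.trans h1)⟩) (hv i h1)
      · rw [Function.update_self]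
        refine hmono ?_ hr
        intro x hx
        obtain ⟨j, hj, rfl⟩ := hl x hx
        exact ⟨j, hj, hlt j hj⟩
    · rcases List.mem_cons.mp hx with rfl | hx
      · exact ⟨l.length, by simp, by simp⟩
      · obtain ⟨j, hj, rfl⟩ := hl x hx
        exact ⟨j, by simp; omega, hlt j hj⟩

/-- A skew program gives a weakly-skew circuit: every vertex gets a private input vertex, which serves
as the second factor in the case of a product. -/
theorem HasSkewProg.exists_circuit {f : MvPolynomial σ ℂ} {n : ℕ} (h : HasSkewProg f n) :
    ∃ C : Circuit σ, C.WeaklySkew ∧ C.poly = f ∧ C.size ≤ 2 * n := by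
  obtain ⟨l, hl, hn, hf⟩ := h
  obtain ⟨v, hv, hmem⟩ := hl.exists_seq SkewRule.mono
  obtain ⟨i₀, hi₀, rfl⟩ := hmem f hf
  set N := l.length
  -- the vertex `.inl i` has the `i`-th result as its value, and `.inr i` is its private input, which
  -- is used only if `.inl i` is a product
  have key : ∀ i : Fin N, ∃ (g h : Node σ (Fin N ⊕ Fin N)) (q : MvPolynomial σ ℂ),
      ((∃ c, h = .const c ∧ q = C c) ∨ ∃ x, h = .var x ∧ q = X x) ∧
      ((∃ c, g = .const c ∧ v i = C c) ∨
        (∃ j k : Fin N, j < i ∧ k < i ∧ g = .add (.inl j) (.inl k) ∧ v i = v j + v k) ∨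
        ∃ j : Fin N, j < i ∧ g = .mul (.inr i) (.inl j) ∧ v i = q * v j) := by
    intro i
    rcases hv i i.2 with ⟨c, hc⟩ | ⟨p, ⟨j, hj, rfl⟩, q, ⟨k, hk, rfl⟩, h⟩ | ⟨p, ⟨j, hj, rfl⟩, c, h⟩ |
      ⟨p, ⟨j, hj, rfl⟩, x, h⟩
    · exact ⟨.const c, .const 0, C 0, Or.inl ⟨0, rfl, rfl⟩, Or.inl ⟨c, rfl, hc⟩⟩
    · exact ⟨.add (.inl ⟨j, hj.trans i.2⟩) (.inl ⟨k, hk.trans i.2⟩), .const 0, C 0,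
        Or.inl ⟨0, rfl, rfl⟩, Or.inr (Or.inl ⟨_, _, hj, hk, rfl, h⟩)⟩
    · exact ⟨.mul (.inr i) (.inl ⟨j, hj.trans i.2⟩), .const c, C c,
        Or.inl ⟨c, rfl, rfl⟩, Or.inr (Or.inr ⟨_, hj, rfl, h⟩)⟩
    · exact ⟨.mul (.inr i) (.inl ⟨j, hj.trans i.2⟩), .var x, X x,
        Or.inr ⟨x, rfl, rfl⟩, Or.inr (Or.inr ⟨_, hj, rfl, h⟩)⟩
  choose g h q hq hg using key
  let gate : Fin N ⊕ Fin N → Node σ (Fin N ⊕ Fin N) := Sum.elim g h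
  let rank : Fin N ⊕ Fin N → ℕ := Sum.elim (fun i => i + 1) fun _ => 0
  have hleaf : ∀ i u, ¬ (h i).HasInput u := by
    intro i u
    rcases hq i with ⟨c, hc, -⟩ | ⟨x, hx, -⟩
    · simp [hc, Node.HasInput]
    · simp [hx, Node.HasInput]
  have hcore : ∀ i u, (g i).HasInput u → (∃ j < i, u = .inl j) ∨ u = .inr i := by
    intro i u hu
    rcases hg i with ⟨c, hc, -⟩ | ⟨j, k, hj, hk, hc, -⟩ | ⟨j, hj, hc, -⟩
    · simp [hc, Node.HasInput] at hu
    · rw [hc] at hu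
      rcases hu with rfl | rfl
      · exact Or.inl ⟨j, hj, rfl⟩
      · exact Or.inl ⟨k, hk, rfl⟩
    · rw [hc] at hu
      rcases hu with rfl | rfl
      · exact Or.inr rfl
      · exact Or.inl ⟨j, hj, rfl⟩
  have hrank : ∀ u w, (gate w).HasInput u → rank u < rank w := by
    rintro u (i | i) hu
    · rcases hcore i u hu with ⟨j, hj, rfl⟩ | rfl
      · exact Nat.succ_lt_succ hj
      · exact Nat.succ_pos _
    · exact absurd hu (hleaf i u)
  let D := Circuit.ofGraph gate rank hrank (.inl ⟨i₀, hi₀⟩)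
  let val : Fin N ⊕ Fin N → MvPolynomial σ ℂ := Sum.elim (fun i => v i) q
  have hval : ∀ u, val u = (gate u).eval val := by
    rintro (i | i)
    · change v i = (g i).eval val
      rcases hg i with ⟨c, hc, h⟩ | ⟨j, k, hj, hk, hc, h⟩ | ⟨j, hj, hc, h⟩ <;> rw [hc, h] <;> rfl
    · change q i = (h i).eval val
      rcases hq i with ⟨c, hc, h⟩ | ⟨x, hc, h⟩ <;> rw [hc, h] <;> rfl
  refine ⟨D, ?_, Circuit.ofGraph_value gate rank hrank _ val hval _, ?_⟩
  · intro α a b hab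
    left
    have hedge : ∀ u w, D.Edge u w ↔ (gate w.1).HasInput u.1 := fun u w =>
      Node.hasInput_restrict _ _ _
    have hα : gate α.1 = .mul a.1 b.1 := by
      have h1 : (gate α.1).restrict (p := fun v => Relation.ReflTransGen
          (fun a b => (gate b).HasInput a) v (.inl ⟨i₀, hi₀⟩))
          (fun _ hu => Relation.ReflTransGen.head hu α.2) = .mul a b := hab
      rcases h2 : gate α.1 with c | x | ⟨a', b'⟩ | ⟨a', b'⟩
      · rw [Node.restrict_eq_const _ h2] at h1
        cases h1
      · rw [Node.restrict_eq_var _ h2] at h1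
        cases h1
      · rw [Node.restrict_eq_add _ h2] at h1
        cases h1
      · rw [Node.restrict_eq_mul _ h2] at h1
        cases h1
        rfl
    obtain ⟨i, hi, j, ha, hb⟩ : ∃ i, α.1 = .inl i ∧ ∃ j, a.1 = .inr i ∧ b.1 = .inl j := by
      rcases hα' : α.1 with i | i
      · rw [hα'] at hα
        change g i = _ at hα
        rcases hg i with ⟨c, hc, -⟩ | ⟨j, k, hj, hk, hc, -⟩ | ⟨j, hj, hc, -⟩ <;> rw [hc] at hα
        · cases hα
        · cases hα
        · injection hα with h1 h2
          exact ⟨i, rfl, j, h1.symm, h2.symm⟩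
      · rw [hα'] at hα
        change h i = _ at hα
        rcases hq i with ⟨c, hc, -⟩ | ⟨x, hc, -⟩ <;> rw [hc] at hα <;> cases hα
    refine ⟨fun hab' => (by rw [hab', hb] at ha; cases ha), fun u w hu _ huw => ?_⟩
    have hua : u = a := by
      rcases Relation.ReflTransGen.cases_tail hu with h1 | ⟨c, -, hc⟩
      · exact h1.symm
      · rw [hedge, ha] at hc
        exact absurd hc (hleaf i _)
    refine ⟨hua, Subtype.ext ?_⟩
    rw [hedge, hua, ha] at huw
    rcases hw : w.1 with k | k
    · rw [hw] at huw
      rcases hcore k _ huw with ⟨j, -, hj⟩ | hj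
      · cases hj
      · injection hj with hj
        rw [hi, hj]
    · rw [hw] at huw
      exact absurd huw (hleaf k _)
  · have : D.size ≤ Fintype.card (Fin N ⊕ Fin N) := by
      classical
      unfold Circuit.size
      exact (@Fintype.card_le_of_injective _ _ D.fintypeV _ Subtype.val Subtype.val_injective)
    rw [Fintype.card_sum, Fintype.card_fin] at this
    omega

end

section

variable {σ : Type*}

/-! ### From circuits to programs -/

namespace Circuit

variable (C : Circuit σ)

/-- A set of vertices which contains the sources of all edges ending in it. -/
def IsDownClosed (S : Finset C.V) : Prop := ∀ v ∈ S, ∀ u, C.Edge u v → u ∈ S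

variable {C}

theorem IsDownClosed.reach {S : Finset C.V} (hS : C.IsDownClosed S) {u v : C.V}
    (h : Relation.ReflTransGen C.Edge u v) (hv : v ∈ S) : u ∈ S := by
  induction h using Relation.ReflTransGen.head_induction_on with
  | refl => exact hv
  | head h _ ih => exact hS _ ih _ h

/-- A nonempty set of vertices has an element without edges to the set. -/
theorem exists_maximal {S : Finset C.V} (h : S.Nonempty) :
    ∃ v ∈ S, ∀ w ∈ S, ¬ C.Edge v w := by
  have := C.fintypeV
  have hirr : Std.Irrefl (Relation.TransGen (Function.swap C.Edge)) :=
    ⟨fun v hv => C.acyclic v (Relation.transGen_swap.mp hv)⟩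
  have htr : IsTrans C.V (Relation.TransGen (Function.swap C.Edge)) := ⟨fun _ _ _ h h' => h.trans h'⟩
  have hwf : WellFounded (Function.swap C.Edge) :=
    Subrelation.wf (fun h => Relation.TransGen.single h)
      (Finite.wellFounded_of_trans_of_irrefl (Relation.TransGen (Function.swap C.Edge)))
  obtain ⟨v, hv, hmin⟩ := hwf.has_min (S : Set C.V) h
  exact ⟨v, hv, fun w hw hvw => hmin w hw hvw⟩

theorem IsDownClosed.erase [DecidableEq C.V] {S : Finset C.V} (hS : C.IsDownClosed S) {v : C.V}
    (hv : ∀ w ∈ S, ¬ C.Edge v w) : C.IsDownClosed (S.erase v) := fun w hw u huw =>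
  Finset.mem_erase.mpr ⟨fun h => hv w (Finset.mem_of_mem_erase hw) (h ▸ huw),
    hS w (Finset.mem_of_mem_erase hw) u huw⟩

/-- The values of the vertices of a circuit, listed in a topological order, form a program. -/
theorem exists_prog_of_isDownClosed [DecidableEq C.V] (S : Finset C.V) (hS : C.IsDownClosed S) :
    ∃ l, Prog ArithRule l ∧ l.length = S.card ∧ ∀ v ∈ S, C.value v ∈ l := by
  induction hn : S.card generalizing S with
  | zero =>
    rw [Finset.card_eq_zero] at hn
    exact ⟨[], .nil, rfl, by simp [hn]⟩
  | succ n ih =>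
    obtain ⟨v, hv, hmax⟩ := exists_maximal (Finset.card_pos.mp (by omega : 0 < S.card))
    obtain ⟨l, hl, hlen, hmem⟩ := ih (S.erase v) (hS.erase hmax)
      (by rw [Finset.card_erase_of_mem hv]; omega)
    have hin : ∀ u, (C.gate v).HasInput u → C.value u ∈ l := fun u hu =>
      hmem u (Finset.mem_erase.mpr ⟨fun h => hmax v hv (by rw [h] at hu; exact hu), hS v hv u hu⟩)
    refine ⟨C.value v :: l, hl.cons ?_, by simp [hlen], fun u hu => ?_⟩
    · rw [value_eq_eval]
      rcases hg : C.gate v with c | x | ⟨a, b⟩ | ⟨a, b⟩ <;> rw [hg] at hin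
      · exact Or.inl ⟨c, rfl⟩
      · exact Or.inr (Or.inl ⟨x, rfl⟩)
      · exact Or.inr (Or.inr (Or.inl ⟨_, hin a (Or.inl rfl), _, hin b (Or.inr rfl), rfl⟩))
      · exact Or.inr (Or.inr (Or.inr ⟨_, hin a (Or.inl rfl), _, hin b (Or.inr rfl), rfl⟩))
    · by_cases h : u = v
      · simp [h]
      · exact List.mem_cons_of_mem _ (hmem u (Finset.mem_erase.mpr ⟨h, hu⟩))

theorem exists_prog (C : Circuit σ) :
    ∃ l, Prog ArithRule l ∧ l.length = C.size ∧ C.poly ∈ l := by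
  classical
  have := C.fintypeV
  obtain ⟨l, h1, h2, h3⟩ := exists_prog_of_isDownClosed (C := C) Finset.univ
    fun _ _ _ _ => Finset.mem_univ _
  refine ⟨l, h1, ?_, h3 _ (Finset.mem_univ _)⟩
  rw [h2, Finset.card_univ]
  unfold size
  congr
  exact Subsingleton.elim _ _

end Circuit

/-- Weakly-skew programs: `WSProg n l` says that the polynomials in `l` are computed with `n` steps,
where one factor of each product is computed by a separate program whose results are discarded. -/
inductive WSProg : ℕ → List (MvPolynomial σ ℂ) → Prop
  | nil : WSProg 0 []
  | const {n : ℕ} {l : List (MvPolynomial σ ℂ)} (c : ℂ) : WSProg n l → WSProg (n + 1) (C c :: l)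
  | var {n : ℕ} {l : List (MvPolynomial σ ℂ)} (x : σ) : WSProg n l → WSProg (n + 1) (X x :: l)
  | add {n : ℕ} {l : List (MvPolynomial σ ℂ)} {p q : MvPolynomial σ ℂ} :
      WSProg n l → p ∈ l → q ∈ l → WSProg (n + 1) ((p + q) :: l)
  | mul {n k : ℕ} {l l' : List (MvPolynomial σ ℂ)} {p q : MvPolynomial σ ℂ} :
      WSProg n l → p ∈ l → WSProg k l' → q ∈ l' → WSProg (n + k + 1) ((p * q) :: l)

namespace Circuit

variable {C : Circuit σ}

/-- `s` chooses for each multiplication gate an operand computed by a separate subcircuit; a vertex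
is private to `S` if it belongs to the subcircuit chosen for some multiplication gate in `S`. -/
def IsPrivate (C : Circuit σ) (s : C.V → C.V) (S : Finset C.V) (v : C.V) : Prop :=
  ∃ α ∈ S, (∃ a b, C.gate α = .mul a b) ∧ C.InSub (s α) v

/-- The vertices which are not private are computed by weakly-skew programs: a maximal vertex is
removed, together with the separate subcircuit of one of its operands if it is a product. -/
theorem exists_wsProg_of_isDownClosed [DecidableEq C.V] (s t : C.V → C.V)
    (hst : ∀ α a b, C.gate α = .mul a b →
      C.IsSeparate α (s α) (t α) ∧ (C.gate α = .mul (s α) (t α) ∨ C.gate α = .mul (t α) (s α)))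
    (S : Finset C.V) (hS : C.IsDownClosed S) :
    ∃ n l, WSProg n l ∧ n ≤ S.card ∧ ∀ v ∈ S, ¬ C.IsPrivate s S v → C.value v ∈ l := by
  induction hn : S.card using Nat.strong_induction_on generalizing S with
  | _ N ih =>
    rcases S.eq_empty_or_nonempty with rfl | hne
    · exact ⟨0, [], .nil, Nat.zero_le _, by simp⟩
    obtain ⟨v, hv, hmax⟩ := exists_maximal hne
    have hS' := hS.erase hmax
    have hcard : (S.erase v).card + 1 = N := by rw [Finset.card_erase_add_one hv, hn]
    -- the operands of `v` are private to a part of `S` only as separate operands of `v`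
    have hop : ∀ S' ⊆ S.erase v, ∀ u, C.Edge u v → ¬ C.IsPrivate s S' u := by
      rintro S' hS'' u huv ⟨α, hα, ⟨a, b, hab⟩, hu⟩
      obtain ⟨⟨-, hsep⟩, hgate⟩ := hst α a b hab
      have hαS := Finset.mem_erase.mp (hS'' hα)
      have hsα : C.Edge (s α) α := by
        rcases hgate with h | h <;> simp [Edge, h, Node.HasInput]
      have hvn : ¬ C.InSub (s α) v := fun h => by
        rcases Relation.ReflTransGen.cases_head h with h1 | ⟨w, hw, hws⟩
        · exact hmax α hαS.2 (h1 ▸ hsα)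
        · exact hmax w (hS.reach (hws.tail hsα) hαS.2) hw
      exact hαS.1 (hsep u v hu hvn huv).2.symm
    by_cases hmul : ∃ a b, C.gate v = .mul a b
    · obtain ⟨a, b, hab⟩ := hmul
      obtain ⟨⟨hne', hsep⟩, hgate⟩ := hst v a b hab
      have hsv : C.Edge (s v) v := by
        rcases hgate with h | h <;> simp [Edge, h, Node.HasInput]
      have htv : C.Edge (t v) v := by
        rcases hgate with h | h <;> simp [Edge, h, Node.HasInput]
      have hval : C.value v = C.value (t v) * C.value (s v) := by
        rw [value_eq_eval]
        rcases hgate with h | h <;> rw [h]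
        · exact mul_comm _ _
        · rfl
      have hvn : ¬ C.InSub (s v) v := fun h =>
        C.acyclic v (Relation.TransGen.tail' h hsv)
      have htn : ¬ C.InSub (s v) (t v) := fun h => hne' (hsep _ _ h hvn htv).1.symm
      classical
      set T := S.filter (C.InSub (s v)) with hT
      set S₂ := (S.erase v).filter fun u => ¬ C.InSub (s v) u with hS₂
      have hTd : C.IsDownClosed T := fun w hw u huw => by
        rw [hT, Finset.mem_filter] at hw ⊢
        exact ⟨hS w hw.1 u huw, Relation.ReflTransGen.head huw hw.2⟩
      have hSd : C.IsDownClosed S₂ := fun w hw u huw => by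
        rw [hS₂, Finset.mem_filter] at hw ⊢
        refine ⟨hS' w hw.1 u huw, fun hu => ?_⟩
        exact (Finset.mem_erase.mp hw.1).1 (hsep u w hu hw.2 huw).2
      have hTsub : T ⊆ S.erase v := fun u hu => by
        rw [hT, Finset.mem_filter] at hu
        exact Finset.mem_erase.mpr ⟨fun h => hvn (h ▸ hu.2), hu.1⟩
      have hsum : T.card + S₂.card = (S.erase v).card := by
        have h1 : T = (S.erase v).filter (C.InSub (s v)) := by
          ext u
          rw [hT, Finset.mem_filter, Finset.mem_filter]
          exact ⟨fun h => ⟨hTsub (Finset.mem_filter.mpr h), h.2⟩,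
            fun h => ⟨Finset.mem_of_mem_erase h.1, h.2⟩⟩
        rw [h1, hS₂, Finset.card_filter_add_card_filter_not]
      obtain ⟨k, l', hl', hk, hmem'⟩ := ih T.card (by omega) T hTd rfl
      obtain ⟨n, l, hl, hn', hmem⟩ := ih S₂.card (by omega) S₂ hSd rfl
      have h1 : C.value (s v) ∈ l' := hmem' _
        (Finset.mem_filter.mpr ⟨hS v hv _ hsv, .refl⟩) (hop T hTsub _ hsv)
      have h2 : C.value (t v) ∈ l := hmem _ (Finset.mem_filter.mpr
        ⟨Finset.mem_erase.mpr ⟨fun h => hmax v hv (by rw [h] at htv; exact htv), hS v hv _ htv⟩, htn⟩)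
        (hop S₂ (Finset.filter_subset _ _) _ htv)
      refine ⟨_, _, hl.mul h2 hl' h1, by omega, fun w hw hp => ?_⟩
      rw [hval.symm]
      by_cases hwv : w = v
      · simp [hwv]
      · refine List.mem_cons_of_mem _ (hmem w (Finset.mem_filter.mpr
          ⟨Finset.mem_erase.mpr ⟨hwv, hw⟩, fun h => hp ⟨v, hv, ⟨a, b, hab⟩, h⟩⟩) ?_)
        rintro ⟨α, hα, h⟩
        exact hp ⟨α, Finset.mem_of_mem_erase (Finset.mem_filter.mp hα).1, h⟩
    · obtain ⟨n, l, hl, hn', hmem⟩ := ih (S.erase v).card (by omega) (S.erase v) hS' rfl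
      have hin : ∀ u, (C.gate v).HasInput u → C.value u ∈ l := fun u hu =>
        hmem u (Finset.mem_erase.mpr ⟨fun h => hmax v hv (by rw [h] at hu; exact hu), hS v hv u hu⟩)
          (hop _ subset_rfl u hu)
      have hres : ∀ w ∈ S, ¬ C.IsPrivate s S w → C.value w ∈ C.value v :: l := fun w hw hp => by
        by_cases hwv : w = v
        · simp [hwv]
        · refine List.mem_cons_of_mem _ (hmem w (Finset.mem_erase.mpr ⟨hwv, hw⟩) ?_)
          rintro ⟨α, hα, h⟩
          exact hp ⟨α, Finset.mem_of_mem_erase hα, h⟩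
      refine ⟨n + 1, C.value v :: l, ?_, by omega, hres⟩
      rw [value_eq_eval]
      rcases hg : C.gate v with c | x | ⟨a, b⟩ | ⟨a, b⟩
      · exact hl.const c
      · exact hl.var x
      · rw [hg] at hin
        exact hl.add (hin a (Or.inl rfl)) (hin b (Or.inr rfl))
      · exact absurd ⟨a, b, hg⟩ hmul

/-- The output vertex is not private, as every private vertex has an outgoing edge. -/
theorem WeaklySkew.exists_wsProg (hC : C.WeaklySkew) :
    ∃ n l, WSProg n l ∧ n ≤ C.size ∧ C.poly ∈ l := by
  classical
  have := C.fintypeV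
  have key : ∀ α, ∃ u w, ∀ a b, C.gate α = .mul a b →
      C.IsSeparate α u w ∧ (C.gate α = .mul u w ∨ C.gate α = .mul w u) := by
    intro α
    by_cases h : ∃ a b, C.gate α = .mul a b
    · obtain ⟨a, b, hab⟩ := h
      rcases hC α a b hab with h1 | h1
      · exact ⟨a, b, fun _ _ _ => ⟨h1, Or.inl hab⟩⟩
      · exact ⟨b, a, fun _ _ _ => ⟨h1, Or.inr hab⟩⟩
    · exact ⟨α, α, fun a b hab => absurd ⟨a, b, hab⟩ h⟩
  choose s t hst using key
  obtain ⟨n, l, h1, h2, h3⟩ := exists_wsProg_of_isDownClosed s t hst Finset.univ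
    fun _ _ _ _ => Finset.mem_univ _
  refine ⟨n, l, h1, h2.trans ?_, h3 _ (Finset.mem_univ _) ?_⟩
  · rw [Finset.card_univ]
    unfold size
    exact le_of_eq (by congr; exact Subsingleton.elim _ _)
  rintro ⟨α, -, ⟨a, b, hab⟩, hα⟩
  have hno := (C.outdegree_zero_iff C.out).mpr rfl
  rcases Relation.ReflTransGen.cases_head hα with h | ⟨w, hw, -⟩
  · refine hno α ?_
    rcases (hst α a b hab).2 with h' | h' <;> simp [h', Node.HasInput, h]
  · exact hno w hw

end Circuit

/-- Replaying a program with all results multiplied by a result `p` of another program. -/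
theorem Prog.exists_glue {l l' : List (MvPolynomial σ ℂ)} (hl : Prog SkewRule l)
    (hl' : Prog SkewRule l') {p : MvPolynomial σ ℂ} (hp : p ∈ l) :
    ∃ l'', Prog SkewRule l'' ∧ l''.length = l.length + l'.length ∧ (∀ x ∈ l, x ∈ l'') ∧
      ∀ q ∈ l', p * q ∈ l'' := by
  induction hl' with
  | nil => exact ⟨l, hl, rfl, fun _ h => h, by simp⟩
  | @cons l' a _ hr ih =>
    obtain ⟨l₂, h1, h2, h3, h4⟩ := ih
    refine ⟨p * a :: l₂, h1.cons ?_, by simp [h2]; omega, fun x hx => List.mem_cons_of_mem _ (h3 x hx),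
      fun q hq => ?_⟩
    · rcases hr with ⟨c, rfl⟩ | ⟨q, hq, q', hq', rfl⟩ | ⟨q, hq, c, rfl⟩ | ⟨q, hq, x, rfl⟩
      · exact Or.inr (Or.inr (Or.inl ⟨p, h3 p hp, c, mul_comm _ _⟩))
      · exact Or.inr (Or.inl ⟨_, h4 q hq, _, h4 q' hq', mul_add _ _ _⟩)
      · exact Or.inr (Or.inr (Or.inl ⟨_, h4 q hq, c, mul_left_comm _ _ _⟩))
      · exact Or.inr (Or.inr (Or.inr ⟨_, h4 q hq, x, mul_left_comm _ _ _⟩))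
    · rcases List.mem_cons.mp hq with rfl | hq
      · simp
      · exact List.mem_cons_of_mem _ (h4 q hq)

/-- A product `p * q` whose factor `q` is computed by a separate program is obtained by repeating this
program with all results multiplied by `p`, so that only products with constants and variables occur.
A variable is computed in two steps, as a multiple of the constant `1`. -/
theorem WSProg.exists_skew {n : ℕ} {l : List (MvPolynomial σ ℂ)} (h : WSProg n l) :
    ∃ l', Prog SkewRule l' ∧ l'.length ≤ 2 * n ∧ ∀ x ∈ l, x ∈ l' := by
  induction h with
  | nil => exact ⟨[], .nil, le_rfl, by simp⟩
  | const c _ ih =>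
    obtain ⟨l', h1, h2, h3⟩ := ih
    exact ⟨C c :: l', h1.cons (Or.inl ⟨c, rfl⟩), by simp; omega, fun x hx => by
      rcases List.mem_cons.mp hx with rfl | hx
      · simp
      · exact List.mem_cons_of_mem _ (h3 x hx)⟩
  | var y _ ih =>
    obtain ⟨l', h1, h2, h3⟩ := ih
    refine ⟨X y * C 1 :: C 1 :: l', (h1.cons (Or.inl ⟨1, rfl⟩)).cons
      (Or.inr (Or.inr (Or.inr ⟨C 1, by simp, y, rfl⟩))), by simp; omega, fun x hx => ?_⟩
    rcases List.mem_cons.mp hx with rfl | hx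
    · simp
    · exact List.mem_cons_of_mem _ (List.mem_cons_of_mem _ (h3 x hx))
  | add _ hp hq ih =>
    obtain ⟨l', h1, h2, h3⟩ := ih
    exact ⟨_, h1.cons (Or.inr (Or.inl ⟨_, h3 _ hp, _, h3 _ hq, rfl⟩)), by simp; omega, fun x hx => by
      rcases List.mem_cons.mp hx with rfl | hx
      · simp
      · exact List.mem_cons_of_mem _ (h3 x hx)⟩
  | mul _ hp _ hq ih ih' =>
    obtain ⟨l₁, h1, h2, h3⟩ := ih
    obtain ⟨l₂, g1, g2, g3⟩ := ih'
    obtain ⟨l₃, k1, k2, k3, k4⟩ := h1.exists_glue g1 (h3 _ hp)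
    exact ⟨l₃, k1, by omega, fun x hx => by
      rcases List.mem_cons.mp hx with rfl | hx
      · exact k4 _ (g3 _ hq)
      · exact k3 x (h3 x hx)⟩

theorem Circuit.WeaklySkew.hasSkewProg {C : Circuit σ} (hC : C.WeaklySkew) :
    HasSkewProg C.poly (2 * C.size) := by
  obtain ⟨n, l, h1, h2, h3⟩ := hC.exists_wsProg
  obtain ⟨l', h4, h5, h6⟩ := h1.exists_skew
  exact ⟨l', h4, by omega, h6 _ h3⟩

/-! ### Complexity -/

theorem exists_hasSkewProg (f : MvPolynomial σ ℂ) : ∃ n, HasSkewProg f n :=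
  let ⟨n, hn⟩ := exists_cost f
  ⟨n, (hn ∅).hasSkewProg⟩

theorem HasSkewProg.wsComplexity_le {f : MvPolynomial σ ℂ} {n : ℕ} (h : HasSkewProg f n) :
    wsComplexity f ≤ 2 * n := by
  obtain ⟨C, h1, h2, h3⟩ := h.exists_circuit
  exact le_trans (Nat.sInf_le ⟨C, h1, h2, rfl⟩) h3

theorem HasSkewProg.complexity_le {f : MvPolynomial σ ℂ} {n : ℕ} (h : HasSkewProg f n) :
    complexity f ≤ 2 * n := by
  obtain ⟨C, -, h2, h3⟩ := h.exists_circuit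
  exact le_trans (Nat.sInf_le ⟨C, h2, rfl⟩) h3

theorem hasSkewProg_wsComplexity (f : MvPolynomial σ ℂ) : HasSkewProg f (2 * wsComplexity f) := by
  have hne : {r | ∃ C : Circuit σ, C.WeaklySkew ∧ C.poly = f ∧ C.size = r}.Nonempty := by
    obtain ⟨n, hn⟩ := exists_hasSkewProg f
    obtain ⟨C, h1, h2, -⟩ := hn.exists_circuit
    exact ⟨_, C, h1, h2, rfl⟩
  obtain ⟨C, h1, h2, h3⟩ := Nat.sInf_mem hne
  have := h1.hasSkewProg
  rw [h2, h3] at this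
  exact this

theorem exists_prog_complexity (f : MvPolynomial σ ℂ) :
    ∃ l, Prog ArithRule l ∧ l.length = complexity f ∧ f ∈ l := by
  have hne : {r | ∃ C : Circuit σ, C.poly = f ∧ C.size = r}.Nonempty := by
    obtain ⟨n, hn⟩ := exists_hasSkewProg f
    obtain ⟨C, -, h2, -⟩ := hn.exists_circuit
    exact ⟨_, C, h2, rfl⟩
  obtain ⟨C, h2, h3⟩ := Nat.sInf_mem hne
  obtain ⟨l, h4, h5, h6⟩ := C.exists_prog
  exact ⟨l, h4, h5.trans h3, h2 ▸ h6⟩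

end

section

variable {σ : Type*}

/-! ### Determinants of affine matrices -/

/-- `f` is the determinant of an `n × n` matrix of polynomials of degree at most `1` in the variables
of `s`. -/
def IsAffineDet (s : Set σ) (n : ℕ) (f : MvPolynomial σ ℂ) : Prop :=
  ∃ M : Matrix (Fin n) (Fin n) (MvPolynomial σ ℂ), (∀ i j, M i j ∈ affine s) ∧ M.det = f

namespace IsAffineDet

variable {s : Set σ} {n : ℕ} {f : MvPolynomial σ ℂ}

theorem aeval {τ : Type*} {t : Set τ} {θ : σ → MvPolynomial τ ℂ}
    (h : IsAffineDet s n f) (hθ : ∀ x ∈ s, θ x ∈ affine t) :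
    IsAffineDet t n (MvPolynomial.aeval θ f) := by
  obtain ⟨M, hM, rfl⟩ := h
  refine ⟨(MvPolynomial.aeval θ).mapMatrix M, fun i j => aeval_mem_affine hθ (hM i j), ?_⟩
  rw [AlgHom.map_det]

theorem succ (h : IsAffineDet s n f) : IsAffineDet s (n + 1) f := by
  obtain ⟨M, hM, rfl⟩ := h
  refine ⟨(Matrix.fromBlocks M 0 0 (1 : Matrix (Fin 1) (Fin 1) _)).submatrix finSumFinEquiv.symm
    finSumFinEquiv.symm, fun i j => ?_, ?_⟩
  · simp only [Matrix.submatrix_apply]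
    rcases finSumFinEquiv.symm i with i | i <;> rcases finSumFinEquiv.symm j with j | j
    · exact hM i j
    · exact Submodule.zero_mem _
    · exact Submodule.zero_mem _
    · simpa [Matrix.one_apply, Subsingleton.elim i j] using one_mem_affine
  · rw [Matrix.det_submatrix_equiv_self, Matrix.det_fromBlocks_zero₂₁, Matrix.det_one, mul_one]

theorem mono_size {m : ℕ} (h : IsAffineDet s n f) (hm : n ≤ m) : IsAffineDet s m f := by
  induction m, hm using Nat.le_induction with
  | base => exact h
  | succ m _ ih => exact ih.succ

end IsAffineDet

/-- The results of a skew program solve a unitriangular linear system with affine coefficients, so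
Cramer's rule expresses them as determinants. -/
theorem HasSkewProg.isAffineDet {f : MvPolynomial σ ℂ} {n : ℕ} (h : HasSkewProg f n) :
    IsAffineDet Set.univ n f := by
  obtain ⟨l, hl, hn, hf⟩ := h
  obtain ⟨v, hv, hmem⟩ := hl.exists_seq SkewRule.mono
  obtain ⟨i₀, hi₀, rfl⟩ := hmem f hf
  refine IsAffineDet.mono_size ?_ hn
  set L := l.length
  -- `v i` is an affine combination of the previous results: the rows `N` of the coefficients form
  -- a strictly lower triangular matrix
  have key : ∀ i : Fin L, ∃ (N : Fin L → MvPolynomial σ ℂ) (e : MvPolynomial σ ℂ),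
      (∀ j, N j ∈ affine Set.univ) ∧ e ∈ affine Set.univ ∧ (∀ j, i ≤ j → N j = 0) ∧
        v i = ∑ j, N j * v j + e := by
    intro i
    have hs : ∀ (j : Fin L) (a : MvPolynomial σ ℂ), a ∈ affine Set.univ →
        ∀ k, (Pi.single j a : Fin L → MvPolynomial σ ℂ) k ∈ affine Set.univ := fun j a ha k => by
      by_cases h : k = j
      · subst h
        simpa using ha
      · simp [Pi.single_eq_of_ne h]
    have hz : ∀ (j : Fin L) (a : MvPolynomial σ ℂ), j < i → ∀ k, i ≤ k →
        (Pi.single j a : Fin L → MvPolynomial σ ℂ) k = 0 := fun j a hj k hk =>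
      Pi.single_eq_of_ne (hj.trans_le hk).ne' _
    have hsum : ∀ (j : Fin L) (a : MvPolynomial σ ℂ),
        ∑ k, (Pi.single j a : Fin L → MvPolynomial σ ℂ) k * v k = a * v j := fun j a => by
      rw [Finset.sum_eq_single j]
      · simp
      · intro k _ hk
        simp [Pi.single_eq_of_ne hk]
      · simp
    rcases hv i i.2 with ⟨c, hc⟩ | ⟨p, ⟨j, hj, rfl⟩, q, ⟨k, hk, rfl⟩, h⟩ | ⟨p, ⟨j, hj, rfl⟩, c, h⟩ |
      ⟨p, ⟨j, hj, rfl⟩, x, h⟩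
    · exact ⟨0, C c, fun _ => Submodule.zero_mem _, C_mem_affine c, fun _ _ => rfl, by simp [hc]⟩
    · let j' : Fin L := ⟨j, hj.trans i.2⟩
      let k' : Fin L := ⟨k, hk.trans i.2⟩
      refine ⟨Pi.single j' 1 + Pi.single k' 1, 0, fun a => Submodule.add_mem _
        (hs j' 1 one_mem_affine a) (hs k' 1 one_mem_affine a), Submodule.zero_mem _, fun a ha => ?_, ?_⟩
      · rw [Pi.add_apply, hz j' 1 hj a ha, hz k' 1 hk a ha, add_zero]
      · simp only [Pi.add_apply, add_mul, Finset.sum_add_distrib, hsum, one_mul, add_zero]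
        exact h
    · let j' : Fin L := ⟨j, hj.trans i.2⟩
      exact ⟨Pi.single j' (C c), 0, hs j' _ (C_mem_affine c), Submodule.zero_mem _, hz j' _ hj, by
        rw [hsum, add_zero]; exact h⟩
    · let j' : Fin L := ⟨j, hj.trans i.2⟩
      exact ⟨Pi.single j' (X x), 0, hs j' _ (X_mem_affine trivial), Submodule.zero_mem _, hz j' _ hj, by
        rw [hsum, add_zero]; exact h⟩
  choose N e hN he hlow hve using key
  let A : Matrix (Fin L) (Fin L) (MvPolynomial σ ℂ) := 1 - Matrix.of N
  let w : Fin L → MvPolynomial σ ℂ := fun i => v i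
  have hA : A.mulVec w = e := by
    rw [Matrix.sub_mulVec, Matrix.one_mulVec]
    funext i
    simp only [Pi.sub_apply, Matrix.mulVec, dotProduct, Matrix.of_apply, w]
    rw [hve i]
    ring
  have hdet : A.det = 1 := by
    rw [Matrix.det_of_isLowerTriangular]
    · refine Finset.prod_eq_one fun i _ => ?_
      simp [A, hlow i i le_rfl]
    · intro i j hij
      have hij' : i < j := hij
      simp [A, hlow i j hij'.le, hij'.ne]
  have hcr : A.cramer e = w := by
    rw [← hA, Matrix.cramer_eq_adjugate_mulVec, Matrix.mulVec_mulVec, Matrix.adjugate_mul, hdet,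
      one_smul, Matrix.one_mulVec]
  refine ⟨A.updateCol ⟨i₀, hi₀⟩ e, fun i j => ?_, ?_⟩
  · rw [Matrix.updateCol_apply]
    split
    · exact he i
    · refine Submodule.sub_mem _ ?_ (hN i j)
      rw [Matrix.one_apply]
      split
      · exact one_mem_affine
      · exact Submodule.zero_mem _
  · rw [← Matrix.cramer_apply, hcr]

/-! ### Computing determinants by skew programs -/

section Berkowitz

variable {R : Type*} [CommRing R]

/-- The power series `det (1 - t M)`. -/
def detSeries {ι : Type*} [Fintype ι] [DecidableEq ι] (M : Matrix ι ι R) : PowerSeries R :=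
  (1 - (PowerSeries.X : PowerSeries R) • M.map PowerSeries.C).det

theorem constantCoeff_detSeries {ι : Type*} [Fintype ι] [DecidableEq ι] (M : Matrix ι ι R) :
    PowerSeries.constantCoeff (detSeries M) = 1 := by
  rw [detSeries, RingHom.map_det]
  have : (PowerSeries.constantCoeff (R := R)).mapMatrix
      (1 - (PowerSeries.X : PowerSeries R) • M.map PowerSeries.C) = 1 := by
    ext i j
    by_cases h : i = j <;> simp [Matrix.one_apply, h]
  rw [this, Matrix.det_one]

theorem coeff_detSeries {n : ℕ} (M : Matrix (Fin n) (Fin n) R) :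
    PowerSeries.coeff n (detSeries M) = (-1) ^ n * M.det := by
  nontriviality R
  have h1 : detSeries M = (M.charpolyRev : PowerSeries R) := by
    rw [detSeries, Matrix.charpolyRev, ← Polynomial.coeToPowerSeries.ringHom_apply,
      RingHom.map_det]
    congr 1
    ext i j : 2
    by_cases h : i = j <;> simp [h] <;> exact mul_comm _ _
  rw [h1, Polynomial.coeff_coe, ← Matrix.reverse_charpoly, Matrix.det_eq_sign_charpoly_coeff,
    Fintype.card_fin, ← mul_assoc, ← mul_pow]
  have h2 : M.charpoly.natDegree = n := by simp [Matrix.charpoly_natDegree_eq_dim]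
  rw [Polynomial.coeff_reverse, h2, Polynomial.revAt_le le_rfl]
  simp

/-- Bordering a matrix: the series `det (1 - t M)` of a bordered matrix, in terms of that of the
matrix and the solution of a linear recursion. -/
theorem exists_detSeries_fromBlocks {n : ℕ} (M : Matrix (Fin n) (Fin n) R)
    (c : Matrix (Fin n) (Fin 1) R) (r : Matrix (Fin 1) (Fin n) R) (d : Matrix (Fin 1) (Fin 1) R) :
    ∃ W : Fin n → PowerSeries R,
      (∀ a, W a = PowerSeries.X * (PowerSeries.C (c a 0) * detSeries M +
        ∑ b, PowerSeries.C (M a b) * W b)) ∧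
      detSeries (Matrix.fromBlocks M c r d) = detSeries M - PowerSeries.X *
        (PowerSeries.C (d 0 0) * detSeries M + ∑ a, PowerSeries.C (r 0 a) * W a) := by
  set t : PowerSeries R := PowerSeries.X
  set A : Matrix (Fin n) (Fin n) (PowerSeries R) := 1 - t • M.map PowerSeries.C with hA
  have hunit : IsUnit A.det := by
    rw [PowerSeries.isUnit_iff_constantCoeff]
    rw [show A.det = detSeries M from rfl, constantCoeff_detSeries]
    exact isUnit_one
  let u : Fin n → PowerSeries R := fun a => t * PowerSeries.C (c a 0) * detSeries M
  let W : Fin n → PowerSeries R := A⁻¹.mulVec u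
  have hAW : A.mulVec W = u := by
    rw [Matrix.mulVec_mulVec, Matrix.mul_nonsing_inv _ hunit, Matrix.one_mulVec]
  refine ⟨W, fun a => ?_, ?_⟩
  · have h1 := congrFun hAW a
    rw [hA, Matrix.sub_mulVec, Matrix.one_mulVec, Pi.sub_apply, sub_eq_iff_eq_add] at h1
    rw [h1]
    simp only [u, Matrix.mulVec, dotProduct, Matrix.smul_apply, Matrix.map_apply, smul_eq_mul,
      mul_assoc, ← Finset.mul_sum]
    ring
  · have hblock : (1 - t • (Matrix.fromBlocks M c r d).map PowerSeries.C) = Matrix.fromBlocks A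
        (-(t • c.map PowerSeries.C)) (-(t • r.map PowerSeries.C))
        (1 - t • d.map PowerSeries.C) := by
      rw [← Matrix.fromBlocks_one, Matrix.fromBlocks_map, Matrix.fromBlocks_smul,
        sub_eq_add_neg, Matrix.fromBlocks_neg, Matrix.fromBlocks_add, zero_add, zero_add,
        ← sub_eq_add_neg, ← sub_eq_add_neg]
    have hinv : Invertible A := Matrix.invertibleOfIsUnitDet A hunit
    have hW : ∀ a, W a = (A⁻¹ * (t • c.map PowerSeries.C)) a 0 * detSeries M := fun a => by
      simp only [W, u, Matrix.mulVec, dotProduct, Matrix.mul_apply, Finset.sum_mul,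
        Matrix.smul_apply, Matrix.map_apply, smul_eq_mul]
      exact Finset.sum_congr rfl fun _ _ => by ring
    rw [detSeries, show (PowerSeries.X : PowerSeries R) = t from rfl, hblock,
      Matrix.det_fromBlocks₁₁, show A.det = detSeries M from rfl, Matrix.det_fin_one,
      Matrix.invOf_eq_nonsing_inv, Matrix.neg_mul, Matrix.neg_mul, Matrix.mul_neg, neg_neg,
      Matrix.mul_assoc]
    simp only [Matrix.sub_apply, Matrix.one_apply_eq, Matrix.smul_apply, Matrix.map_apply,
      smul_eq_mul, hW]
    rw [Matrix.mul_apply]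
    simp only [Matrix.smul_apply, Matrix.map_apply, smul_eq_mul, ← mul_assoc, ← Finset.sum_mul]
    simp only [mul_assoc, ← Finset.mul_sum]
    ring

end Berkowitz

/-- One bordering step on coefficients. -/
theorem cost_detSeries_fromBlocks {n N : ℕ} {s : Finset σ}
    (M : Matrix (Fin n) (Fin n) (MvPolynomial σ ℂ)) (c : Matrix (Fin n) (Fin 1) (MvPolynomial σ ℂ))
    (r : Matrix (Fin 1) (Fin n) (MvPolynomial σ ℂ)) (d : Matrix (Fin 1) (Fin 1) (MvPolynomial σ ℂ))
    (hM : ∀ i j, M i j ∈ affine (s : Set σ)) (hc : ∀ i j, c i j ∈ affine (s : Set σ))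
    (hr : ∀ i j, r i j ∈ affine (s : Set σ)) (hd : ∀ i j, d i j ∈ affine (s : Set σ)) :
    Cost SkewRule (⋃ i ≤ N, {PowerSeries.coeff i (detSeries M)})
      (⋃ i ≤ N, {PowerSeries.coeff i (detSeries (Matrix.fromBlocks M c r d))})
      ((N + 1) * ((n + 2) * ((n + 3) * (3 * s.card + 4)))) := by
  obtain ⟨W, hW, hdet⟩ := exists_detSeries_fromBlocks M c r d
  set q := detSeries M
  set T : Set (MvPolynomial σ ℂ) := ⋃ i ≤ N, {PowerSeries.coeff i q} with hT
  have hTq : ∀ i ≤ N, PowerSeries.coeff i q ∈ T := fun i hi => Set.mem_biUnion (show i ≤ N from hi) rfl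
  let V : ℕ → Set (MvPolynomial σ ℂ) := fun i => ⋃ a : Fin n, {PowerSeries.coeff i (W a)}
  have hVm : ∀ i a, PowerSeries.coeff i (W a) ∈ V i := fun i a => Set.mem_iUnion.mpr ⟨a, rfl⟩
  set E := 3 * s.card + 4 with hE
  have hcoeff : ∀ (p : MvPolynomial σ ℂ) (Q : PowerSeries (MvPolynomial σ ℂ)) (i : ℕ),
      PowerSeries.coeff i (PowerSeries.C p * Q) = p * PowerSeries.coeff i Q := fun p Q i => by
    simp
  have hW0 : ∀ a, PowerSeries.coeff 0 (W a) = C 0 := fun a => by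
    rw [hW a]
    simp
  have hWs : ∀ i a, PowerSeries.coeff (i + 1) (W a) =
      c a 0 * PowerSeries.coeff i q + ∑ b, M a b * PowerSeries.coeff i (W b) := fun i a => by
    rw [hW a, PowerSeries.coeff_succ_X_mul, map_add, map_sum, hcoeff]
    simp only [hcoeff]
  have h0 : Cost SkewRule T (V 0) 1 := by
    refine (cost_C (σ := σ) (T := T) 0).mono subset_rfl ?_ le_rfl
    intro x hx
    obtain ⟨a, ha⟩ := Set.mem_iUnion.mp hx
    rw [Set.mem_singleton_iff.mp ha, hW0]
    rfl
  have hone : ∀ i < N, ∀ a, Cost SkewRule (T ∪ V i) {PowerSeries.coeff (i + 1) (W a)}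
      ((n + 3) * E) := fun i hi a => by
    rw [hWs]
    have h1 : Cost SkewRule (T ∪ V i) {c a 0 * PowerSeries.coeff i q} (3 * s.card + 3) :=
      cost_affine_mul (hc a 0) (Or.inl (hTq i hi.le))
    have h2 : Cost SkewRule (T ∪ V i ∪ {c a 0 * PowerSeries.coeff i q})
        {∑ b, M a b * PowerSeries.coeff i (W b)} (1 + Fintype.card (Fin n) * (3 * s.card + 4)) :=
      cost_dot Finset.univ _ _ (fun b _ => hM a b) fun b _ => Or.inl (Or.inr (hVm i b))
    refine ((h1.trans h2).trans' (cost_add (by simp) (by simp))).mono_cost ?_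
    rw [Fintype.card_fin]
    nlinarith
  have hstep : ∀ i < N, Cost SkewRule (T ∪ V i) (V (i + 1)) (n * ((n + 3) * E)) := fun i hi => by
    refine (Cost.biUnion Finset.univ _ fun a _ => hone i hi a).mono subset_rfl ?_ (by simp)
    intro x hx
    obtain ⟨a, ha⟩ := Set.mem_iUnion.mp hx
    exact Set.mem_biUnion (Finset.mem_univ a) ha
  have hall := (h0.trans (Cost.iterate N hstep)).mono_cost
    (le_refl (1 + N * (n * ((n + 3) * E))))
  set U : Set (MvPolynomial σ ℂ) := V 0 ∪ ⋃ i ≤ N, V i with hU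
  have hUm : ∀ i ≤ N, ∀ a, PowerSeries.coeff i (W a) ∈ U := fun i hi a =>
    Or.inr (Set.mem_biUnion (show i ≤ N from hi) (hVm i a))
  have hnew : ∀ i ∈ Finset.range (N + 1), Cost SkewRule (T ∪ U)
      {PowerSeries.coeff i (detSeries (Matrix.fromBlocks M c r d))} ((n + 3) * E) := by
    intro i hi
    rw [hdet]
    rcases i with _ | i
    · refine (Cost.of_subset ?_).mono_cost (Nat.zero_le _)
      intro x hx
      rw [Set.mem_singleton_iff.mp hx]
      simpa using Or.inl (hTq 0 (Nat.zero_le _))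
    · have hi' : i + 1 ≤ N := by simpa [Nat.lt_succ_iff] using hi
      have h3 : PowerSeries.coeff (i + 1) (q - PowerSeries.X *
          (PowerSeries.C (d 0 0) * q + ∑ a, PowerSeries.C (r 0 a) * W a)) =
          PowerSeries.coeff (i + 1) q + C (-1) * (d 0 0 * PowerSeries.coeff i q +
            ∑ a, r 0 a * PowerSeries.coeff i (W a)) := by
        rw [map_sub, PowerSeries.coeff_succ_X_mul, map_add, map_sum, hcoeff]
        simp only [hcoeff, map_neg, map_one]
        ring
      rw [h3]
      have h1 : Cost SkewRule (T ∪ U) {d 0 0 * PowerSeries.coeff i q} (3 * s.card + 3) :=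
        cost_affine_mul (hd 0 0) (Or.inl (hTq i (by omega)))
      have h2 : Cost SkewRule (T ∪ U ∪ {d 0 0 * PowerSeries.coeff i q})
          {∑ a, r 0 a * PowerSeries.coeff i (W a)} (1 + Fintype.card (Fin n) * (3 * s.card + 4)) :=
        cost_dot Finset.univ _ _ (fun b _ => hr 0 b)
          fun b _ => Or.inl (Or.inr (hUm i (by omega) b))
      have h4 := (h1.trans h2).trans' (cost_add (p := d 0 0 * PowerSeries.coeff i q)
        (q := ∑ a, r 0 a * PowerSeries.coeff i (W a)) (by simp) (by simp))
      have h5 := h4.trans' (cost_C_mul (-1) (Or.inr rfl))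
      have h6 := h5.trans' (cost_add (p := PowerSeries.coeff (i + 1) q)
        (Or.inl (Or.inl (hTq (i + 1) hi'))) (Or.inr rfl))
      refine h6.mono_cost ?_
      rw [Fintype.card_fin]
      nlinarith
  refine (hall.trans' (Cost.biUnion _ _ hnew)).mono subset_rfl ?_ ?_
  · intro x hx
    simp only [Set.mem_iUnion] at hx ⊢
    obtain ⟨i, hi, hx⟩ := hx
    exact ⟨i, Finset.mem_range.mpr (by omega), hx⟩
  · rw [Finset.card_range]
    have : 1 ≤ (n + 3) * E := by
      rw [hE]
      nlinarith
    nlinarith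

theorem cost_detSeries {n N : ℕ} {s : Finset σ}
    (M : Matrix (Fin n) (Fin n) (MvPolynomial σ ℂ)) (hM : ∀ i j, M i j ∈ affine (s : Set σ)) :
    Cost SkewRule ∅ (⋃ i ≤ N, {PowerSeries.coeff i (detSeries M)})
      (2 + n * ((N + 1) * ((n + 2) * ((n + 3) * (3 * s.card + 4))))) := by
  induction n with
  | zero =>
    have h1 : detSeries M = 1 := Matrix.det_isEmpty
    refine ((cost_C (T := ∅) (σ := σ) 0).trans (cost_C 1)).mono subset_rfl ?_ (by omega)
    intro x hx
    simp only [Set.mem_iUnion] at hx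
    obtain ⟨i, -, hx⟩ := hx
    rw [Set.mem_singleton_iff.mp hx, h1, PowerSeries.coeff_one]
    split
    · exact Or.inr (by simp)
    · exact Or.inl (by simp)
  | succ n ih =>
    let e : Fin n ⊕ Fin 1 ≃ Fin (n + 1) := finSumFinEquiv
    let M' := M.submatrix e e
    have hM' : detSeries M = detSeries (Matrix.fromBlocks M'.toBlocks₁₁ M'.toBlocks₁₂ M'.toBlocks₂₁
        M'.toBlocks₂₂) := by
      rw [Matrix.fromBlocks_toBlocks, detSeries, detSeries, ← Matrix.det_submatrix_equiv_self e]
      congr 1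
      ext i j : 2
      simp [M', Matrix.one_apply]
    have h2 := cost_detSeries_fromBlocks (N := N) M'.toBlocks₁₁ M'.toBlocks₁₂ M'.toBlocks₂₁
      M'.toBlocks₂₂ (fun _ _ => hM _ _) (fun _ _ => hM _ _) (fun _ _ => hM _ _) (fun _ _ => hM _ _)
    rw [hM']
    refine ((ih M'.toBlocks₁₁ fun _ _ => hM _ _).trans' (h2.mono Set.subset_union_right
      subset_rfl le_rfl)).mono_cost ?_
    have h3 : (N + 1) * ((n + 2) * ((n + 3) * (3 * s.card + 4))) ≤
        (N + 1) * ((n + 1 + 2) * ((n + 1 + 3) * (3 * s.card + 4))) := by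
      gcongr <;> omega
    calc _ ≤ 2 + n * ((N + 1) * ((n + 1 + 2) * ((n + 1 + 3) * (3 * s.card + 4)))) +
          (N + 1) * ((n + 1 + 2) * ((n + 1 + 3) * (3 * s.card + 4))) := by gcongr
      _ = _ := by ring

/-- The bound for the length of a skew program for determinants. -/
def detCost (n k : ℕ) : ℕ := 3 + n * ((n + 1) * ((n + 2) * ((n + 3) * (3 * k + 4))))

theorem IsAffineDet.hasSkewProg {s : Finset σ} {n : ℕ} {f : MvPolynomial σ ℂ}
    (h : IsAffineDet (s : Set σ) n f) : HasSkewProg f (detCost n s.card) := by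
  obtain ⟨M, hM, rfl⟩ := h
  have h1 := (cost_detSeries (N := n) M hM).trans' (cost_C_mul ((-1) ^ n)
    (p := PowerSeries.coeff n (detSeries M)) (Or.inr (Set.mem_biUnion (show n ≤ n from le_rfl) rfl)))
  have h2 : C ((-1) ^ n) * PowerSeries.coeff n (detSeries M) = M.det := by
    rw [coeff_detSeries, map_pow, map_neg, map_one, ← mul_assoc, ← mul_pow]
    simp
  rw [h2] at h1
  exact (h1.mono_cost (by rw [detCost]; omega)).hasSkewProg

end

/-! ### The topology on polynomials -/

theorem boundedPart_mono {n n' d d' : ℕ} (hn : n ≤ n') (hd : d ≤ d') :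
    boundedPart n d ⊆ boundedPart n' d' := fun _ hf =>
  ⟨fun i hi => (hf.1 i hi).trans_le hn, hf.2.trans hd⟩

theorem exists_mem_boundedPart (f : A) : ∃ n d, f ∈ boundedPart n d :=
  ⟨f.vars.sup id + 1, f.totalDegree,
    fun _ hi => Nat.lt_succ_of_le (Finset.le_sup (f := id) hi), le_rfl⟩

theorem sum_smul_mem_boundedPart {n d : ℕ} {ι : Type*} (s : Finset ι) (c : ι → ℂ) {u : ι → A}
    (hu : ∀ i, u i ∈ boundedPart n d) : ∑ i ∈ s, c i • u i ∈ boundedPart n d := by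
  classical
  refine Finset.sum_induction _ (· ∈ boundedPart n d) (fun f g hf hg => ⟨fun i hi => ?_, ?_⟩)
    ⟨by simp, by simp⟩ (fun j _ => ⟨fun i hi => ?_, ?_⟩)
  · exact (Finset.mem_union.mp (vars_add_subset f g hi)).elim (hf.1 i) (hg.1 i)
  · exact (totalDegree_add f g).trans (max_le hf.2 hg.2)
  · exact (hu j).1 i (by
      rw [mem_vars_iff_mem_support] at hi ⊢
      obtain ⟨s, hs, hi⟩ := hi
      exact ⟨s, support_smul hs, hi⟩)
  · exact (totalDegree_smul_le (c j) (u j)).trans (hu j).2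

/-- Linear combinations of fixed polynomials depend continuously on the coefficients. -/
theorem continuous_sum_smul {ι : Type*} [Fintype ι] (u : ι → A) :
    @Continuous (ι → ℂ) A _ polyTopology fun c => ∑ i, c i • u i := by
  choose N D hu using fun i => exists_mem_boundedPart (u i)
  have hu' : ∀ i, u i ∈ boundedPart (Finset.univ.sup N) (Finset.univ.sup D) := fun i =>
    boundedPart_mono (Finset.le_sup (Finset.mem_univ i)) (Finset.le_sup (Finset.mem_univ i)) (hu i)
  set n := Finset.univ.sup N
  set d := Finset.univ.sup D
  let g : (ι → ℂ) → boundedPart n d := fun c =>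
    ⟨∑ i, c i • u i, sum_smul_mem_boundedPart Finset.univ c hu'⟩
  have hg : @Continuous _ _ _ (boundedPartTopology n d) g := by
    rw [continuous_induced_rng, continuous_pi_iff]
    intro s
    have : (fun c : ι → ℂ => coeff s ((g c : A))) = fun c => ∑ i, c i * coeff s (u i) := by
      funext c
      simp [g, coeff_sum]
    change Continuous fun c : ι → ℂ => coeff s ((g c : A))
    rw [this]
    fun_prop
  have hval : @Continuous _ _ (boundedPartTopology n d) polyTopology
      (Subtype.val : boundedPart n d → A) := by
    rw [continuous_iff_coinduced_le]
    exact le_iSup_of_le n (le_iSup (fun d =>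
      TopologicalSpace.coinduced Subtype.val (boundedPartTopology n d)) d)
  exact @Continuous.comp _ _ _ _ (boundedPartTopology n d) polyTopology g _ hval hg

theorem eq_sum_monomial {n d : ℕ} {f : A} (hf : f ∈ boundedPart n d) :
    f = ∑ s ∈ (Finset.range (d + 1)).biUnion fun k => (Finset.range n).finsuppAntidiag k,
      coeff s f • monomial s (1 : ℂ) := by
  conv_lhs => rw [← support_sum_monomial_coeff f]
  simp only [smul_monomial, smul_eq_mul, mul_one]
  refine Finset.sum_subset (fun s hs => ?_) fun s _ hs => ?_
  · rw [Finset.mem_biUnion]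
    have hsub : s.support ⊆ Finset.range n := fun i hi =>
      Finset.mem_range.mpr (hf.1 i ((mem_vars_iff_mem_support i).mpr ⟨s, hs, hi⟩))
    refine ⟨∑ i ∈ Finset.range n, s i, ?_, Finset.mem_finsuppAntidiag.mpr ⟨rfl, hsub⟩⟩
    rw [Finset.mem_range, Nat.lt_succ_iff]
    refine le_trans (le_of_eq ?_) ((le_totalDegree hs).trans hf.2)
    exact (Finsupp.sum_of_support_subset s hsub (fun _ a => a) (by simp)).symm
  · rw [notMem_support_iff.mp hs, monomial_zero]

/-- A linear map out of the space of polynomials is continuous as soon as it is continuous on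
finite-dimensional subspaces. -/
theorem continuous_of_continuous_sum {E : Type*} [AddCommMonoid E] [Module ℂ E] [TopologicalSpace E]
    (T : A →ₗ[ℂ] E)
    (hT : ∀ (S : Finset (ℕ →₀ ℕ)), Continuous fun c : S → ℂ => ∑ s, c s • T (monomial s.1 1)) :
    @Continuous A E polyTopology _ T := by
  rw [continuous_iSup_dom]
  intro n
  rw [continuous_iSup_dom]
  intro d
  rw [continuous_coinduced_dom]
  set S := (Finset.range (d + 1)).biUnion fun k => (Finset.range n).finsuppAntidiag k
  have h1 : (T ∘ Subtype.val : boundedPart n d → E) =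
      (fun c : S → ℂ => ∑ s, c s • T (monomial s.1 1)) ∘ fun f s => coeff s.1 f.1 := by
    funext f
    simp only [Function.comp_apply]
    conv_lhs => rw [eq_sum_monomial f.2, map_sum]
    simp only [map_smul]
    exact (Finset.sum_coe_sort S fun s => coeff s f.1 • T (monomial s 1)).symm
  rw [h1]
  let := boundedPartTopology n d
  refine (hT S).comp ?_
  have h2 : Continuous fun (f : boundedPart n d) (s : ℕ →₀ ℕ) => coeff s (f : A) :=
    continuous_induced_dom
  exact continuous_pi fun s => (continuous_apply s.1).comp h2

theorem continuous_linearMap (T : A →ₗ[ℂ] A) : @Continuous A A polyTopology polyTopology T := by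
  let := polyTopology
  exact continuous_of_continuous_sum T fun S =>
    continuous_sum_smul fun s : S => T (monomial s.1 1)

theorem continuous_linearFunctional (T : A →ₗ[ℂ] ℂ) : @Continuous A ℂ polyTopology _ T :=
  continuous_of_continuous_sum T fun S => by fun_prop

/-! ### Approximation by skew programs -/

/-- `f` is a limit of polynomials computed by skew programs of length at most `r`. -/
def HasApproxSkewProg (f : A) (r : ℕ) : Prop := f ∈ @closure A polyTopology {g | HasSkewProg g r}

theorem HasSkewProg.mono {σ : Type*} {f : MvPolynomial σ ℂ} {n m : ℕ} (h : HasSkewProg f n)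
    (hm : n ≤ m) : HasSkewProg f m :=
  let ⟨l, h1, h2, h3⟩ := h
  ⟨l, h1, h2.trans hm, h3⟩

theorem HasApproxSkewProg.approxWsComplexity_le {f : A} {n : ℕ} (h : HasApproxSkewProg f n) :
    approxWsComplexity f ≤ 2 * n := by
  let := polyTopology
  exact Nat.sInf_le (closure_mono (fun g (hg : HasSkewProg g n) => hg.wsComplexity_le) h)

theorem hasApproxSkewProg_approxWsComplexity (f : A) :
    HasApproxSkewProg f (2 * approxWsComplexity f) := by
  let := polyTopology
  have hne : {r | f ∈ closure {g : A | wsComplexity g ≤ r}}.Nonempty :=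
    ⟨wsComplexity f, subset_closure (le_refl (wsComplexity f))⟩
  refine closure_mono (fun g hg => ?_) (Nat.sInf_mem hne)
  exact (hasSkewProg_wsComplexity g).mono (Nat.mul_le_mul_left 2 hg)

theorem HasApproxSkewProg.map {f : A} {n m : ℕ} (h : HasApproxSkewProg f n) (T : A →ₗ[ℂ] A)
    (hT : ∀ g, HasSkewProg g n → HasSkewProg (T g) m) : HasApproxSkewProg (T f) m := by
  let := polyTopology
  exact map_mem_closure (continuous_linearMap T) h hT

/-- Affine substitutions preserve approximability, because they preserve determinants of affine
matrices. -/
theorem HasApproxSkewProg.aeval {f : A} {n : ℕ} (h : HasApproxSkewProg f n) {s : Finset ℕ}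
    {θ : ℕ → A} (hθ : ∀ i, θ i ∈ affine (s : Set ℕ)) :
    HasApproxSkewProg (MvPolynomial.aeval θ f) (detCost n s.card) :=
  h.map (MvPolynomial.aeval θ).toLinearMap fun _ hg =>
    (hg.isAffineDet.aeval fun i _ => hθ i).hasSkewProg

/-! ### Polynomial bounds -/

theorem PolyBounded.mono {t u : ℕ → ℕ} (h : PolyBounded u) (hle : ∀ n, t n ≤ u n) : PolyBounded t :=
  let ⟨q, hq⟩ := h
  ⟨q, fun n => (hle n).trans (hq n)⟩

theorem PolyBounded.const (c : ℕ) : PolyBounded fun _ => c := ⟨Polynomial.C c, by simp⟩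

theorem PolyBounded.id : PolyBounded fun n => n := ⟨Polynomial.X, by simp⟩

theorem PolyBounded.eval (q : Polynomial ℕ) : PolyBounded fun n => q.eval n := ⟨q, fun _ => le_rfl⟩

theorem PolyBounded.add {t u : ℕ → ℕ} (ht : PolyBounded t) (hu : PolyBounded u) :
    PolyBounded fun n => t n + u n :=
  let ⟨p, hp⟩ := ht
  let ⟨q, hq⟩ := hu
  ⟨p + q, fun n => by simpa using add_le_add (hp n) (hq n)⟩

theorem PolyBounded.mul {t u : ℕ → ℕ} (ht : PolyBounded t) (hu : PolyBounded u) :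
    PolyBounded fun n => t n * u n :=
  let ⟨p, hp⟩ := ht
  let ⟨q, hq⟩ := hu
  ⟨p * q, fun n => by simpa using Nat.mul_le_mul (hp n) (hq n)⟩

theorem eval_nat_mono (q : Polynomial ℕ) : Monotone fun n : ℕ => q.eval n := fun m n h => by
  simp only [Polynomial.eval_eq_sum_range]
  gcongr

theorem PolyBounded.comp {t u : ℕ → ℕ} (ht : PolyBounded t) (hu : PolyBounded u) :
    PolyBounded fun n => t (u n) :=
  let ⟨p, hp⟩ := ht
  let ⟨q, hq⟩ := hu
  ⟨p.comp q, fun n => (hp _).trans (by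
    rw [Polynomial.eval_comp]
    exact eval_nat_mono p (hq n))⟩

theorem PolyBounded.detCost {t u : ℕ → ℕ} (ht : PolyBounded t) (hu : PolyBounded u) :
    PolyBounded fun n => detCost (t n) (u n) := by
  unfold GCT.detCost
  exact (const 3).add (ht.mul ((ht.add (const 1)).mul ((ht.add (const 2)).mul
    ((ht.add (const 3)).mul (((const 3).mul hu).add (const 4))))))

theorem PolyBounded.of_eventually {t u : ℕ → ℕ} (hu : PolyBounded u)
    (h : ∀ᶠ n in atTop, t n ≤ u n) : PolyBounded t := by
  obtain ⟨N, hN⟩ := eventually_atTop.mp h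
  refine (hu.add (const (∑ i ∈ Finset.range N, t i))).mono fun n => ?_
  by_cases hn : N ≤ n
  · exact (hN n hn).trans (Nat.le_add_right _ _)
  · exact (Finset.single_le_sum (f := t) (fun _ _ => Nat.zero_le _)
      (Finset.mem_range.mpr (not_le.mp hn))).trans (Nat.le_add_left _ _)

theorem PolyBounded.eventually_le_pow {t : ℕ → ℕ} (h : PolyBounded t) :
    ∃ c, 2 ≤ c ∧ ∀ᶠ m in atTop, t m ≤ m ^ c := by
  obtain ⟨q, hq⟩ := h
  suffices ∃ c, 2 ≤ c ∧ ∀ᶠ m in atTop, q.eval m ≤ m ^ c by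
    obtain ⟨c, hc, h⟩ := this
    exact ⟨c, hc, h.mono fun m hm => (hq m).trans hm⟩
  clear hq
  induction q using Polynomial.induction_on' with
  | add p q hp hq =>
    obtain ⟨c, hc, h⟩ := hp
    obtain ⟨d, hd, h'⟩ := hq
    refine ⟨max c d + 1, by omega, ?_⟩
    filter_upwards [h, h', eventually_ge_atTop 2] with m h1 h2 hm
    rw [Polynomial.eval_add]
    calc _ ≤ m ^ max c d + m ^ max c d :=
          add_le_add (h1.trans (Nat.pow_le_pow_right (by omega) (le_max_left _ _)))
            (h2.trans (Nat.pow_le_pow_right (by omega) (le_max_right _ _)))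
      _ = m ^ max c d * 2 := by ring
      _ ≤ m ^ max c d * m := Nat.mul_le_mul_left _ hm
      _ = _ := (pow_succ _ _).symm
  | monomial k a =>
    refine ⟨k + 2, by omega, ?_⟩
    filter_upwards [eventually_ge_atTop (a + 1)] with m hm
    rw [Polynomial.eval_monomial, pow_add, mul_comm]
    exact Nat.mul_le_mul_left _ (by nlinarith)

/-! ### Orbit closures and substitutions -/

theorem eval_smul_of_isHomogeneous {σ : Type*} {F : MvPolynomial σ ℂ} {d : ℕ}
    (hF : F.IsHomogeneous d) (t : ℂ) (c : σ → ℂ) :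
    eval (fun i => t * c i) F = t ^ d * eval c F := by
  rw [eval_eq, eval_eq, Finset.mul_sum]
  refine Finset.sum_congr rfl fun s hs => ?_
  have h1 : ∑ i ∈ s.support, s i = d := (hF.degree_eq_sum_deg_support hs).symm
  simp only [mul_pow, Finset.prod_mul_distrib, Finset.prod_pow_eq_pow_sum, h1]
  ring

/-- Vanishing of a homogeneous polynomial at a point does not depend on the representative. -/
theorem eval_rep_mk_eq_zero_iff {V : Type} [AddCommGroup V] [Module ℂ V]
    {F : MvPolynomial (Module.Dual ℂ V) ℂ} {d : ℕ} (hF : F.IsHomogeneous d) {v : V} (hv : v ≠ 0) :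
    eval (fun φ => φ (Projectivization.mk ℂ v hv).rep) F = 0 ↔ eval (fun φ => φ v) F = 0 := by
  obtain ⟨a, ha⟩ := Projectivization.exists_smul_eq_mk_rep ℂ v hv
  have : (fun φ : Module.Dual ℂ V => φ (Projectivization.mk ℂ v hv).rep) =
      fun φ => (a : ℂ) * φ v := by
    funext φ
    rw [← ha, Units.smul_def, map_smul, smul_eq_mul]
  rw [this, eval_smul_of_isHomogeneous hF]
  simp

section Orbit

variable {N : Type} [Fintype N]

/-- The exponents of the monomials of degree `d` in the variables of `N`. -/
abbrev Expo (N : Type) [Fintype N] [DecidableEq N] (d : ℕ) : Type :=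
  {s : N →₀ ℕ // s ∈ Finset.univ.finsuppAntidiag d}

/-- The coefficients of `subst g f` are polynomial functions of the entries of `g`. -/
theorem exists_coeff_subst (f : MvPolynomial N ℂ) :
    ∃ Φ : (N →₀ ℕ) → MvPolynomial (N × N) ℂ, ∀ (x : N × N → ℂ) s,
      coeff s (subst (Matrix.of fun i j => x (i, j)) f) = eval x (Φ s) := by
  let θ : N → MvPolynomial N (MvPolynomial (N × N) ℂ) := fun k => ∑ j, C (X (j, k)) * X j
  refine ⟨fun s => coeff s (eval₂ (C.comp C) θ f), fun x s => ?_⟩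
  rw [← coeff_map]
  congr 1
  have : (subst (Matrix.of fun i j => x (i, j)) : MvPolynomial N ℂ →+* MvPolynomial N ℂ) =
      (MvPolynomial.map (eval x)).comp (eval₂Hom (C.comp C) θ) := by
    refine MvPolynomial.ringHom_ext (fun c => ?_) fun k => ?_
    · simp [subst]
    · simp [subst, θ, map_sum]
  exact DFunLike.congr_fun this f

theorem subst_smul_matrix {d : ℕ} {f : MvPolynomial N ℂ} (hf : f.IsHomogeneous d) (t : ℂ)
    (g : Matrix N N ℂ) : subst (t • g) f = C (t ^ d) * subst g f := by
  have h1 : subst (t • g) f = aeval (fun k => C t * (∑ j, C (g j k) * X j)) f := by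
    rw [subst]
    congr 2
    funext k
    simp only [Matrix.smul_apply, smul_eq_mul, map_mul, Finset.mul_sum, mul_assoc]
  rw [h1, subst, aeval_def, aeval_def, eval₂_eq, eval₂_eq, Finset.mul_sum]
  refine Finset.sum_congr rfl fun s hs => ?_
  have h2 : ∑ i ∈ s.support, s i = d := (hf.degree_eq_sum_deg_support hs).symm
  simp only [mul_pow, Finset.prod_mul_distrib, Finset.prod_pow_eq_pow_sum, h2, map_pow]
  ring

variable [DecidableEq N]

theorem degree_of_mem_finsuppAntidiag {d : ℕ} {s : N →₀ ℕ}
    (hs : s ∈ Finset.univ.finsuppAntidiag d) : s.degree = d := by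
  rw [Finsupp.degree_eq_sum]
  exact (Finset.mem_finsuppAntidiag.mp hs).1

theorem eq_sum_of_isHomogeneous {d : ℕ} {f : MvPolynomial N ℂ} (hf : f.IsHomogeneous d) :
    f = ∑ s : Expo N d, coeff s.1 f • monomial s.1 (1 : ℂ) := by
  conv_lhs => rw [← support_sum_monomial_coeff f]
  simp only [smul_monomial, smul_eq_mul, mul_one]
  rw [Finset.sum_coe_sort (Finset.univ.finsuppAntidiag d) fun s => monomial s (coeff s f)]
  refine Finset.sum_subset (fun s hs => ?_) fun s _ hs => ?_
  · rw [Finset.mem_finsuppAntidiag]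
    refine ⟨?_, Finset.subset_univ _⟩
    have := hf (mem_support_iff.mp hs)
    rw [← Finsupp.degree_eq_sum, Finsupp.degree_eq_weight_one]
    exact this
  · rw [notMem_support_iff.mp hs, monomial_zero]

/-- The monomials as elements of the space of forms. -/
def monomialForm {d : ℕ} (s : Expo N d) : Form N d :=
  ⟨monomial s.1 1, isHomogeneous_monomial 1 (degree_of_mem_finsuppAntidiag s.2)⟩

theorem form_eq_sum {d : ℕ} (f : Form N d) :
    f = ∑ s : Expo N d, coeff s.1 f.1 • monomialForm s := by
  refine Subtype.ext ?_
  rw [Submodule.coe_sum]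
  exact eq_sum_of_isHomogeneous f.2

theorem smul_mk_form {d : ℕ} (g : GL N ℂ) {f : Form N d} (hf : f ≠ 0) :
    ∃ h, g • Projectivization.mk ℂ f hf = Projectivization.mk ℂ (g • f) h :=
  ⟨_, Projectivization.smul_mk g hf⟩

/-- The orbit closure in terms of representatives. -/
theorem mem_orbitClosure_iff {d : ℕ} {f v : Form N d} (hf : f ≠ 0) (hv : v ≠ 0) :
    Projectivization.mk ℂ v hv ∈ orbitClosure (Projectivization.mk ℂ f hf) ↔
      ∀ (k : ℕ) (F : MvPolynomial (Module.Dual ℂ (Form N d)) ℂ), F.IsHomogeneous k →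
        (∀ g : GL N ℂ, eval (fun φ => φ (g • f)) F = 0) → eval (fun φ => φ v) F = 0 := by
  refine forall_congr' fun k => forall_congr' fun F => forall_congr' fun hF => ?_
  rw [eval_rep_mk_eq_zero_iff hF]
  refine imp_congr ⟨fun h g => ?_, ?_⟩ Iff.rfl
  · obtain ⟨hg, h1⟩ := smul_mk_form g hf
    have h2 := h _ ⟨g, rfl⟩
    have h3 : eval (fun φ => φ (g • Projectivization.mk ℂ f hf).rep) F = 0 := h2
    rwa [h1, eval_rep_mk_eq_zero_iff hF] at h3
  · rintro h _ ⟨g, rfl⟩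
    obtain ⟨hg, h1⟩ := smul_mk_form g hf
    have h3 : eval (fun φ => φ (g • Projectivization.mk ℂ f hf).rep) F = 0 := by
      rw [h1, eval_rep_mk_eq_zero_iff hF]
      exact h g
    exact h3

/-- A form in the Zariski closure of the orbit of `f` is a Euclidean limit of forms `subst g f`. -/
theorem exists_subst_near {d : ℕ} (hd : d ≠ 0) {f v : MvPolynomial N ℂ} (hf : f.IsHomogeneous d)
    (hv : v.IsHomogeneous d) (hf0 : (⟨f, hf⟩ : Form N d) ≠ 0) (hv0 : (⟨v, hv⟩ : Form N d) ≠ 0)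
    (h : Projectivization.mk ℂ _ hv0 ∈ orbitClosure (Projectivization.mk ℂ _ hf0)) {ε : ℝ}
    (hε : 0 < ε) :
    ∃ g : Matrix N N ℂ, ∀ s : Expo N d, ‖coeff s.1 (subst g f) - coeff s.1 v‖ < ε := by
  obtain ⟨Φ, hΦ⟩ := exists_coeff_subst f
  have hrel : ∀ G : MvPolynomial (Expo N d) ℂ, aeval (fun s : Expo N d => Φ s.1) G = 0 →
      eval (fun s : Expo N d => coeff s.1 v) G = 0 := by
    intro G hG
    have h1 : ∀ g : Matrix N N ℂ, eval (fun s : Expo N d => coeff s.1 (subst g f)) G = 0 := by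
      intro g
      have h2 := congrArg (eval fun p : N × N => g p.1 p.2) hG
      rw [map_zero] at h2
      rw [← h2]
      have h3 : (aeval (fun p : N × N => g p.1 p.2) : MvPolynomial (N × N) ℂ →ₐ[ℂ] ℂ).comp
          (aeval fun s : Expo N d => Φ s.1) = aeval fun s : Expo N d => coeff s.1 (subst g f) := by
        ext s
        have := hΦ (fun p => g p.1 p.2) s.1
        simp only [AlgHom.comp_apply, aeval_X]
        exact this.symm
      exact (DFunLike.congr_fun h3 G).symm
    -- the set of all `subst g f` is a cone, hence the homogeneous components vanish on it as well
    have h4 : ∀ (k : ℕ) (g : Matrix N N ℂ),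
        eval (fun s : Expo N d => coeff s.1 (subst g f)) (homogeneousComponent k G) = 0 := by
      intro k g
      set c : Expo N d → ℂ := fun s => coeff s.1 (subst g f)
      let P : Polynomial ℂ := ∑ i ∈ Finset.range (G.totalDegree + 1),
        Polynomial.monomial i (eval c (homogeneousComponent i G))
      have hP : P = 0 := by
        refine Polynomial.funext fun t => ?_
        obtain ⟨u, rfl⟩ := IsAlgClosed.exists_pow_nat_eq t (Nat.pos_of_ne_zero hd)
        have h5 := h1 (u • g)
        rw [subst_smul_matrix hf] at h5
        simp only [coeff_C_mul] at h5
        rw [← sum_homogeneousComponent G, map_sum] at h5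
        simp only [Polynomial.eval_finsetSum, Polynomial.eval_monomial, P, Polynomial.eval_zero]
        rw [← h5]
        refine Finset.sum_congr rfl fun i _ => ?_
        rw [eval_smul_of_isHomogeneous (homogeneousComponent_isHomogeneous i G)]
        ring
      by_cases hk : k < G.totalDegree + 1
      · have h6 : P.coeff k = eval c (homogeneousComponent k G) := by
          simp only [P, Polynomial.finsetSum_coeff, Polynomial.coeff_monomial]
          rw [Finset.sum_ite_eq', if_pos (Finset.mem_range.mpr hk)]
        rw [← h6, hP, Polynomial.coeff_zero]
      · rw [homogeneousComponent_eq_zero k G (by omega), map_zero]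
    rw [← sum_homogeneousComponent G, map_sum]
    refine Finset.sum_eq_zero fun k _ => ?_
    let co : Expo N d → Module.Dual ℂ (Form N d) := fun s =>
      (lcoeff ℂ s.1).comp (homogeneousSubmodule N ℂ d).subtype
    have hF : (rename co (homogeneousComponent k G)).IsHomogeneous k :=
      (homogeneousComponent_isHomogeneous k G).rename_isHomogeneous
    have hev : ∀ w : Form N d, eval (fun φ : Module.Dual ℂ (Form N d) => φ w)
        (rename co (homogeneousComponent k G)) =
        eval (fun s : Expo N d => coeff s.1 w.1) (homogeneousComponent k G) := fun w => by
      rw [eval_rename]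
      rfl
    have h7 := (mem_orbitClosure_iff hf0 hv0).mp h k _ hF fun g => by
      rw [hev]
      exact h4 k g.1
    rwa [hev] at h7
  obtain ⟨x, hx⟩ := exists_eval_near_of_forall_relation (fun s : Expo N d => Φ s.1)
    (fun s => coeff s.1 v) hrel hε
  exact ⟨Matrix.of fun i j => x (i, j), fun s => by
    rw [hΦ]
    exact hx s⟩

/-- Equations of the orbit of `f` hold at all `subst h f`, where `h` may be singular. -/
theorem eval_subst_eq_zero {d : ℕ} {f : MvPolynomial N ℂ} (hf : f.IsHomogeneous d)
    {F : MvPolynomial (Module.Dual ℂ (Form N d)) ℂ}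
    (h0 : ∀ g : GL N ℂ, eval (fun φ => φ (g • (⟨f, hf⟩ : Form N d))) F = 0) (h : Matrix N N ℂ) :
    eval (fun φ => φ ⟨subst h f, subst_isHomogeneous h hf⟩) F = 0 := by
  obtain ⟨Φ, hΦ⟩ := exists_coeff_subst f
  let ev : (N × N → ℂ) → ℂ := fun x => eval (fun φ : Module.Dual ℂ (Form N d) =>
    φ ⟨subst (Matrix.of fun i j => x (i, j)) f, subst_isHomogeneous _ hf⟩) F
  have hcont : Continuous ev := by
    refine (MvPolynomial.continuous_eval F).comp (continuous_pi fun φ => ?_)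
    have : (fun x : N × N → ℂ => φ ⟨subst (Matrix.of fun i j => x (i, j)) f,
        subst_isHomogeneous _ hf⟩) =
        fun x => ∑ s : Expo N d, eval x (Φ s.1) * φ (monomialForm s) := by
      funext x
      rw [form_eq_sum ⟨subst (Matrix.of fun i j => x (i, j)) f, subst_isHomogeneous _ hf⟩, map_sum]
      refine Finset.sum_congr rfl fun s _ => ?_
      rw [map_smul, smul_eq_mul, ← hΦ]
    rw [this]
    exact continuous_finsetSum _ fun s _ => (MvPolynomial.continuous_eval _).mul continuous_const
  obtain ⟨t, ht, hdet⟩ := exists_seq_tendsto_eval_ne_zero (Matrix.det_mvPolynomialX_ne_zero N ℂ)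
    fun p => h p.1 p.2
  have hz : ∀ i, ev (t i) = 0 := fun i => by
    have h1 := hdet i
    rw [Matrix.eval_det_mvPolynomialX] at h1
    let g : GL N ℂ := Matrix.GeneralLinearGroup.mkOfDetNeZero (Matrix.of fun a b => t i (a, b)) h1
    exact h0 g
  have hlim := (hcont.tendsto fun p => h p.1 p.2).comp ht
  exact tendsto_nhds_unique hlim (tendsto_const_nhds.congr fun i => (hz i).symm)

end Orbit

/-! ### The conjecture and the permanent -/

/-- If a form `v` lies in the orbit closure of `f`, then each linear image of `v` in `A` is a limit
of images of forms `subst g f`. -/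
theorem map_mem_closure_of_mem_orbitClosure {N : Type} [Fintype N] [DecidableEq N] {d : ℕ}
    (hd : d ≠ 0) {f v : MvPolynomial N ℂ} (hf : f.IsHomogeneous d)
    (hv : v.IsHomogeneous d) (hf0 : (⟨f, hf⟩ : Form N d) ≠ 0) (hv0 : (⟨v, hv⟩ : Form N d) ≠ 0)
    (h : Projectivization.mk ℂ _ hv0 ∈ orbitClosure (Projectivization.mk ℂ _ hf0))
    (T : MvPolynomial N ℂ →ₗ[ℂ] A) {S : Set A} (hS : ∀ g, T (subst g f) ∈ S) :
    T v ∈ @closure A polyTopology S := by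
  let := polyTopology
  have hT : ∀ w : MvPolynomial N ℂ, w.IsHomogeneous d →
      T w = ∑ s : Expo N d, coeff s.1 w • T (monomial s.1 1) := fun w hw => by
    conv_lhs => rw [eq_sum_of_isHomogeneous hw]
    simp only [map_sum, map_smul]
  rw [hT v hv]
  have hmem : (fun s : Expo N d => coeff s.1 v) ∈
      closure (Set.range fun (g : Matrix N N ℂ) (s : Expo N d) => coeff s.1 (subst g f)) := by
    rw [Metric.mem_closure_iff]
    intro ε hε
    obtain ⟨g, hg⟩ := exists_subst_near hd hf hv hf0 hv0 h hε
    refine ⟨_, ⟨g, rfl⟩, (dist_pi_lt_iff hε).mpr fun s => ?_⟩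
    rw [dist_comm, dist_eq_norm]
    exact hg s
  refine map_mem_closure (f := fun c : Expo N d → ℂ => ∑ s, c s • T (monomial s.1 1))
    (continuous_sum_smul _) hmem ?_
  rintro _ ⟨g, rfl⟩
  simp only [← hT _ (subst_isHomogeneous g hf)]
  exact hS g

theorem isAffineDet_det (n : ℕ) : IsAffineDet Set.univ n (det n) :=
  ⟨Matrix.mvPolynomialX (Fin n) (Fin n) ℂ, fun _ _ => X_mem_affine trivial, rfl⟩

/-- The substitution that maps `paddedPerm` to `permSeq`: it sends the variables of the upper left
block to those of `permSeq`, and a further corner variable to `1`. -/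
def unpad (m n : ℕ) (p : Fin n × Fin n) : A :=
  if p.1 < m ∧ p.2 < m then X (p.2 + m * p.1) else if p.1.val = n - 1 ∧ p.2.val = n - 1 then 1 else 0

theorem unpad_mem_affine (m n : ℕ) (p : Fin n × Fin n) :
    unpad m n p ∈ affine (Finset.range (m ^ 2) : Set ℕ) := by
  unfold unpad
  split_ifs with h1 h2
  · refine X_mem_affine (Finset.mem_coe.mpr (Finset.mem_range.mpr ?_))
    nlinarith [h1.1, h1.2]
  · exact one_mem_affine
  · exact Submodule.zero_mem _

theorem aeval_unpad_paddedPerm {m n : ℕ} (h : m ≤ n) :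
    aeval (unpad m n) (paddedPerm h) = permSeq m := by
  rw [paddedPerm, map_mul, map_pow, aeval_rename]
  have h1 : aeval (unpad m n ∘ Prod.map (Fin.castLE h) (Fin.castLE h)) (perm m) = permSeq m := by
    rw [permSeq]
    congr 1
    ext1 p
    simp [unpad]
  rw [h1]
  rcases h.eq_or_lt with rfl | hlt
  · simp
  · rw [ell, dif_pos (by omega), aeval_X, unpad, if_neg (by simp; omega), if_pos ⟨rfl, rfl⟩]
    simp

theorem paddedPermPoint_mem_orbitClosure {m n : ℕ} (h : m ≤ n) :
    paddedPermPoint h ∈ orbitClosure (paddedPermPoint h) :=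
  fun _ _ _ h0 => h0 _ (MulAction.mem_orbit_self _)

/-- The substitution that turns the padded permanent into `permSeq m` maps the forms in the orbit of
the determinant to determinants of affine matrices. -/
theorem hasApproxSkewProg_permSeq {m n : ℕ} (hn : n ≠ 0) (h : m ≤ n)
    (hle : orbitClosure (paddedPermPoint h) ⊆ orbitClosure (detPoint n)) :
    HasApproxSkewProg (permSeq m) (detCost n (m ^ 2)) := by
  rw [← aeval_unpad_paddedPerm h]
  refine map_mem_closure_of_mem_orbitClosure hn (det_isHomogeneous n) (paddedPerm_isHomogeneous h)
    _ _ (hle (paddedPermPoint_mem_orbitClosure h)) (aeval (unpad m n)).toLinearMap fun g => ?_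
  have h1 : (aeval (unpad m n) : _ →ₐ[ℂ] A).comp (subst g) =
      aeval fun k => aeval (unpad m n) (subst g (X k)) := by
    ext1 k
    simp
  have h2 : aeval (unpad m n) (subst g (det n)) =
      aeval (fun k => aeval (unpad m n) (subst g (X k))) (det n) := by
    rw [← h1, AlgHom.comp_apply]
  have h3 := ((isAffineDet_det n).aeval (t := (Finset.range (m ^ 2) : Set ℕ))
    (θ := fun k => aeval (unpad m n) (subst g (X k))) fun k _ => ?_).hasSkewProg
  · rw [Finset.card_range] at h3
    change HasSkewProg (aeval (unpad m n) (subst g (det n))) _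
    rwa [h2]
  · rw [subst, aeval_X, map_sum]
    refine Submodule.sum_mem _ fun j _ => ?_
    rw [map_mul, aeval_C, aeval_X]
    exact C_mul_mem_affine _ (unpad_mem_affine m n j)

theorem permSeq_mem_of_not_conjecture (h : ¬ MulmuleySohoniConjecture) : permSeq ∈ VPwsClosure := by
  rw [MulmuleySohoniConjecture, not_not] at h
  obtain ⟨c, hc, h⟩ := h
  have hp : PolyBounded fun m => 2 * detCost (m ^ c) (m ^ 2) :=
    (PolyBounded.const 2).mul (PolyBounded.detCost
      (⟨Polynomial.X ^ c, by simp⟩ : PolyBounded fun m => m ^ c) ⟨Polynomial.X ^ 2, by simp⟩)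
  refine hp.of_eventually ?_
  filter_upwards [h, eventually_ge_atTop 1] with m hm h1
  exact (hasApproxSkewProg_permSeq (by positivity) _ hm).approxWsComplexity_le

section Homogenize

variable {N : Type}

/-- Homogenization in degree `n`: the homogeneous component of degree `k` is multiplied by
`L ^ (n - k)`, where `L` and the values `ψ i` that are substituted for the variables are meant to be
linear forms. -/
def homogenize (L : MvPolynomial N ℂ) (ψ : ℕ → MvPolynomial N ℂ) (n : ℕ) : A →ₗ[ℂ] MvPolynomial N ℂ :=
  ∑ k ∈ Finset.range (n + 1),
    LinearMap.mulLeft ℂ (L ^ (n - k)) ∘ₗ (aeval ψ).toLinearMap ∘ₗ homogeneousComponent k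

theorem homogenize_apply (L : MvPolynomial N ℂ) (ψ : ℕ → MvPolynomial N ℂ) (n : ℕ) (f : A) :
    homogenize L ψ n f =
      ∑ k ∈ Finset.range (n + 1), L ^ (n - k) * aeval ψ (homogeneousComponent k f) := by
  simp [homogenize, LinearMap.sum_apply]

variable {L : MvPolynomial N ℂ} {ψ : ℕ → MvPolynomial N ℂ}

theorem homogenize_isHomogeneous (hL : L.IsHomogeneous 1) (hψ : ∀ i, (ψ i).IsHomogeneous 1)
    (n : ℕ) (f : A) : (homogenize L ψ n f).IsHomogeneous n := by
  rw [homogenize_apply]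
  refine IsHomogeneous.sum _ _ _ fun k hk => ?_
  have h := (hL.pow (n - k)).mul ((homogeneousComponent_isHomogeneous k f).aeval (n := 1) ψ hψ)
  have hk : k ≤ n := by simpa [Nat.lt_succ_iff] using hk
  rwa [one_mul, one_mul, Nat.sub_add_cancel hk] at h

theorem homogenize_of_isHomogeneous {m n : ℕ} (h : m ≤ n) {f : A} (hf : f.IsHomogeneous m) :
    homogenize L ψ n f = L ^ (n - m) * aeval ψ f := by
  rw [homogenize_apply, Finset.sum_eq_single m]
  · rw [homogeneousComponent_of_mem hf, if_pos rfl]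
  · intro k _ hk
    rw [homogeneousComponent_of_mem hf, if_neg hk, map_zero, mul_zero]
  · intro hm
    exact absurd (Finset.mem_range.mpr (Nat.lt_succ_of_le h)) hm

/-- Homogenization is undone by rescaling to `L = 1`. -/
theorem eval_homogenize {p : N → ℂ} (hp : eval p L ≠ 0) {n : ℕ} {f : A} (hf : f.totalDegree ≤ n) :
    eval p (homogenize L ψ n f) =
      eval p L ^ n * eval (fun i => (eval p L)⁻¹ * eval p (ψ i)) f := by
  have h1 : f = ∑ k ∈ Finset.range (n + 1), homogeneousComponent k f := by
    conv_lhs => rw [← sum_homogeneousComponent f]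
    refine Finset.sum_subset (Finset.range_mono (by omega)) fun k _ hk => ?_
    exact homogeneousComponent_eq_zero k f (by simpa using hk)
  conv_rhs => rw [h1]
  rw [homogenize_apply, map_sum, map_sum, Finset.mul_sum]
  refine Finset.sum_congr rfl fun k hk => ?_
  have hk : k ≤ n := by simpa [Nat.lt_succ_iff] using hk
  rw [eval_smul_of_isHomogeneous (homogeneousComponent_isHomogeneous k f), map_mul, map_pow]
  have h2 : eval p (aeval ψ (homogeneousComponent k f)) =
      eval (fun i => eval p (ψ i)) (homogeneousComponent k f) := by
    have : ((aeval p : MvPolynomial N ℂ →ₐ[ℂ] ℂ).comp (aeval ψ)) = aeval fun i => eval p (ψ i) := by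
      ext i
      simp
    exact DFunLike.congr_fun this _
  rw [h2, ← mul_assoc, inv_pow, ← pow_sub₀ _ hp hk]

theorem totalDegree_le_one_of_mem_affine {σ : Type*} {s : Set σ} {p : MvPolynomial σ ℂ}
    (hp : p ∈ affine s) : p.totalDegree ≤ 1 := by
  refine Submodule.span_induction (p := fun p _ => p.totalDegree ≤ 1) ?_ (by simp)
    (fun p q _ _ h1 h2 => (totalDegree_add p q).trans (max_le h1 h2))
    (fun c p _ h => (totalDegree_smul_le c p).trans h) hp
  rintro _ (rfl | ⟨x, _, rfl⟩)
  · simp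
  · simp

theorem totalDegree_det_le {σ : Type*} {n : ℕ} {M : Matrix (Fin n) (Fin n) (MvPolynomial σ ℂ)}
    (hM : ∀ i j, (M i j).totalDegree ≤ 1) : M.det.totalDegree ≤ n := by
  rw [Matrix.det_apply']
  refine totalDegree_finsetSum_le fun e _ => ?_
  have h1 : (∏ i, M (e i) i).totalDegree ≤ n := by
    refine (totalDegree_finsetProd _ _).trans ((Finset.sum_le_sum fun i _ => hM (e i) i).trans ?_)
    simp
  rcases Int.units_eq_one_or (Equiv.Perm.sign e) with hs | hs <;> simpa [hs] using h1

theorem eq_sum_X_of_isHomogeneous_one [Fintype N] {f : MvPolynomial N ℂ} (hf : f.IsHomogeneous 1) :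
    f = ∑ j, C (coeff (Finsupp.single j 1) f) * X j := by
  classical
  ext s
  simp only [coeff_sum, coeff_C_mul, coeff_X]
  by_cases hs : s.degree = 1
  · obtain ⟨j, rfl⟩ := (Finsupp.sum_eq_one_iff s).mp hs
    rw [Finset.sum_eq_single j]
    · simp
    · intro i _ hi
      rw [if_neg, mul_zero]
      intro h
      exact hi (Finsupp.single_left_injective one_ne_zero h)
    · simp
  · rw [Finset.sum_eq_zero]
    · by_contra h
      have := hf h
      rw [Finsupp.degree_eq_weight_one] at hs
      exact hs this
    · intro j _
      rw [if_neg, mul_zero]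
      rintro rfl
      simp at hs

/-- The homogenization of a determinant of affine forms is a linear image of the determinant. -/
theorem IsAffineDet.exists_subst_eq_homogenize {n : ℕ} {L : MvPolynomial (Fin n × Fin n) ℂ}
    {ψ : ℕ → MvPolynomial (Fin n × Fin n) ℂ} (hL0 : L ≠ 0) (hL : L.IsHomogeneous 1)
    (hψ : ∀ i, (ψ i).IsHomogeneous 1) {f : A} (hf : IsAffineDet Set.univ n f) :
    ∃ h : Matrix (Fin n × Fin n) (Fin n × Fin n) ℂ, homogenize L ψ n f = subst h (det n) := by
  obtain ⟨M, hM, rfl⟩ := hf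
  have hM1 : ∀ i j, (M i j).totalDegree ≤ 1 := fun i j => totalDegree_le_one_of_mem_affine (hM i j)
  let Q : Matrix (Fin n) (Fin n) (MvPolynomial (Fin n × Fin n) ℂ) :=
    Matrix.of fun i j => homogenize L ψ 1 (M i j)
  refine ⟨Matrix.of fun l p => coeff (Finsupp.single l 1) (Q p.1 p.2), ?_⟩
  have h1 : subst (Matrix.of fun l p => coeff (Finsupp.single l 1) (Q p.1 p.2)) (det n) = Q.det := by
    rw [det, AlgHom.map_det]
    congr 1
    ext1 i j
    rw [AlgHom.mapMatrix_apply, Matrix.map_apply, Matrix.mvPolynomialX_apply, subst, aeval_X]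
    exact (eq_sum_X_of_isHomogeneous_one (homogenize_isHomogeneous hL hψ 1 _)).symm
  rw [h1]
  refine mul_left_cancel₀ hL0 (MvPolynomial.funext fun p => ?_)
  rw [map_mul, map_mul]
  by_cases hp : eval p L = 0
  · simp [hp]
  congr 1
  rw [eval_homogenize hp (totalDegree_det_le hM1), RingHom.map_det, RingHom.map_det]
  have h2 : (eval p).mapMatrix Q =
      eval p L • (eval fun i => (eval p L)⁻¹ * eval p (ψ i)).mapMatrix M := by
    ext i j
    have := eval_homogenize (ψ := ψ) hp (hM1 i j)
    rw [pow_one] at this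
    simpa [Q] using this
  rw [h2, Matrix.det_smul, Fintype.card_fin]

end Homogenize

theorem ell_isHomogeneous (n : ℕ) : (ell n).IsHomogeneous 1 := by
  unfold ell
  split
  · exact isHomogeneous_X ℂ _
  · exact isHomogeneous_zero _ _ _

/-- The variables of `permSeq m` as entries of the upper left block of an `n × n` matrix. -/
def blockVar {m n : ℕ} (h : m ≤ n) (i : ℕ) : MvPolynomial (Fin n × Fin n) ℂ :=
  if hi : i < m * m then
    X (Prod.map (Fin.castLE h) (Fin.castLE h) (finProdFinEquiv.symm ⟨i, hi⟩)) else 0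

theorem blockVar_isHomogeneous {m n : ℕ} (h : m ≤ n) (i : ℕ) : (blockVar h i).IsHomogeneous 1 := by
  unfold blockVar
  split
  · exact isHomogeneous_X ℂ _
  · exact isHomogeneous_zero _ _ _

theorem homogenize_permSeq {m n : ℕ} (h : m ≤ n) :
    homogenize (ell n) (blockVar h) n (permSeq m) = paddedPerm h := by
  rw [permSeq, homogenize_of_isHomogeneous h (perm_isHomogeneous m).rename_isHomogeneous,
    paddedPerm, aeval_rename]
  congr 2
  ext1 p
  rw [aeval_X, rename_X, Function.comp_apply, blockVar, dif_pos (finProdFinEquiv p).isLt, Fin.eta,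
    Equiv.symm_apply_apply]

/-- If the permanent is a limit of polynomials with short skew programs, then equations of the orbit
of the determinant hold at the padded permanent, because both homogenization and the evaluation of an
equation are continuous. -/
theorem orbitClosure_paddedPermPoint_subset {m n r : ℕ} (hn : n ≠ 0) (h : m ≤ n) (hr : r ≤ n)
    (hm : HasApproxSkewProg (permSeq m) r) :
    orbitClosure (paddedPermPoint h) ⊆ orbitClosure (detPoint n) := by
  have hL0 : ell n ≠ 0 := by
    rw [ell, dif_pos (Nat.pos_of_ne_zero hn)]
    exact X_ne_zero _
  let H : A →ₗ[ℂ] Form (Fin n × Fin n) n :=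
    (homogenize (ell n) (blockVar h) n).codRestrict _
      (homogenize_isHomogeneous (ell_isHomogeneous n) (blockVar_isHomogeneous h) n)
  intro p hp d F hF hdet
  have hdet' : ∀ g : GL (Fin n × Fin n) ℂ,
      eval (fun φ => φ (g • (⟨det n, det_isHomogeneous n⟩ : Form (Fin n × Fin n) n))) F = 0 := by
    intro g
    have h2 := hdet _ ⟨g, rfl⟩
    obtain ⟨hg, h1⟩ := smul_mk_form g (f := ⟨det n, det_isHomogeneous n⟩) fun h =>
      Matrix.det_mvPolynomialX_ne_zero (Fin n) ℂ (congrArg Subtype.val h)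
    have h3 : eval (fun φ => φ (g • detPoint n).rep) F = 0 := h2
    rwa [detPoint, h1, eval_rep_mk_eq_zero_iff hF] at h3
  refine hp d F hF ?_
  rintro _ ⟨g, rfl⟩
  change eval (fun φ => φ (g • paddedPermPoint h).rep) F = 0
  obtain ⟨hg, h1⟩ := smul_mk_form g (f := ⟨paddedPerm h, paddedPerm_isHomogeneous h⟩) fun h0 =>
    paddedPerm_ne_zero h (congrArg Subtype.val h0)
  rw [paddedPermPoint, h1, eval_rep_mk_eq_zero_iff hF]
  have hH : (⟨paddedPerm h, paddedPerm_isHomogeneous h⟩ : Form (Fin n × Fin n) n) = H (permSeq m) :=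
    Subtype.ext (homogenize_permSeq h).symm
  rw [hH]
  let := polyTopology
  have hcont : Continuous fun f : A => eval (fun φ => φ (g • H f)) F :=
    (MvPolynomial.continuous_eval F).comp (continuous_pi fun φ =>
      continuous_linearFunctional (φ ∘ₗ DistribSMul.toLinearMap ℂ _ g ∘ₗ H))
  have hsub : {f : A | HasSkewProg f r} ⊆ {f | eval (fun φ => φ (g • H f)) F = 0} := by
    intro f hf
    obtain ⟨a, ha⟩ := (hf.mono hr).isAffineDet.exists_subst_eq_homogenize hL0 (ell_isHomogeneous n)
      (blockVar_isHomogeneous h)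
    have h2 : g • H f = ⟨subst (g.val * a) (det n), subst_isHomogeneous _ (det_isHomogeneous n)⟩ := by
      refine Subtype.ext ?_
      rw [coe_smul_form]
      change subst g.val (homogenize _ _ n f) = subst (g.val * a) (det n)
      rw [ha, subst_mul]
    change eval (fun φ => φ (g • H f)) F = 0
    rw [h2]
    exact eval_subst_eq_zero (det_isHomogeneous n) hdet' _
  exact closure_minimal hsub (isClosed_eq hcont continuous_const) hm

theorem not_conjecture_of_permSeq_mem (h : permSeq ∈ VPwsClosure) : ¬ MulmuleySohoniConjecture := by
  rw [MulmuleySohoniConjecture, not_not]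
  have h2 : PolyBounded fun m => 2 * approxWsComplexity (permSeq m) := (PolyBounded.const 2).mul h
  obtain ⟨c, hc, hle⟩ := h2.eventually_le_pow
  refine ⟨c, by omega, ?_⟩
  filter_upwards [hle, eventually_ge_atTop 1] with m hm h1
  exact orbitClosure_paddedPermPoint_subset (by positivity) _ hm
    (hasApproxSkewProg_approxWsComplexity _)

theorem conjecture_iff_permSeq_notMem : MulmuleySohoniConjecture ↔ permSeq ∉ VPwsClosure :=
  ⟨fun h h' => not_conjecture_of_permSeq_mem h' h, fun h =>
    by_contra fun h' => h (permSeq_mem_of_not_conjecture h')⟩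

/-! ### The permanent belongs to VNP -/

/-- Ryser's formula. A term of the expanded product belongs to a map `φ` from columns to rows, and the
signed sum over `e` vanishes unless `φ` is surjective. -/
theorem permanent_eq_sum_bool {R : Type*} [CommRing R] {n : ℕ} (M : Matrix (Fin n) (Fin n) R) :
    M.permanent = ∑ e : Fin n → Bool, (∏ j, (2 * (if e j then 1 else 0) - 1)) *
      ∏ i, ∑ j, (if e j then 1 else 0) * M j i := by
  let b : Bool → R := fun t => if t then 1 else 0
  have hin : ∀ φ : Fin n → Fin n, ∑ e : Fin n → Bool, (∏ j, (2 * b (e j) - 1)) * ∏ i, b (e (φ i)) =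
      ∏ j, (1 - 0 ^ (Finset.univ.filter fun i => φ i = j).card) := by
    intro φ
    have h1 : ∀ e : Fin n → Bool, (∏ j, (2 * b (e j) - 1)) * ∏ i, b (e (φ i)) =
        ∏ j, ((2 * b (e j) - 1) * b (e j) ^ (Finset.univ.filter fun i => φ i = j).card) := by
      intro e
      rw [Finset.prod_mul_distrib, ← Finset.prod_fiberwise Finset.univ φ fun i => b (e (φ i))]
      congr 1
      refine Finset.prod_congr rfl fun j _ => ?_
      rw [Finset.prod_congr rfl fun i hi => by rw [(Finset.mem_filter.mp hi).2], Finset.prod_const]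
    simp only [h1]
    have h2 := Finset.prod_univ_sum (fun _ : Fin n => (Finset.univ : Finset Bool))
      fun j t => (2 * b t - 1) * b t ^ (Finset.univ.filter fun i => φ i = j).card
    rw [Fintype.piFinset_univ] at h2
    rw [← h2]
    refine Finset.prod_congr rfl fun j _ => ?_
    simp [b]
    ring
  have hexp : ∀ e : Fin n → Bool, ∏ i, ∑ j, b (e j) * M j i =
      ∑ φ : Fin n → Fin n, (∏ i, b (e (φ i))) * ∏ i, M (φ i) i := by
    intro e
    rw [Finset.prod_univ_sum, Fintype.piFinset_univ]
    simp only [Finset.prod_mul_distrib]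
  change _ = ∑ e : Fin n → Bool, (∏ j, (2 * b (e j) - 1)) * ∏ i, ∑ j, b (e j) * M j i
  simp only [hexp, Finset.mul_sum]
  rw [Finset.sum_comm]
  simp only [← mul_assoc, ← Finset.sum_mul, hin]
  refine Finset.sum_of_injOn (fun σ : Equiv.Perm (Fin n) => (σ : Fin n → Fin n))
    (fun _ _ _ _ h => DFunLike.coe_injective h) (fun _ _ => Finset.mem_coe.mpr (Finset.mem_univ _))
    (fun φ _ hφ => ?_) fun σ _ => ?_
  · have hs : ¬ Function.Surjective φ := fun hs => hφ
      ⟨Equiv.ofBijective φ (Finite.surjective_iff_bijective.mp hs), by simp, rfl⟩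
    simp only [Function.Surjective, not_forall, not_exists] at hs
    obtain ⟨j, hj⟩ := hs
    rw [Finset.prod_eq_zero (Finset.mem_univ j), zero_mul]
    rw [Finset.filter_false_of_mem fun i _ => hj i]
    simp
  · have h1 : ∏ j, (1 - 0 ^ (Finset.univ.filter fun i => σ i = j).card : R) = 1 :=
      Finset.prod_eq_one fun j _ => by
        rw [zero_pow, sub_zero]
        exact Finset.card_ne_zero_of_mem (a := σ.symm j) (by simp)
    rw [h1, one_mul]

/-- The polynomial in the variables of `permSeq n` and `n` further ones in Ryser's formula. -/
def ryser (n : ℕ) : MvPolynomial (ℕ ⊕ Fin n) ℂ :=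
  (∏ j : Fin n, (C 2 * X (.inr j) - 1)) *
    ∏ i : Fin n, ∑ j : Fin n, X (.inr j) * X (.inl (i + n * j))

theorem permSeq_eq_permanent (n : ℕ) :
    permSeq n = (Matrix.of fun j i : Fin n => (X (i + n * j) : A)).permanent := by
  simp [permSeq, perm, Matrix.permanent, Matrix.mvPolynomialX_apply]

theorem permSeq_eq_sum (n : ℕ) :
    permSeq n = ∑ e : Fin n → Bool, aeval (Sum.elim X fun i => if e i then 1 else 0) (ryser n) := by
  rw [permSeq_eq_permanent, permanent_eq_sum_bool]
  refine Finset.sum_congr rfl fun e _ => ?_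
  have h2 : (C 2 : A) = 2 := map_ofNat C 2
  simp [ryser, map_prod, map_sum, h2]

theorem cost_prod_mul {σ ι : Type*} (s : Finset ι) (f : ι → MvPolynomial σ ℂ) {n : ℕ}
    (h : ∀ i ∈ s, ∀ T : Set (MvPolynomial σ ℂ), ∀ p ∈ T, Cost SkewRule T {f i * p} n)
    {T : Set (MvPolynomial σ ℂ)} {p : MvPolynomial σ ℂ} (hp : p ∈ T) :
    Cost SkewRule T {(∏ i ∈ s, f i) * p} (s.card * n) := by
  classical
  induction s using Finset.induction_on with
  | empty => exact (Cost.of_subset (by simpa using hp)).mono_cost (Nat.zero_le _)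
  | insert i s hi ih =>
    rw [Finset.prod_insert hi, Finset.card_insert_of_notMem hi, mul_assoc]
    refine ((ih fun j hj => h j (Finset.mem_insert_of_mem hj)).trans'
      (h i (Finset.mem_insert_self _ _) _ _ (by simp))).mono_cost ?_
    ring_nf
    rfl

theorem hasSkewProg_ryser (n : ℕ) :
    HasSkewProg (ryser n) (1 + n * (1 + n * 3) + n * 6) := by
  have h1 : ∀ i ∈ (Finset.univ : Finset (Fin n)), ∀ T : Set (MvPolynomial (ℕ ⊕ Fin n) ℂ), ∀ p ∈ T,
      Cost SkewRule T {(∑ j : Fin n, X (.inr j) * X (.inl (i + n * j))) * p} (1 + n * 3) := by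
    intro i _ T p hp
    have h2 : ∀ x y, Cost SkewRule T {X x * (X y * p)} (1 + 1) := fun x y =>
      (cost_X_mul y hp).trans' (cost_X_mul x (by simp))
    have h3 := cost_sum (T := T) (Finset.univ : Finset (Fin n)) _
      fun j _ => h2 (.inr j) (.inl ((i : ℕ) + n * j))
    rw [Finset.card_univ, Fintype.card_fin] at h3
    simpa only [Finset.sum_mul, mul_assoc] using h3
  have h3 : ∀ j ∈ (Finset.univ : Finset (Fin n)), ∀ T : Set (MvPolynomial (ℕ ⊕ Fin n) ℂ), ∀ p ∈ T,
      Cost SkewRule T {(C 2 * X (.inr j) - 1) * p} 6 := by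
    intro j _ T p hp
    have hm : (C 2 * X (.inr j) - 1 : MvPolynomial (ℕ ⊕ Fin n) ℂ) ∈
        affine (({Sum.inr j} : Finset (ℕ ⊕ Fin n)) : Set (ℕ ⊕ Fin n)) :=
      Submodule.sub_mem _ (C_mul_mem_affine _ (X_mem_affine (by simp))) one_mem_affine
    exact cost_affine_mul hm hp
  have h4 := (cost_C (T := ∅) (σ := ℕ ⊕ Fin n) 1).trans' (cost_prod_mul _ _ h1 (p := C 1) (by simp))
  have h5 := h4.trans' (cost_prod_mul _ _ h3 (p := (∏ i : Fin n, ∑ j : Fin n,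
    X (.inr j) * X (.inl (i + n * j))) * C 1) (by simp))
  rw [Finset.card_univ, Fintype.card_fin, C_1, mul_one] at h5
  exact h5.hasSkewProg

theorem totalDegree_ryser_le (n : ℕ) : (ryser n).totalDegree ≤ n + n * 2 := by
  refine (totalDegree_mul _ _).trans (add_le_add ?_ ?_)
  · refine (totalDegree_finsetProd _ _).trans ((Finset.sum_le_card_nsmul _ _ 1 fun j _ => ?_).trans ?_)
    · refine (totalDegree_sub _ _).trans (max_le ((totalDegree_mul _ _).trans ?_) ?_) <;> simp
    · simp
  · refine (totalDegree_finsetProd _ _).trans ((Finset.sum_le_card_nsmul _ _ 2 fun i _ => ?_).trans ?_)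
    · refine totalDegree_finsetSum_le fun j _ => (totalDegree_mul _ _).trans ?_
      simp
    · simp

theorem permSeq_mem_VNP : permSeq ∈ VNP := by
  refine ⟨Polynomial.X, fun n => ryser (Polynomial.X.eval n), ⟨?_, ?_⟩, fun n => ?_⟩
  · have h1 : PolyBounded fun n => 2 * (1 + n * (1 + n * 3) + n * 6) :=
      (PolyBounded.const 2).mul ((((PolyBounded.const 1).add (PolyBounded.id.mul
        ((PolyBounded.const 1).add (PolyBounded.id.mul (PolyBounded.const 3)))))).add
        (PolyBounded.id.mul (PolyBounded.const 6)))
    exact (h1.comp (PolyBounded.eval Polynomial.X)).mono fun n => (hasSkewProg_ryser _).complexity_le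
  · have h1 : PolyBounded fun n => n + n * 2 :=
      PolyBounded.id.add (PolyBounded.id.mul (PolyBounded.const 2))
    exact (h1.comp (PolyBounded.eval Polynomial.X)).mono fun n => totalDegree_ryser_le _
  · rw [← permSeq_eq_sum, Polynomial.eval_X]

/-! ### Coefficients of products of affine forms -/

section OptionVariable

variable {τ : Type*}

/-- The coefficient of the `D`-th power of the variable `none`. -/
def hide (D : ℕ) (P : MvPolynomial (Option τ) ℂ) : MvPolynomial τ ℂ :=
  (optionEquivLeft ℂ τ P).coeff D

/-- Substitution for the variable `none`. -/
def substNone (Q : MvPolynomial τ ℂ) : MvPolynomial (Option τ) ℂ →ₐ[ℂ] MvPolynomial τ ℂ :=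
  aeval fun o => o.elim Q X

theorem optionEquivLeft_rename_some (p : MvPolynomial τ ℂ) :
    optionEquivLeft ℂ τ (rename some p) = Polynomial.C p := by
  have : (optionEquivLeft ℂ τ).toAlgHom.comp (rename some) = Polynomial.CAlgHom := by
    ext1 i
    simp
  exact DFunLike.congr_fun this p

theorem substNone_eq_eval (Q : MvPolynomial τ ℂ) (P : MvPolynomial (Option τ) ℂ) :
    substNone Q P = (optionEquivLeft ℂ τ P).eval Q := by
  let ev : Polynomial (MvPolynomial τ ℂ) →ₐ[ℂ] MvPolynomial τ ℂ :=
    (Polynomial.aeval Q).restrictScalars ℂ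
  have : substNone Q = ev.comp (optionEquivLeft ℂ τ).toAlgHom := by
    ext1 o
    cases o <;> simp [substNone, ev]
  rw [this]
  simp [ev]

theorem hide_one_eq {P : MvPolynomial (Option τ) ℂ} {e f : MvPolynomial τ ℂ}
    {q : Polynomial (MvPolynomial τ ℂ)}
    (h : optionEquivLeft ℂ τ P = Polynomial.C e + Polynomial.C f * Polynomial.X + Polynomial.X ^ 2 * q) :
    hide 1 P = f := by
  rw [hide, h]
  simp [Polynomial.coeff_X_pow_mul', Polynomial.coeff_C]

/-- A linear combination of coefficients with respect to the variable `none` is a single coefficient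
of the product with another polynomial. -/
theorem hide_mul_sum (D : ℕ) (P : MvPolynomial (Option τ) ℂ) (c : ℕ → MvPolynomial τ ℂ) :
    hide D ((∑ i ∈ Finset.range (D + 1), rename some (c i) * X none ^ (D - i)) * P) =
      ∑ i ∈ Finset.range (D + 1), c i * (optionEquivLeft ℂ τ P).coeff i := by
  rw [hide, Finset.sum_mul, map_sum, Polynomial.finsetSum_coeff]
  refine Finset.sum_congr rfl fun i hi => ?_
  have hi : i ≤ D := by simpa [Nat.lt_succ_iff] using hi
  rw [map_mul, map_mul, map_pow, optionEquivLeft_X_none, optionEquivLeft_rename_some, mul_assoc,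
    Polynomial.coeff_C_mul, Polynomial.coeff_X_pow_mul', if_pos (Nat.sub_le _ _),
    Nat.sub_sub_self hi]

/-- The coefficients of a monomial, where the variable `none` is treated separately. -/
theorem coeff_optionElim {R K : Type*} [CommRing R] (d : K →₀ ℕ) (m : ℕ)
    (p : MvPolynomial (Option K) R) :
    coeff (d.optionElim m) p = (coeff d (optionEquivRight R K p)).coeff m := by
  induction p using MvPolynomial.induction_on' with
  | monomial j r =>
    have h1 : optionEquivRight R K (monomial j r) =
        monomial j.some (Polynomial.monomial (j none) r) := by
      rw [optionEquivRight_apply, aeval_monomial, Finsupp.prod_option_index]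
      · rw [monomial_eq (s := j.some), ← Polynomial.C_mul_X_pow_eq_monomial, map_mul, map_pow]
        simp only [MvPolynomial.algebraMap_apply, Polynomial.algebraMap_eq, Option.elim_none,
          Option.elim_some, mul_assoc]
      · simp
      · intros
        rw [pow_add]
    classical
    rw [h1, coeff_monomial, coeff_monomial]
    by_cases h : j = d.optionElim m
    · subst h
      simp
    · rw [if_neg h]
      split_ifs with h2
      · rw [Polynomial.coeff_monomial, if_neg]
        intro h3
        exact h (by rw [← h2, ← h3, Finsupp.optionElim_some])
      · simp
  | add p q hp hq => simp [hp, hq]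

end OptionVariable

theorem rename_mem_affine {τ τ' : Type*} (f : τ → τ') {a : MvPolynomial τ ℂ}
    (ha : a ∈ affine Set.univ) : rename f a ∈ affine Set.univ := by
  rw [rename_eq_aeval]
  exact aeval_mem_affine (s := Set.univ) (t := Set.univ) (fun x _ => X_mem_affine trivial) ha

/-- `Rep N P`: the polynomial `P` is a coefficient of a product of `N` affine forms, where the
coefficient is taken with respect to some further variables, indexed by `K`. -/
def Rep {τ : Type*} (N : ℕ) (P : MvPolynomial τ ℂ) : Prop :=
  ∃ (K : Type) (_ : Fintype K) (α : K →₀ ℕ) (a : Fin N → MvPolynomial τ ℂ) (b : Fin N → K → ℂ),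
    (∀ i, a i ∈ affine Set.univ) ∧
      P = coeff α (∏ i, (C (a i) + ∑ k, C (C (b i k)) * X k) : MvPolynomial K (MvPolynomial τ ℂ))

namespace Rep

variable {τ : Type*} {N : ℕ}

theorem of_affine {a : MvPolynomial τ ℂ} (ha : a ∈ affine Set.univ) : Rep 1 a :=
  ⟨PEmpty, inferInstance, 0, fun _ => a, fun _ => PEmpty.elim, fun _ => ha, by simp⟩

theorem mul_affine {P a : MvPolynomial τ ℂ} (h : Rep N P) (ha : a ∈ affine Set.univ) :
    Rep (N + 1) (a * P) := by
  obtain ⟨K, hK, α, a', b, ha', rfl⟩ := h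
  refine ⟨K, hK, α, Fin.cons a a', Fin.cons 0 b, fun i => ?_, ?_⟩
  · induction i using Fin.cases with
    | zero => exact ha
    | succ i => exact ha' i
  · rw [Fin.prod_univ_succ]
    simp

theorem mono {P : MvPolynomial τ ℂ} (h : Rep N P) {M : ℕ} (hM : N ≤ M) : Rep M P := by
  induction M, hM using Nat.le_induction with
  | base => exact h
  | succ M _ ih => simpa using ih.mul_affine one_mem_affine

theorem aeval {τ' : Type*} {P : MvPolynomial τ ℂ} (h : Rep N P) {θ : τ → MvPolynomial τ' ℂ}
    (hθ : ∀ x, θ x ∈ affine Set.univ) : Rep N (aeval θ P) := by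
  obtain ⟨K, hK, α, a, b, ha, rfl⟩ := h
  refine ⟨K, hK, α, fun i => MvPolynomial.aeval θ (a i), b,
    fun i => aeval_mem_affine (fun x _ => hθ x) (ha i), ?_⟩
  have := coeff_map (MvPolynomial.aeval θ : _ →ₐ[ℂ] MvPolynomial τ' ℂ).toRingHom
    (∏ i, (C (a i) + ∑ k, C (C (b i k)) * X k) : MvPolynomial K (MvPolynomial τ ℂ)) α
  refine this.symm.trans ?_
  congr 1
  simp [map_prod, map_sum]

theorem exists_optionEquivLeft_eq {p : MvPolynomial (Option τ) ℂ} (hp : p ∈ affine Set.univ) :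
    ∃ a ∈ affine (Set.univ : Set τ), ∃ c : ℂ,
      optionEquivLeft ℂ τ p = Polynomial.C a + Polynomial.C (C c) * Polynomial.X := by
  induction hp using Submodule.span_induction with
  | mem p hp =>
    rcases hp with rfl | ⟨o, _, rfl⟩
    · exact ⟨1, one_mem_affine, 0, by simp⟩
    · cases o with
      | none => exact ⟨0, Submodule.zero_mem _, 1, by simp⟩
      | some x => exact ⟨X x, X_mem_affine trivial, 0, by simp⟩
  | zero => exact ⟨0, Submodule.zero_mem _, 0, by simp⟩
  | add p q _ _ hp hq =>
    obtain ⟨a, ha, c, h1⟩ := hp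
    obtain ⟨a', ha', c', h2⟩ := hq
    refine ⟨a + a', Submodule.add_mem _ ha ha', c + c', ?_⟩
    rw [map_add, h1, h2]
    simp only [map_add]
    ring
  | smul t p _ hp =>
    obtain ⟨a, ha, c, h1⟩ := hp
    refine ⟨C t * a, C_mul_mem_affine _ ha, t * c, ?_⟩
    rw [smul_eq_C_mul, map_mul, h1, optionEquivLeft_C]
    simp only [map_mul]
    ring

theorem hide {P : MvPolynomial (Option τ) ℂ} (h : Rep N P) (D : ℕ) : Rep N (hide D P) := by
  obtain ⟨K, hK, α, a, b, ha, rfl⟩ := h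
  choose a' ha' c hc using fun i => exists_optionEquivLeft_eq (ha i)
  refine ⟨Option K, inferInstance, α.optionElim D, a', fun i o => o.elim (c i) (b i), ha', ?_⟩
  rw [coeff_optionElim, GCT.hide]
  congr 1
  have := coeff_map (optionEquivLeft ℂ τ).toRingEquiv.toRingHom
    (∏ i, (C (a i) + ∑ k, C (C (b i k)) * X k) : MvPolynomial K (MvPolynomial (Option τ) ℂ)) α
  refine this.symm.trans ?_
  congr 1
  simp [map_prod, map_sum, hc, Fintype.sum_option, add_assoc]

theorem rename {τ' : Type*} {P : MvPolynomial τ ℂ} (h : Rep N P) (f : τ → τ') :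
    Rep N (rename f P) := by
  rw [rename_eq_aeval]
  exact h.aeval fun x => X_mem_affine trivial

theorem multiset_prod_mul {P : MvPolynomial τ ℂ} (h : Rep N P) (s : Multiset (MvPolynomial τ ℂ))
    (hs : ∀ a ∈ s, a ∈ affine Set.univ) : Rep (N + s.card) (s.prod * P) := by
  induction s using Multiset.induction_on with
  | empty => simpa using h
  | cons a s ih =>
    rw [Multiset.prod_cons, mul_assoc, Multiset.card_cons, ← add_assoc]
    exact (ih fun b hb => hs b (Multiset.mem_cons_of_mem hb)).mul_affine
      (hs a (Multiset.mem_cons_self a s))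

theorem prod_mul {P : MvPolynomial τ ℂ} (h : Rep N P) {ι : Type*} (s : Finset ι)
    (f : ι → MvPolynomial τ ℂ) (k : ℕ)
    (hf : ∀ i ∈ s, ∀ M Q, Rep M Q → Rep (M + k) (f i * Q)) :
    Rep (N + s.card * k) ((∏ i ∈ s, f i) * P) := by
  classical
  induction s using Finset.induction_on with
  | empty => simpa using h
  | insert i s hi ih =>
    rw [Finset.prod_insert hi, Finset.card_insert_of_notMem hi, mul_assoc]
    refine (hf i (Finset.mem_insert_self _ _) _ _
      (ih fun j hj => hf j (Finset.mem_insert_of_mem hj))).mono ?_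
    ring_nf
    rfl

/-- Multiplication by a quadric of rank at most `3`: up to the factor `2`, it is the coefficient
of `z₁ * z₂` in `(w + z₁ + z₂) * (1 + z₁ + z₂) * (y + z₁ - z₂) * (y' + z₁ - z₂)`. -/
theorem quadric_mul {P y y' w : MvPolynomial τ ℂ} (h : Rep N P) (hy : y ∈ affine Set.univ)
    (hy' : y' ∈ affine Set.univ) (hw : w ∈ affine Set.univ) : Rep (N + 5) ((y * y' - w) * P) := by
  let r : MvPolynomial τ ℂ →ₐ[ℂ] MvPolynomial (Option (Option τ)) ℂ :=
    (MvPolynomial.rename some).comp (MvPolynomial.rename some)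
  have hr : ∀ {a}, a ∈ affine Set.univ → r a ∈ affine Set.univ := fun ha =>
    rename_mem_affine _ (rename_mem_affine _ ha)
  let z₁ : MvPolynomial (Option (Option τ)) ℂ := X none
  let z₂ : MvPolynomial (Option (Option τ)) ℂ := X (some none)
  have hz₁ : z₁ ∈ affine Set.univ := X_mem_affine trivial
  have hz₂ : z₂ ∈ affine Set.univ := X_mem_affine trivial
  have h1 : Rep N (r P) := (h.rename some).rename some
  have h2 := ((((h1.mul_affine (Submodule.sub_mem _ (Submodule.add_mem _ (hr hy') hz₁) hz₂)).mul_affine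
    (Submodule.sub_mem _ (Submodule.add_mem _ (hr hy) hz₁) hz₂)).mul_affine
    (Submodule.add_mem _ (Submodule.add_mem _ one_mem_affine hz₁) hz₂)).mul_affine
    (Submodule.add_mem _ (Submodule.add_mem _ (hr hw) hz₁) hz₂)).hide 1
  have h3 := (h2.hide 1).mul_affine (C_mem_affine (1 / 2))
  convert h3 using 1
  let u : MvPolynomial (Option τ) ℂ := X none
  let v : MvPolynomial τ ℂ →ₐ[ℂ] MvPolynomial (Option τ) ℂ := MvPolynomial.rename some
  have hoz₁ : optionEquivLeft ℂ (Option τ) z₁ = Polynomial.X := optionEquivLeft_X_none ℂ (Option τ)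
  have hoz₂ : optionEquivLeft ℂ (Option τ) z₂ = Polynomial.C u :=
    optionEquivLeft_X_some ℂ (Option τ) none
  have hor : ∀ a, optionEquivLeft ℂ (Option τ) (r a) = Polynomial.C (v a) := fun a =>
    optionEquivLeft_rename_some _
  have hou : optionEquivLeft ℂ τ u = Polynomial.X := optionEquivLeft_X_none ℂ τ
  have hov : ∀ a, optionEquivLeft ℂ τ (v a) = Polynomial.C a := fun a =>
    optionEquivLeft_rename_some _
  rw [hide_one_eq (τ := Option τ) (f := ((v y - u) * (v y' - u) * (v w + 1 + 2 * u) +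
      (v w + u) * (1 + u) * (v y + v y' - 2 * u)) * v P)
    (e := (v w + u) * (1 + u) * (v y - u) * (v y' - u) * v P)
    (q := Polynomial.C (v P) * (Polynomial.X ^ 2 + Polynomial.X * Polynomial.C (v w + v y + v y' + 1) +
      Polynomial.C ((v y - u) * (v y' - u) + (v w + u) * (1 + u) +
        (v w + 1 + 2 * u) * (v y + v y' - 2 * u)))),
    hide_one_eq (f := 2 * (y * y' - w) * P) (e := (y * y' * (w + 1) + w * (y + y')) * P)
    (q := Polynomial.C (-(y + y' + w + 1) * P))]
  · have hC : (C (1 / 2) : MvPolynomial τ ℂ) * 2 = 1 := by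
      rw [← map_ofNat C 2, ← map_mul]
      norm_num
    linear_combination (-(y * y' - w) * P) * hC
  · simp only [map_mul, map_add, map_sub, map_one, map_ofNat, map_neg, hou, hov]
    ring
  · simp only [map_mul, map_add, map_sub, map_one, map_ofNat, hoz₁, hoz₂, hor]
    ring

/-- Substitution of a product: `∑ i, Q ^ i * z ^ (D - i)` is the product of the quadrics `Q - ζ * z`
where `ζ` runs through the nontrivial roots of unity of order `D + 1`. -/
theorem substNone_mul {P : MvPolynomial (Option τ) ℂ} (h : Rep N P) {D : ℕ}
    (hP : (optionEquivLeft ℂ τ P).natDegree ≤ D) {y y' : MvPolynomial τ ℂ}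
    (hy : y ∈ affine Set.univ) (hy' : y' ∈ affine Set.univ) :
    Rep (N + D * 5) (substNone (y * y') P) := by
  classical
  let v : MvPolynomial τ ℂ →ₐ[ℂ] MvPolynomial (Option τ) ℂ := MvPolynomial.rename some
  have hv : ∀ {a}, a ∈ affine Set.univ → v a ∈ affine Set.univ := rename_mem_affine _
  let z : MvPolynomial (Option τ) ℂ := X none
  let Q := v (y * y')
  have hprim := Complex.isPrimitiveRoot_exp (D + 1) (Nat.succ_ne_zero D)
  let S := (Polynomial.nthRootsFinset (D + 1) (1 : ℂ)).erase 1
  have hmem : (1 : ℂ) ∈ Polynomial.nthRootsFinset (D + 1) (1 : ℂ) := by simp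
  have hcard : S.card = D := by
    rw [Finset.card_erase_of_mem hmem, hprim.card_nthRootsFinset, Nat.add_sub_cancel]
  have hpow : Q ^ (D + 1) - z ^ (D + 1) =
      ∏ ζ ∈ Polynomial.nthRootsFinset (D + 1) (1 : ℂ), (Q - C ζ * z) := by
    refine MvPolynomial.funext fun x => ?_
    simp only [map_sub, map_pow, map_prod, map_mul, eval_C]
    exact hprim.pow_sub_pow_eq_prod_sub_mul _ _ (Nat.succ_pos D)
  have hQz : Q - z ≠ 0 := by
    intro h0
    have h1 := congrArg (fun p => (optionEquivLeft ℂ τ p).coeff 1) h0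
    simp only [map_sub, Q, v, z, optionEquivLeft_rename_some, optionEquivLeft_X_none] at h1
    simp at h1
  have hsum : ∑ i ∈ Finset.range (D + 1), Q ^ i * z ^ (D - i) = ∏ ζ ∈ S, (Q - C ζ * z) := by
    refine mul_right_cancel₀ hQz ?_
    have h1 := (Commute.all Q z).geom_sum₂_mul (D + 1)
    rw [Nat.add_sub_cancel] at h1
    rw [h1, hpow, ← Finset.prod_erase_mul _ _ hmem, map_one, one_mul]
  have h1 : Rep (N + D * 5) ((∏ ζ ∈ S, (Q - C ζ * z)) * P) := by
    rw [← hcard]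
    refine h.prod_mul S _ 5 fun ζ _ M R hR => ?_
    have := hR.quadric_mul (hv hy) (hv hy') (w := C ζ * z) (C_mul_mem_affine _ (X_mem_affine trivial))
    rwa [← map_mul] at this
  have h2 := h1.hide D
  rw [← hsum] at h2
  have h3 := hide_mul_sum D P fun i => (y * y') ^ i
  simp only [map_pow] at h3
  rw [substNone_eq_eval, Polynomial.eval_eq_sum_range' (Nat.lt_succ_of_le hP)]
  convert h2 using 1
  rw [h3]
  exact Finset.sum_congr rfl fun i _ => mul_comm _ _

/-- Summation over the values `0` and `1` of a variable: up to powers of the variable, the linear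
functional `z ^ i ↦ 0 ^ i + 1` is given by a polynomial in one variable, which splits. -/
theorem substNone_add {P : MvPolynomial (Option τ) ℂ} (h : Rep N P) {D : ℕ}
    (hP : (optionEquivLeft ℂ τ P).natDegree ≤ D) :
    Rep (N + (D + 1)) (substNone 0 P + substNone 1 P) := by
  let z : MvPolynomial (Option τ) ℂ := X none
  let q : Polynomial ℂ := ∑ i ∈ Finset.range (D + 1), Polynomial.C (0 ^ i + 1) * Polynomial.X ^ (D - i)
  have hq : q.natDegree ≤ D := by
    refine Polynomial.natDegree_sum_le_of_forall_le _ _ fun i _ => ?_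
    exact (Polynomial.natDegree_C_mul_X_pow_le _ _).trans (Nat.sub_le _ _)
  have h1 : Polynomial.aeval z q =
      C q.leadingCoeff * ((q.roots.map fun a => z - C a).prod : MvPolynomial (Option τ) ℂ) := by
    conv_lhs => rw [(IsAlgClosed.splits q).eq_prod_roots]
    rw [map_mul, Polynomial.aeval_C, map_multiset_prod, Multiset.map_map]
    simp [algebraMap_eq]
  have h2 : Rep (N + (D + 1)) (Polynomial.aeval z q * P) := by
    rw [h1, mul_assoc]
    refine ((h.multiset_prod_mul (q.roots.map fun a => z - C a) fun a ha => ?_).mul_affine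
      (C_mem_affine _)).mono ?_
    · obtain ⟨b, -, rfl⟩ := Multiset.mem_map.mp ha
      exact Submodule.sub_mem _ (X_mem_affine trivial) (C_mem_affine b)
    · rw [Multiset.card_map]
      have := (Polynomial.card_roots' q).trans hq
      omega
  have h3 := hide_mul_sum D P fun i => C (0 ^ i + 1)
  have h4 : Polynomial.aeval z q =
      ∑ i ∈ Finset.range (D + 1), MvPolynomial.rename some (C (0 ^ i + 1)) * X none ^ (D - i) := by
    simp [q, map_sum, z]
  rw [h4] at h2
  convert h2.hide D using 1
  rw [h3, substNone_eq_eval, substNone_eq_eval, Polynomial.eval_eq_sum_range' (Nat.lt_succ_of_le hP),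
    Polynomial.eval_eq_sum_range' (Nat.lt_succ_of_le hP), ← Finset.sum_add_distrib]
  refine Finset.sum_congr rfl fun i _ => ?_
  simp only [map_add, map_pow, map_zero, map_one]
  ring

end Rep

/-! ### Weighted degrees -/

/-- All monomials of `P` have weight at most `d`, where the variable `x` has weight `w x`. -/
def HasWeightLE {σ : Type*} (w : σ → ℕ) (d : ℕ) (P : MvPolynomial σ ℂ) : Prop :=
  ∀ s ∈ P.support, Finsupp.weight w s ≤ d

namespace HasWeightLE

variable {σ : Type*} {w : σ → ℕ} {d e : ℕ} {P Q : MvPolynomial σ ℂ}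

theorem mono (h : HasWeightLE w d P) (hd : d ≤ e) : HasWeightLE w e P := fun s hs => (h s hs).trans hd

theorem C (c : ℂ) : HasWeightLE w d (C c) := fun s hs => by
  classical
  have : s = 0 := by
    by_contra h
    rw [mem_support_iff, coeff_C, if_neg (Ne.symm h)] at hs
    exact hs rfl
  simp [this]

theorem X {x : σ} (hx : w x ≤ d) : HasWeightLE w d (X x) := fun s hs => by
  classical
  rw [support_X, Finset.mem_singleton] at hs
  simpa [hs, Finsupp.weight_apply] using hx

theorem add (hP : HasWeightLE w d P) (hQ : HasWeightLE w d Q) : HasWeightLE w d (P + Q) :=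
  fun s hs => by
    classical
    rcases Finset.mem_union.mp (support_add hs) with h | h
    · exact hP s h
    · exact hQ s h

theorem sum {ι : Type*} (t : Finset ι) {f : ι → MvPolynomial σ ℂ}
    (h : ∀ i ∈ t, HasWeightLE w d (f i)) : HasWeightLE w d (∑ i ∈ t, f i) :=
  Finset.sum_induction _ _ (fun _ _ => add) (by simpa using C (w := w) (d := d) 0) h

theorem mul (hP : HasWeightLE w d P) (hQ : HasWeightLE w e Q) : HasWeightLE w (d + e) (P * Q) :=
  fun s hs => by
    classical
    obtain ⟨a, ha, b, hb, rfl⟩ := Finset.mem_add.mp (support_mul P Q hs)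
    rw [map_add]
    exact add_le_add (hP a ha) (hQ b hb)

theorem pow (hP : HasWeightLE w d P) (k : ℕ) : HasWeightLE w (k * d) (P ^ k) := by
  induction k with
  | zero => simpa using C (w := w) (d := 0) 1
  | succ k ih =>
    rw [pow_succ, Nat.succ_mul]
    exact ih.mul hP

theorem prod {ι : Type*} (t : Finset ι) {f : ι → MvPolynomial σ ℂ} {k : ι → ℕ}
    (h : ∀ i ∈ t, HasWeightLE w (k i) (f i)) : HasWeightLE w (∑ i ∈ t, k i) (∏ i ∈ t, f i) := by
  classical
  induction t using Finset.induction_on with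
  | empty => simpa using C (w := w) (d := 0) 1
  | insert i t hi ih =>
    rw [Finset.sum_insert hi, Finset.prod_insert hi]
    exact (h i (Finset.mem_insert_self _ _)).mul (ih fun j hj => h j (Finset.mem_insert_of_mem hj))

/-- A substitution that respects the weights does not increase the weighted degree. -/
theorem aeval {τ : Type*} {v : τ → ℕ} {θ : σ → MvPolynomial τ ℂ} (hP : HasWeightLE w d P)
    (hθ : ∀ x, HasWeightLE v (w x) (θ x)) : HasWeightLE v d (aeval θ P) := by
  rw [aeval_def, eval₂_eq]
  refine sum _ fun s hs => ?_
  have h1 := (C (w := v) (d := 0) (coeff s P)).mul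
    (prod s.support fun x _ => (hθ x).pow (s x))
  refine h1.mono ?_
  rw [zero_add]
  exact hP s hs

theorem natDegree_optionEquivLeft_le {w : Option σ → ℕ} {P : MvPolynomial (Option σ) ℂ}
    (hP : HasWeightLE w d P) (hw : w none ≠ 0) : (optionEquivLeft ℂ σ P).natDegree ≤ d := by
  rw [natDegree_optionEquivLeft, degreeOf_le_iff]
  exact fun s hs => (Finsupp.le_weight w hw s).trans (hP s hs)

theorem of_totalDegree_le (hP : P.totalDegree ≤ d) : HasWeightLE (fun _ => 1) d P := fun s hs => by
  refine le_trans ?_ ((le_totalDegree hs).trans hP)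
  simp [Finsupp.weight_apply]

end HasWeightLE

/-! ### Homogeneous programs -/

/-- The rule of homogeneous programs, the results of which are polynomials together with
their (positive) degrees: the polynomial `0`, variables, linear combinations of two polynomials of the
same degree, and products. -/
def HomRule {τ : Type*} (S : Set (ℕ × MvPolynomial τ ℂ)) (a : ℕ × MvPolynomial τ ℂ) : Prop :=
  (1 ≤ a.1 ∧ a.2 = 0) ∨ (∃ x, a.1 = 1 ∧ a.2 = X x) ∨
    (∃ p q, (a.1, p) ∈ S ∧ (a.1, q) ∈ S ∧ ∃ b c, a.2 = C b * p + C c * q) ∨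
      ∃ p ∈ S, ∃ q ∈ S, a.1 = p.1 + q.1 ∧ a.2 = p.2 * q.2

namespace HomRule

variable {τ : Type*}

theorem mono ⦃S S' : Set (ℕ × MvPolynomial τ ℂ)⦄ ⦃a : ℕ × MvPolynomial τ ℂ⦄ (h : S ⊆ S') :
    HomRule S a → HomRule S' a := by
  rintro (h1 | h1 | ⟨p, q, hp, hq, h1⟩ | ⟨p, hp, q, hq, h1⟩)
  · exact Or.inl h1
  · exact Or.inr (Or.inl h1)
  · exact Or.inr (Or.inr (Or.inl ⟨p, q, h hp, h hq, h1⟩))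
  · exact Or.inr (Or.inr (Or.inr ⟨p, h hp, q, h hq, h1⟩))

variable {T : Set (ℕ × MvPolynomial τ ℂ)} {k : ℕ}

theorem cost_zero (hk : 1 ≤ k) : Cost HomRule T {(k, 0)} 1 :=
  Cost.single mono (Or.inl ⟨hk, rfl⟩)

theorem cost_linear {p q : MvPolynomial τ ℂ} (hp : (k, p) ∈ T) (hq : (k, q) ∈ T) (b c : ℂ) :
    Cost HomRule T {(k, C b * p + C c * q)} 1 :=
  Cost.single mono (Or.inr (Or.inr (Or.inl ⟨p, q, hp, hq, b, c, rfl⟩)))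

theorem cost_mul {i j : ℕ} {p q : MvPolynomial τ ℂ} (hp : (i, p) ∈ T) (hq : (j, q) ∈ T) :
    Cost HomRule T {(i + j, p * q)} 1 :=
  Cost.single mono (Or.inr (Or.inr (Or.inr ⟨_, hp, _, hq, rfl, rfl⟩)))

theorem cost_sum {ι : Type*} (s : Finset ι) (f : ι → MvPolynomial τ ℂ) {n : ℕ} (hk : 1 ≤ k)
    (h : ∀ i ∈ s, Cost HomRule T {(k, f i)} n) :
    Cost HomRule T {(k, ∑ i ∈ s, f i)} (1 + s.card * (n + 1)) := by
  classical
  induction s using Finset.induction_on with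
  | empty => simpa using cost_zero (T := T) hk
  | insert i s hi ih =>
    have h1 := ih fun j hj => h j (Finset.mem_insert_of_mem hj)
    have h2 := (h i (Finset.mem_insert_self _ _)).mono (T' := T ∪ {(k, ∑ j ∈ s, f j)})
      Set.subset_union_left subset_rfl le_rfl
    have h3 := (h1.trans h2).trans' (cost_linear (k := k) (p := f i) (q := ∑ j ∈ s, f j)
      (by simp) (by simp) 1 1)
    rw [C_1, one_mul, one_mul] at h3
    rw [Finset.sum_insert hi, Finset.card_insert_of_notMem hi]
    exact h3.mono_cost (by ring_nf; rfl)

end HomRule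

section Homogenization

variable {τ : Type*}

theorem homogeneousComponent_mul (k : ℕ) (p q : MvPolynomial τ ℂ) :
    homogeneousComponent k (p * q) = ∑ ij ∈ Finset.HasAntidiagonal.antidiagonal k,
      homogeneousComponent ij.1 p * homogeneousComponent ij.2 q := by
  set M := p.totalDegree + q.totalDegree + k + 1
  have h : ∀ f : MvPolynomial τ ℂ, f.totalDegree < M →
      f = ∑ i ∈ Finset.range M, homogeneousComponent i f := fun f hf => by
    conv_lhs => rw [← sum_homogeneousComponent f]
    refine Finset.sum_subset (Finset.range_mono (by omega)) fun i _ hi => ?_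
    exact homogeneousComponent_eq_zero i f (by simpa using hi)
  conv_lhs => rw [h p (by omega), h q (by omega), Finset.sum_mul_sum, ← Finset.sum_product', map_sum]
  have h1 : ∀ ij : ℕ × ℕ, homogeneousComponent k
      (homogeneousComponent ij.1 p * homogeneousComponent ij.2 q) =
      if ij.1 + ij.2 = k then homogeneousComponent ij.1 p * homogeneousComponent ij.2 q else 0 := by
    intro ij
    rw [homogeneousComponent_of_mem (n := ij.1 + ij.2)
      ((homogeneousComponent_isHomogeneous ij.1 p).mul (homogeneousComponent_isHomogeneous ij.2 q))]
    simp only [eq_comm]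
  simp only [h1]
  rw [← Finset.sum_filter]
  refine Finset.sum_congr ?_ fun _ _ => rfl
  ext ij
  simp only [Finset.mem_filter, Finset.mem_product, Finset.mem_range,
    Finset.HasAntidiagonal.mem_antidiagonal]
  omega

/-- The homogeneous components of `p` of the degrees from `1` to `d`. -/
def components (d : ℕ) (p : MvPolynomial τ ℂ) : Set (ℕ × MvPolynomial τ ℂ) :=
  ⋃ k ∈ Finset.Icc 1 d, {(k, homogeneousComponent k p)}

theorem mem_components {d k : ℕ} (h1 : 1 ≤ k) (hd : k ≤ d) (p : MvPolynomial τ ℂ) :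
    (k, homogeneousComponent k p) ∈ components d p :=
  Set.mem_biUnion (Finset.mem_coe.mpr (Finset.mem_Icc.mpr ⟨h1, hd⟩)) rfl

/-- The components of a product are sums of products of components, among which those with a component
of degree `0` are linear combinations. -/
theorem cost_components {d : ℕ} {S : Set (MvPolynomial τ ℂ)} {a : MvPolynomial τ ℂ}
    (h : ArithRule S a) :
    Cost HomRule (⋃ p ∈ S, components d p) (components d a) (d * (2 * d + 3)) := by
  have hc : d * (2 * d + 3) = (Finset.Icc 1 d).card * (2 * d + 3) := by simp
  rw [hc]
  refine Cost.biUnion _ _ fun k hk => ?_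
  obtain ⟨hk1, hkd⟩ := Finset.mem_Icc.mp hk
  have hT : ∀ p ∈ S, ∀ i, 1 ≤ i → i ≤ d →
      (i, homogeneousComponent i p) ∈ ⋃ p ∈ S, components d p := fun p hp i h1 h2 =>
    Set.mem_biUnion hp (mem_components h1 h2 p)
  rcases h with ⟨c, rfl⟩ | ⟨x, rfl⟩ | ⟨p, hp, q, hq, rfl⟩ | ⟨p, hp, q, hq, rfl⟩
  · rw [homogeneousComponent_of_mem (isHomogeneous_C τ c), if_neg (by omega)]
    exact (HomRule.cost_zero hk1).mono_cost (by omega)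
  · rw [homogeneousComponent_of_mem (isHomogeneous_X ℂ x)]
    split_ifs with h1
    · exact (Cost.single HomRule.mono (Or.inr (Or.inl ⟨x, h1, rfl⟩))).mono_cost (by omega)
    · exact (HomRule.cost_zero hk1).mono_cost (by omega)
  · have := HomRule.cost_linear (hT p hp k hk1 hkd) (hT q hq k hk1 hkd) 1 1
    rw [C_1, one_mul, one_mul] at this
    rw [map_add]
    exact this.mono_cost (by omega)
  · rw [homogeneousComponent_mul]
    refine (HomRule.cost_sum (n := 1) _ _ hk1 fun ij hij => ?_).mono_cost ?_
    · rw [Finset.HasAntidiagonal.mem_antidiagonal] at hij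
      rcases Nat.eq_zero_or_pos ij.1 with h0 | h1
      · have h2 : ij.2 = k := by omega
        have := HomRule.cost_linear (hT q hq k hk1 hkd) (hT q hq k hk1 hkd) (coeff 0 p) 0
        rw [h0, h2, homogeneousComponent_zero]
        simpa using this
      rcases Nat.eq_zero_or_pos ij.2 with h0 | h2
      · have h2 : ij.1 = k := by omega
        have := HomRule.cost_linear (hT p hp k hk1 hkd) (hT p hp k hk1 hkd) (coeff 0 q) 0
        rw [h0, h2, homogeneousComponent_zero, mul_comm]
        simpa using this
      · have := HomRule.cost_mul (hT p hp ij.1 h1 (by omega)) (hT q hq ij.2 h2 (by omega))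
        rwa [hij] at this
    · rw [Finset.Nat.card_antidiagonal]
      nlinarith

theorem Prog.cost_components {l : List (MvPolynomial τ ℂ)} (h : Prog ArithRule l) (d : ℕ) :
    Cost HomRule ∅ (⋃ p ∈ {x | x ∈ l}, components d p) (l.length * (d * (2 * d + 3))) := by
  induction h with
  | nil => exact (Cost.of_subset (by simp)).mono_cost (Nat.zero_le _)
  | @cons l a _ ha ih =>
    have h1 := ih.trans ((GCT.cost_components (d := d) ha).mono Set.subset_union_right subset_rfl le_rfl)
    refine h1.mono subset_rfl ?_ (by rw [List.length_cons]; ring_nf; rfl)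
    intro x hx
    simp only [Set.mem_iUnion, Set.mem_ofPred_eq, List.mem_cons] at hx
    obtain ⟨p, rfl | hp, hx⟩ := hx
    · exact Or.inr hx
    · exact Or.inl (Set.mem_biUnion hp hx)

end Homogenization

/-! ### Circuits as coefficients of products of affine forms -/

/-- The results of a homogeneous program are replaced by variables, beginning with the last one. The
weights bound the degrees in these variables and hence the costs of the substitutions. -/
theorem Prog.exists_rep_aeval {τ : Type} {l : List (ℕ × MvPolynomial τ ℂ)} (h : Prog HomRule l)
    (d : ℕ) :
    ∃ (σ : Type) (w : σ → ℕ) (val : σ → MvPolynomial τ ℂ), (∀ y, w y ≠ 0) ∧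
      (∀ x, ∃ y, w y = 1 ∧ val y = X x) ∧ (∀ a ∈ l, ∃ y, w y = a.1 ∧ val y = a.2) ∧
      ∀ N P, HasWeightLE w d P → Rep N P → Rep (N + l.length * (d * 5)) (aeval val P) := by
  induction h with
  | nil =>
    refine ⟨τ, fun _ => 1, X, fun _ => one_ne_zero, fun x => ⟨x, rfl, rfl⟩, by simp,
      fun N P _ hP => ?_⟩
    simpa [aeval_X_left] using hP
  | @cons l a _ ha ih =>
    obtain ⟨σ, w, val, hw, hvar, hval, hrep⟩ := ih
    have hQ : a.1 ≠ 0 ∧ ∃ Q : MvPolynomial σ ℂ, aeval val Q = a.2 ∧ HasWeightLE w a.1 Q ∧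
        (Q ∈ affine Set.univ ∨ ∃ y y', Q = X y * X y') := by
      rcases ha with ⟨h1, h2⟩ | ⟨x, h1, h2⟩ | ⟨p, q, hp, hq, b, c, h2⟩ | ⟨p, hp, q, hq, h1, h2⟩
      · exact ⟨by omega, 0, by simp [h2], by simpa using HasWeightLE.C 0,
          Or.inl (Submodule.zero_mem _)⟩
      · obtain ⟨y, hy, hy'⟩ := hvar x
        exact ⟨by omega, X y, by simp [h2, hy'], HasWeightLE.X (by omega),
          Or.inl (X_mem_affine trivial)⟩
      · obtain ⟨y, hy, rfl⟩ := hval _ hp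
        obtain ⟨z, hz, rfl⟩ := hval _ hq
        have h3 : ∀ (b : ℂ) (y : σ), w y = a.1 → HasWeightLE w a.1 (C b * X y) := fun b y hy => by
          simpa using (HasWeightLE.C (d := 0) b).mul (HasWeightLE.X hy.le)
        exact ⟨by rw [← hy]; exact hw y, C b * X y + C c * X z, by simp [h2], (h3 b y hy).add (h3 c z hz),
          Or.inl (Submodule.add_mem _ (C_mul_mem_affine _ (X_mem_affine trivial))
            (C_mul_mem_affine _ (X_mem_affine trivial)))⟩
      · obtain ⟨y, hy, hy'⟩ := hval _ hp
        obtain ⟨z, hz, hz'⟩ := hval _ hq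
        have := hw y
        refine ⟨by omega, X y * X z, by simp [h2, hy', hz'], ?_, Or.inr ⟨y, z, rfl⟩⟩
        rw [h1]
        exact (HasWeightLE.X hy.le).mul (HasWeightLE.X hz.le)
    obtain ⟨ha0, Q, hQ, hQw, hQ'⟩ := hQ
    refine ⟨Option σ, fun o => o.elim a.1 w, fun o => o.elim a.2 val, ?_, fun x => ?_, ?_,
      fun N P hP hNP => ?_⟩
    · rintro (_ | y)
      · exact ha0
      · exact hw y
    · obtain ⟨y, hy⟩ := hvar x
      exact ⟨some y, hy⟩
    · intro b hb
      rcases List.mem_cons.mp hb with rfl | hb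
      · exact ⟨none, rfl, rfl⟩
      · obtain ⟨y, hy⟩ := hval b hb
        exact ⟨some y, hy⟩
    · have h1 : (aeval fun o : Option σ => o.elim a.2 val) = (aeval val).comp (substNone Q) := by
        ext1 o
        cases o with
        | none => simpa [substNone] using hQ.symm
        | some y => simp [substNone]
      rw [h1, AlgHom.comp_apply]
      have h2 : HasWeightLE w d (substNone Q P) := hP.aeval (by
        rintro (_ | y)
        · exact hQw
        · exact HasWeightLE.X le_rfl)
      have h3 : Rep (N + d * 5) (substNone Q P) := by
        rcases hQ' with hQ' | ⟨y, z, rfl⟩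
        · refine Rep.mono (hNP.aeval ?_) (Nat.le_add_right _ _)
          rintro (_ | y)
          · exact hQ'
          · exact X_mem_affine trivial
        · exact hNP.substNone_mul (hP.natDegree_optionEquivLeft_le ha0) (X_mem_affine trivial)
            (X_mem_affine trivial)
      refine (hrep _ _ h2 h3).mono ?_
      rw [List.length_cons]
      ring_nf
      rfl

/-- A polynomial is the sum of its constant coefficient and its components of positive degree, which are
represented by variables of a homogeneous program. -/
theorem rep_of_complexity {τ : Type} (f : MvPolynomial τ ℂ) {d : ℕ} (hd : f.totalDegree ≤ d) :
    Rep (1 + complexity f * (d * (2 * d + 3)) * (d * 5)) f := by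
  obtain ⟨l, hl, hlen, hf⟩ := exists_prog_complexity f
  obtain ⟨l', hl', -, hlen', hmem⟩ := hl.cost_components d [] .nil (by simp)
  obtain ⟨σ, w, val, -, -, hval, hrep⟩ := hl'.exists_rep_aeval d
  have hk : ∀ k : Finset.Icc 1 d, ∃ y, w y = k.1 ∧ val y = homogeneousComponent k.1 f := fun k =>
    hval _ (hmem _ (Set.mem_biUnion hf
      (mem_components (Finset.mem_Icc.mp k.2).1 (Finset.mem_Icc.mp k.2).2 f)))
  choose y hy hy' using hk
  have h1 := hrep 1 (C (coeff 0 f) + ∑ k : Finset.Icc 1 d, X (y k))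
    ((HasWeightLE.C _).add (HasWeightLE.sum _ fun k _ => HasWeightLE.X
      ((hy k).le.trans (Finset.mem_Icc.mp k.2).2)))
    (Rep.of_affine (Submodule.add_mem _ (C_mem_affine _)
      (Submodule.sum_mem _ fun k _ => X_mem_affine trivial)))
  have h2 : aeval val (C (coeff 0 f) + ∑ k : Finset.Icc 1 d, X (y k)) = f := by
    simp only [map_add, map_sum, aeval_X, hy', algHom_C, algebraMap_eq]
    rw [Finset.sum_coe_sort (Finset.Icc 1 d) fun k => homogeneousComponent k f,
      ← homogeneousComponent_zero]
    have h3 : ∑ k ∈ Finset.range (d + 1), homogeneousComponent k f = f := by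
      conv_rhs => rw [← sum_homogeneousComponent f]
      refine (Finset.sum_subset (Finset.range_mono (by omega)) fun i _ hi => ?_).symm
      exact homogeneousComponent_eq_zero i f (by simpa using hi)
    conv_rhs => rw [← h3, Finset.range_eq_Ico, Finset.sum_eq_sum_Ico_succ_bot (Nat.succ_pos d)]
    rfl
  rw [h2] at h1
  refine h1.mono ?_
  have h4 : l'.length ≤ complexity f * (d * (2 * d + 3)) := by simpa [hlen] using hlen'
  gcongr

/-- Summation over a Boolean cube. -/
theorem Rep.sum_bool {τ : Type*} {d : ℕ} (n : ℕ) {N : ℕ} {P : MvPolynomial (τ ⊕ Fin n) ℂ}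
    (hP : HasWeightLE (fun _ => 1) d P) (h : Rep N P) :
    Rep (N + n * (d + 1)) (∑ e : Fin n → Bool,
      MvPolynomial.aeval (Sum.elim X fun i => if e i then 1 else 0) P : MvPolynomial τ ℂ) := by
  induction n generalizing N with
  | zero =>
    rw [Finset.univ_unique, Finset.sum_singleton, Nat.zero_mul]
    refine h.aeval ?_
    rintro (x | i)
    · exact X_mem_affine trivial
    · exact i.elim0
  | succ n ih =>
    let ε : τ ⊕ Fin (n + 1) → Option (τ ⊕ Fin n) :=
      Sum.elim (fun x => some (.inl x)) (Fin.cons none fun i => some (.inr i))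
    have hP' : HasWeightLE (fun _ => 1) d (MvPolynomial.rename ε P) := by
      rw [rename_eq_aeval]
      exact hP.aeval fun x => HasWeightLE.X le_rfl
    have h1 := (h.rename ε).substNone_add (hP'.natDegree_optionEquivLeft_le one_ne_zero)
    have hsub : ∀ c : ℂ, HasWeightLE (fun _ => 1) d (substNone (C c) (MvPolynomial.rename ε P)) :=
      fun c => hP'.aeval (by
        rintro (_ | y)
        · exact HasWeightLE.C c
        · exact HasWeightLE.X le_rfl)
    have h2 := ih (by simpa using (hsub 0).add (hsub 1)) h1
    have h3 : ∀ (e : Fin n → Bool) (b : Bool),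
        MvPolynomial.aeval (Sum.elim X fun i => if (Fin.cons b e : Fin (n + 1) → Bool) i then 1 else 0) P =
          MvPolynomial.aeval (Sum.elim X fun i => if e i then 1 else 0 : _ → MvPolynomial τ ℂ)
            (substNone (if b then 1 else 0) (MvPolynomial.rename ε P)) := by
      intro e b
      have : MvPolynomial.aeval (Sum.elim X fun i =>
          if (Fin.cons b e : Fin (n + 1) → Bool) i then 1 else 0) =
          ((MvPolynomial.aeval (Sum.elim X fun i => if e i then 1 else 0 : _ → MvPolynomial τ ℂ)).comp
            (substNone (if b then 1 else 0))).comp (MvPolynomial.rename ε) := by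
        ext1 x
        rcases x with x | i
        · simp [ε, substNone]
        · refine Fin.cases ?_ (fun i => ?_) i
          · cases b <;> simp [ε, substNone]
          · simp [ε, substNone]
      rw [this]
      rfl
    have h4 := (Fin.consEquiv fun _ : Fin (n + 1) => Bool).sum_comp fun e : Fin (n + 1) → Bool =>
      (MvPolynomial.aeval (Sum.elim X fun i => if e i then 1 else 0) P : MvPolynomial τ ℂ)
    rw [← h4, Fintype.sum_prod_type_right]
    simp only [Fin.consEquiv_apply, h3]
    refine Rep.mono ?_ (show N + (d + 1) + n * (d + 1) ≤ _ by ring_nf; rfl)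
    convert h2 using 3 with e
    rw [map_add, Fintype.sum_bool, add_comm]
    simp

/-! ### Coefficients of products of affine forms as permanents -/

section Columns

variable {N : ℕ} {K : Type*}

/-- The exponent of the monomial of those variables that are chosen by `φ`, where `none` stands for no
variable. -/
def content (φ : Fin N → Option K) : K →₀ ℕ := ∑ i, (φ i).elim 0 fun k => Finsupp.single k 1

theorem content_comp_perm (φ : Fin N → Option K) (σ : Equiv.Perm (Fin N)) :
    content (φ ∘ σ) = content φ :=
  Equiv.sum_comp σ fun i => (φ i).elim 0 fun k => Finsupp.single k 1

variable [DecidableEq K]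

theorem content_apply (φ : Fin N → Option K) (k : K) :
    content φ k = Fintype.card {i // φ i = some k} := by
  rw [content, Finsupp.finsetSum_apply, Fintype.card_subtype, Finset.card_filter]
  refine Finset.sum_congr rfl fun i _ => ?_
  cases φ i <;> simp [Finsupp.single_apply]

variable [Fintype K]

/-- Two choices of `N` variables with the same product differ by a permutation. -/
theorem exists_perm_of_content_eq {φ ψ : Fin N → Option K} (h : content φ = content ψ) :
    ∃ σ : Equiv.Perm (Fin N), ψ ∘ σ = φ := by
  have hsum : ∀ φ : Fin N → Option K,
      Fintype.card {i // φ i = none} + ∑ k, Fintype.card {i // φ i = some k} = N := fun φ => by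
    rw [← Fintype.sum_option fun o => Fintype.card {i // φ i = o}, ← Fintype.card_sigma,
      Fintype.card_congr (Equiv.sigmaFiberEquiv φ), Fintype.card_fin]
  have hsome : ∀ k, Fintype.card {i // φ i = some k} = Fintype.card {i // ψ i = some k} := fun k => by
    rw [← content_apply, ← content_apply, h]
  have hcard : ∀ o, Fintype.card {i // φ i = o} = Fintype.card {i // ψ i = o} := by
    rintro (_ | k)
    · have h1 := hsum φ
      have h2 := hsum ψ
      simp only [hsome] at h1
      omega
    · exact hsome k
  exact ⟨Equiv.ofFiberEquiv fun o => Fintype.equivOfCardEq (hcard o),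
    funext fun i => Equiv.ofFiberEquiv_map _ i⟩

/-- A coefficient of a product of affine forms is a sum over the choices of content `α`. -/
theorem coeff_prod_affine {R : Type*} [CommRing R] (α : K →₀ ℕ) (a : Fin N → R) (b : Fin N → K → R) :
    coeff α (∏ i, (C (a i) + ∑ k, C (b i k) * X k)) =
      ∑ φ : Fin N → Option K, if content φ = α then ∏ i, (φ i).elim (a i) (b i) else 0 := by
  have h1 : ∀ i, (C (a i) + ∑ k, C (b i k) * X k : MvPolynomial K R) =
      ∑ o : Option K, monomial (o.elim 0 fun k => Finsupp.single k 1) (o.elim (a i) (b i)) := by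
    intro i
    rw [Fintype.sum_option]
    simp [C_mul_X_eq_monomial]
  simp only [h1]
  rw [Finset.prod_univ_sum, Fintype.piFinset_univ, coeff_sum]
  refine Finset.sum_congr rfl fun φ _ => ?_
  have h2 : ∏ i, monomial ((φ i).elim 0 fun k => Finsupp.single k 1) ((φ i).elim (a i) (b i)) =
      monomial (content φ) (∏ i, (φ i).elim (a i) (b i)) := by
    rw [content, monomial_sum_index, map_prod, ← Finset.prod_mul_distrib]
    simp [C_mul_monomial]
  rw [h2, coeff_monomial]

/-- The choices of a given content are the rearrangements of one of them. Hence the sum over these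
choices is, up to a factor, a permanent, the rows of which correspond to the values of the chosen
`φ₀`. -/
theorem exists_card_mul_eq_permanent {R : Type*} [CommRing R] (φ₀ : Fin N → Option K)
    (c : Fin N → Option K → R) :
    ∃ s : ℕ, s ≠ 0 ∧ (s : R) * ∑ φ : Fin N → Option K,
      (if content φ = content φ₀ then ∏ i, c i (φ i) else 0) =
        (Matrix.of fun j i => c i (φ₀ j)).permanent := by
  let F : (Fin N → Option K) → Finset (Equiv.Perm (Fin N)) := fun φ =>
    Finset.univ.filter fun σ => φ₀ ∘ σ = φ
  have hF : ∀ φ, (F φ).card = if content φ = content φ₀ then (F φ₀).card else 0 := by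
    intro φ
    split_ifs with h
    · obtain ⟨σ₀, rfl⟩ := exists_perm_of_content_eq h
      symm
      refine Finset.card_equiv (Equiv.mulRight σ₀) fun σ => ?_
      simp only [F, Finset.mem_filter, Finset.mem_univ, true_and, Equiv.coe_mulRight,
        Equiv.Perm.coe_mul, ← Function.comp_assoc]
      exact ⟨fun h => by rw [h], fun h => σ₀.surjective.injective_comp_right h⟩
    · rw [Finset.card_eq_zero, Finset.filter_eq_empty_iff]
      rintro σ - rfl
      exact h (content_comp_perm φ₀ σ)
  refine ⟨(F φ₀).card, Finset.card_ne_zero_of_mem (a := 1) (by simp [F]), ?_⟩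
  rw [Matrix.permanent, ← Finset.sum_fiberwise Finset.univ
    (fun (σ : Equiv.Perm (Fin N)) i => φ₀ (σ i)), Finset.mul_sum]
  refine Finset.sum_congr rfl fun φ _ => ?_
  have h1 : ∀ σ ∈ F φ, ∏ i, (Matrix.of fun j i => c i (φ₀ j)) (σ i) i = ∏ i, c i (φ i) := by
    intro σ hσ
    have : φ₀ ∘ σ = φ := (Finset.mem_filter.mp hσ).2
    subst this
    rfl
  refine Eq.trans ?_ (Finset.sum_congr rfl h1).symm
  rw [Finset.sum_const, hF φ, nsmul_eq_mul]
  split_ifs <;> simp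

end Columns

theorem Rep.exists_permanent {τ : Type*} {N : ℕ} {P : MvPolynomial τ ℂ} (h : Rep N P) :
    ∃ (c : ℂ) (M : Matrix (Fin N) (Fin N) (MvPolynomial τ ℂ)),
      (∀ i j, M i j ∈ affine Set.univ) ∧ P = C c * M.permanent := by
  classical
  obtain ⟨K, hK, α, a, b, ha, rfl⟩ := h
  rw [coeff_prod_affine α a fun i k => C (b i k)]
  by_cases hφ : ∃ φ₀ : Fin N → Option K, content φ₀ = α
  · obtain ⟨φ₀, rfl⟩ := hφ
    obtain ⟨s, hs, h1⟩ := exists_card_mul_eq_permanent φ₀ fun i o => o.elim (a i) fun k => C (b i k)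
    refine ⟨(s : ℂ)⁻¹, Matrix.of fun j i => (φ₀ j).elim (a i) fun k => C (b i k), fun j i => ?_, ?_⟩
    rotate_left
    · rw [← h1, ← mul_assoc, ← map_natCast (C : ℂ →+* MvPolynomial τ ℂ), ← map_mul,
        inv_mul_cancel₀ (Nat.cast_ne_zero.mpr hs), map_one, one_mul]
    · rw [Matrix.of_apply]
      cases φ₀ j with
      | none => exact ha i
      | some k => exact C_mem_affine _
  · refine ⟨0, 0, fun _ _ => Submodule.zero_mem _, ?_⟩
    rw [map_zero, zero_mul]
    exact Finset.sum_eq_zero fun φ _ => if_neg fun h => hφ ⟨φ, h⟩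

/-! ### The permanent is hard for VNP -/

theorem Prog.exists_supported {σ : Type*} {l : List (MvPolynomial σ ℂ)} (h : Prog ArithRule l) :
    ∃ V : Finset σ, V.card ≤ l.length ∧ ∀ p ∈ l, p ∈ supported ℂ (V : Set σ) := by
  classical
  induction h with
  | nil => exact ⟨∅, by simp, by simp⟩
  | @cons l a _ ha ih =>
    obtain ⟨V, hV, hl⟩ := ih
    suffices ∃ W : Finset σ, V ⊆ W ∧ W.card ≤ V.card + 1 ∧ a ∈ supported ℂ (W : Set σ) by
      obtain ⟨W, hVW, hW, ha⟩ := this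
      refine ⟨W, by rw [List.length_cons]; omega, fun p hp => ?_⟩
      rcases List.mem_cons.mp hp with rfl | hp
      · exact ha
      · exact supported_mono (Finset.coe_subset.mpr hVW) (hl p hp)
    rcases ha with ⟨c, rfl⟩ | ⟨x, rfl⟩ | ⟨p, hp, q, hq, rfl⟩ | ⟨p, hp, q, hq, rfl⟩
    · exact ⟨V, subset_rfl, Nat.le_succ _, Subalgebra.algebraMap_mem _ c⟩
    · exact ⟨insert x V, Finset.subset_insert _ _, Finset.card_insert_le _ _,
        X_mem_supported.mpr (by simp)⟩
    · exact ⟨V, subset_rfl, Nat.le_succ _, Subalgebra.add_mem _ (hl p hp) (hl q hq)⟩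
    · exact ⟨V, subset_rfl, Nat.le_succ _, Subalgebra.mul_mem _ (hl p hp) (hl q hq)⟩

theorem aeval_mem_supported {σ τ : Type*} {V : Set σ} {W : Set τ} {p : MvPolynomial σ ℂ}
    (hp : p ∈ supported ℂ V) {θ : σ → MvPolynomial τ ℂ} (hθ : ∀ x ∈ V, θ x ∈ supported ℂ W) :
    aeval θ p ∈ supported ℂ W := by
  rw [aeval_def, eval₂_eq]
  refine Subalgebra.sum_mem _ fun s hs => Subalgebra.mul_mem _ (Subalgebra.algebraMap_mem _ _)
    (Subalgebra.prod_mem _ fun x hx => Subalgebra.pow_mem _ (hθ x ?_) _)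
  exact mem_supported.mp hp ((mem_vars_iff_mem_support x).mpr ⟨s, hs, hx⟩)

theorem aeval_eq_self_of_mem_supported {σ : Type*} {V : Set σ} {p : MvPolynomial σ ℂ}
    (hp : p ∈ supported ℂ V) {θ : σ → MvPolynomial σ ℂ} (hθ : ∀ x ∈ V, θ x = X x) :
    aeval θ p = p := by
  have := hom_congr_vars (f₁ := (aeval θ : _ →ₐ[ℂ] MvPolynomial σ ℂ).toRingHom)
    (f₂ := RingHom.id _) (p₁ := p) (p₂ := p) (by ext1 c; simp)
    (fun x hx _ => by simpa using hθ x (mem_supported.mp hp hx)) rfl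
  simpa using this

theorem permanent_eq_aeval_permSeq {N : ℕ} (M : Matrix (Fin N) (Fin N) A) :
    M.permanent = aeval (fun k => if h : k < N * N then
      M (finProdFinEquiv.symm ⟨k, h⟩).1 (finProdFinEquiv.symm ⟨k, h⟩).2 else 0) (permSeq N) := by
  rw [permSeq, aeval_rename, perm, Matrix.permanent, Matrix.permanent, map_sum]
  refine Finset.sum_congr rfl fun σ _ => ?_
  rw [map_prod]
  refine Finset.prod_congr rfl fun i _ => ?_
  rw [Matrix.mvPolynomialX_apply, aeval_X, Function.comp_apply, dif_pos (finProdFinEquiv _).isLt,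
    Fin.eta, Equiv.symm_apply_apply]

theorem HasSkewProg.C_mul {σ : Type*} {f : MvPolynomial σ ℂ} {n : ℕ} (h : HasSkewProg f n) (c : ℂ) :
    HasSkewProg (C c * f) (n + 1) := by
  obtain ⟨l, hl, hn, hf⟩ := h
  obtain ⟨l', hl', -, hn', hf'⟩ := cost_C_mul (T := {f}) c rfl l hl (by simpa using hf)
  exact ⟨l', hl', by omega, hf' _ rfl⟩

theorem Rep.hasApproxSkewProg {N r : ℕ} {f : A} (h : Rep N f) {V : Finset ℕ}
    (hV : f ∈ supported ℂ (V : Set ℕ)) (hr : HasApproxSkewProg (permSeq N) r) :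
    HasApproxSkewProg f (detCost r V.card + 1) := by
  obtain ⟨c, M, hM, hf⟩ := h.exists_permanent
  let ρ : A →ₐ[ℂ] A := MvPolynomial.aeval fun i => if i ∈ V then X i else 0
  have hρ : ρ f = f := aeval_eq_self_of_mem_supported hV fun x hx => if_pos hx
  have hρM : ∀ i j, ρ (M i j) ∈ affine (V : Set ℕ) := fun i j => by
    refine aeval_mem_affine (s := Set.univ) (fun x _ => ?_) (hM i j)
    split_ifs with hx
    · exact X_mem_affine hx
    · exact Submodule.zero_mem _
  have h1 : f = C c * (ρ.mapMatrix M).permanent := by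
    rw [← hρ, hf, map_mul, algHom_C, algebraMap_eq]
    congr 1
    simp [Matrix.permanent, map_sum, map_prod]
  rw [h1, permanent_eq_aeval_permSeq]
  have h2 := hr.aeval (s := V) (θ := fun k => if h : k < N * N then
    ρ.mapMatrix M (finProdFinEquiv.symm ⟨k, h⟩).1 (finProdFinEquiv.symm ⟨k, h⟩).2 else 0) fun k => by
      split_ifs
      · exact hρM _ _
      · exact Submodule.zero_mem _
  exact h2.map (LinearMap.mulLeft ℂ (C c)) fun g hg => hg.C_mul c

theorem detCost_mono (n : ℕ) {k k' : ℕ} (h : k ≤ k') : detCost n k ≤ detCost n k' := by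
  unfold detCost
  gcongr

/-- Valiant's theorem: the permanent is complete for VNP. -/
theorem VNP_subset_of_permSeq_mem (h : permSeq ∈ VPwsClosure) : VNP ⊆ VPwsClosure := by
  rintro f ⟨p, g, ⟨hs, hd⟩, hf⟩
  let s : ℕ → ℕ := fun n => complexity (g n)
  let d : ℕ → ℕ := fun n => (g n).totalDegree
  let N : ℕ → ℕ := fun n => 1 + s n * (d n * (2 * d n + 3)) * (d n * 5) + p.eval n * (d n + 1)
  let r : ℕ → ℕ := fun m => 2 * approxWsComplexity (permSeq m)
  have hN : PolyBounded N :=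
    ((PolyBounded.const 1).add ((hs.mul (hd.mul (((PolyBounded.const 2).mul hd).add
      (PolyBounded.const 3)))).mul (hd.mul (PolyBounded.const 5)))).add
        ((PolyBounded.eval p).mul (hd.add (PolyBounded.const 1)))
  have hr : PolyBounded r := (PolyBounded.const 2).mul h
  have hbound : PolyBounded fun n => 2 * (detCost (r (N n)) (s n) + 1) :=
    (PolyBounded.const 2).mul ((PolyBounded.detCost (hr.comp hN) hs).add (PolyBounded.const 1))
  refine hbound.mono fun n => ?_
  have h1 : Rep (N n) (f n) := by
    rw [hf n]
    exact (rep_of_complexity (g n) le_rfl).sum_bool _ (HasWeightLE.of_totalDegree_le le_rfl)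
  obtain ⟨l, hl, hlen, hgl⟩ := exists_prog_complexity (g n)
  obtain ⟨V, hV, hsup⟩ := hl.exists_supported
  have h2 : f n ∈ supported ℂ (V.toLeft : Set ℕ) := by
    rw [hf n]
    refine Subalgebra.sum_mem _ fun e _ => aeval_mem_supported (hsup _ hgl) ?_
    rintro (x | i) hx
    · exact X_mem_supported.mpr (by simpa using hx)
    · simp only [Sum.elim_inr]
      split_ifs
      · exact Subalgebra.one_mem _
      · exact Subalgebra.zero_mem _
  have h3 := (h1.hasApproxSkewProg h2 (hasApproxSkewProg_approxWsComplexity _)).approxWsComplexity_le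
  refine h3.trans (Nat.mul_le_mul_left 2 (Nat.add_le_add_right (detCost_mono _ ?_) 1))
  exact V.card_toLeft_le.trans (hV.trans hlen.le)

theorem permSeq_mem_iff_VNP_subset : permSeq ∈ VPwsClosure ↔ VNP ⊆ VPwsClosure :=
  ⟨VNP_subset_of_permSeq_mem, fun h => h permSeq_mem_VNP⟩

end GCT

end

theorem mainTheorem2 :
    (GCT.MulmuleySohoniConjecture ↔ GCT.permSeq ∉ GCT.VPwsClosure) ∧
      (GCT.MulmuleySohoniConjecture ↔ ¬ GCT.VNP ⊆ GCT.VPwsClosure) :=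
  ⟨GCT.conjecture_iff_permSeq_notMem,
    GCT.conjecture_iff_permSeq_notMem.trans (not_congr GCT.permSeq_mem_iff_VNP_subset)⟩
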